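/- Let $(X_i)_{i\in I}$, $I$ countable, be independent standard Gaussian random variables on a probability space $(\Omega,\mathcal F,\mathbb P)$. For $k\ge 1$ call $f(X)$ a cylinder variable of class $\mathcal C^k_b$ if $f$ depends on finitely many coordinates, through a function of class $\mathcal C^k$ whose derivatives of orders $0,\dots,k$ are bounded. On cylinder variables put $$\mathbf L[f(X)]=\sum_i\big(\partial_i^2f-x_i\,\partial_if\big)(X)\quad(\text{class }\mathcal C^2_b),\qquad \Gamma[f(X),f(X)]=\sum_i(\partial_if)^2(X)\quad(\text{class }\mathcal C^1_b).$$ Extend $\mathbf L$ to its closure in $L^2(\mathbb P)$. Extend $\Gamma$ as follows: $F\in L^2(\mathbb P)$ is in the domain of $\Gamma$ if there are cylinder variables $f_n(X)\to F$ in $L^2(\mathbb P)$ of class $\mathcal C^1_b$ with $\mathbb E\,\Gamma[f_n(X)-f_m(X),f_n(X)-f_m(X)]\to0$ as $n,m\to\infty$, and $\Gamma[F,F]$ is then the limit of $\Gamma[f_n(X),f_n(X)]$ in $L^1(\mathbb P)$. **Theorem.** Let $F$ be in the second Wiener chaos, $F\in\mathrm{Ker}(\mathbf L+2\,\mathbf{Id})$,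 with $\mathbb E(F^2)=1$, let $\kappa_4(F)=\mathbb E(F^4)-3$, and let $p\ge1$ be an integer. If $$\kappa_4(F)<\frac{24}{2^p\,(p+1)!},$$ then $F$ is in the domain of $\Gamma$, $\Gamma[F,F]>0$ almost surely, $$\frac1{\Gamma[F,F]}\in L^q(\Omega,\mathcal F,\mathbb P)\quad\text{for every } 0<q<\frac p2,$$ and for every $\varepsilon>0$ $$\mathbb P\big(\Gamma[F,F]<\varepsilon\big)\le\frac{\sqrt{2\,p!}}{2^p}\,\varepsilon^{p/2}.$$ -/

import Mathlib

open MeasureTheory ProbabilityTheory Filter Topology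

namespace WienerChaos

noncomputable section

/-- `f : ℝ^ι → ℝ` is a cylinder function of class `C^k_b`: it depends on finitely many coordinates,
through a function of class `C^k` whose derivatives of orders `0, …, k` are all bounded. -/
def IsCylinder {ι : Type*} (k : ℕ) (f : (ι → ℝ) → ℝ) : Prop :=
  ∃ (s : Finset ι) (g : (s → ℝ) → ℝ),
    ContDiff ℝ k g ∧
    (∀ j ≤ k, ∃ C : ℝ, ∀ y, ‖iteratedFDeriv ℝ j g y‖ ≤ C) ∧
    ∀ x : ι → ℝ, f x = g (fun i => x i)

open Classical in
/-- The partial derivative `∂ᵢ f`. -/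
def partialDeriv {ι : Type*} (i : ι) (f : (ι → ℝ) → ℝ) (x : ι → ℝ) : ℝ :=
  lineDeriv ℝ f x (Pi.single i 1)

/-- The square field `∑ᵢ (∂ᵢ f)²` of a cylinder function (a finite sum). -/
def cylGamma {ι : Type*} (f : (ι → ℝ) → ℝ) (x : ι → ℝ) : ℝ :=
  ∑ᶠ i, (partialDeriv i f x) ^ 2

/-- The Ornstein-Uhlenbeck operator `Δ f - x · ∇ f` on a cylinder function (a finite sum). -/
def cylL {ι : Type*} (f : (ι → ℝ) → ℝ) (x : ι → ℝ) : ℝ :=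
  ∑ᶠ i, (partialDeriv i (partialDeriv i f) x - x i * partialDeriv i f x)

/-- `F` belongs to the domain of the Ornstein-Uhlenbeck operator `L` on `L²(P)` and `L F = G`, where
`L` is the closure in `L²(P) × L²(P)` of the operator `f(X) ↦ (Δ f - x · ∇ f)(X)` defined on
cylinder functions of class `C²_b`. -/
def IsOUImage {ι Ω : Type*} [MeasurableSpace Ω] (X : ι → Ω → ℝ) (P : Measure Ω)
    (F G : Ω → ℝ) : Prop :=
  MemLp F 2 P ∧ MemLp G 2 P ∧
  ∃ f : ℕ → (ι → ℝ) → ℝ, (∀ n, IsCylinder 2 (f n)) ∧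
    Tendsto (fun n => eLpNorm (fun ω => f n (fun i => X i ω) - F ω) 2 P) atTop (𝓝 0) ∧
    Tendsto (fun n => eLpNorm (fun ω => cylL (f n) (fun i => X i ω) - G ω) 2 P) atTop (𝓝 0)

/-- The second Wiener chaos `Ker (L + 2 Id)`. -/
def InSecondChaos {ι Ω : Type*} [MeasurableSpace Ω] (X : ι → Ω → ℝ) (P : Measure Ω)
    (F : Ω → ℝ) : Prop :=
  IsOUImage X P F (fun ω => -2 * F ω)

/-- `F` belongs to the domain of the square field operator (the Malliavin-Sobolev space `𝔻^{1,2}`)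
and `Γ[F,F] = S`: there are cylinder functions of class `C¹_b` with `fₙ(X) → F` in `L²(P)` that are
Cauchy for the energy `E[Γ[f,f]]`, and `S` is the `L¹(P)`-limit of `Γ[fₙ,fₙ](X)`. -/
def IsCarreDuChamp {ι Ω : Type*} [MeasurableSpace Ω] (X : ι → Ω → ℝ) (P : Measure Ω)
    (F S : Ω → ℝ) : Prop :=
  MemLp F 2 P ∧ Integrable S P ∧
  ∃ f : ℕ → (ι → ℝ) → ℝ, (∀ n, IsCylinder 1 (f n)) ∧
    Tendsto (fun n => eLpNorm (fun ω => f n (fun i => X i ω) - F ω) 2 P) atTop (𝓝 0) ∧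
    Tendsto (fun m : ℕ × ℕ => ∫ ω, cylGamma (f m.1 - f m.2) (fun i => X i ω) ∂P) atTop (𝓝 0) ∧
    Tendsto (fun n => eLpNorm (fun ω => cylGamma (f n) (fun i => X i ω) - S ω) 1 P) atTop (𝓝 0)

/-- The fourth cumulant `E[F⁴] - 3` of a random variable with mean zero and variance one. -/
def kappa4 {Ω : Type*} [MeasurableSpace Ω] (P : Measure Ω) (F : Ω → ℝ) : ℝ :=
  (∫ ω, (F ω) ^ 4 ∂P) - 3

end

end WienerChaos

/-! Formally F = ∑ A_ij (X_i X_j - δ_ij) with A symmetric and A_ij = E[F X_i X_j] / 2. If λ_k are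
the eigenvalues of A, then in rotated Gaussian coordinates F = ∑ λ_k (N_k² - 1) and Γ[F,F] = |2AX|²
= 4 ∑ λ_k² N_k². Put μ_k = 2 λ_k². The variance condition says ∑ μ_k = 1, the identity E F⁴ = 48 ∑
λ_k⁴ + 12 (∑ λ_k²)² says κ₄ = 12 ∑ μ_k², and Γ = 2 ∑ μ_k N_k². So the theorem is a small ball
estimate, `measureReal_weightedSq_lt_le`: if ∑ μ_k = 1 and ∑ μ_k² ≤ 2 / (2^p (p+1)!), then P(∑ μ_k
N_k² < x) ≤ √(2 p! x^p / 2^p). It is used at x = ε/2; positivity and negative moments follow from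
the tail bound.

For the small ball estimate the main tool is a Chernoff bound in which s = ∑ μ_k² plays the role of
an inverse number of degrees of freedom: ∏ (1 + c μ_k) ≥ (1 + c s)^(1/s). It suffices for p ≥ 3. For
p = 1, 2 the constants leave little room and x near 1 needs the bound 1 - e^(-x)/2. This one comes
from averaging two independent copies: the average is a mixture ∑ μ_k E_k of exponential variables,
whose tail is log-concave, and a mean-one variable with log-concave tail exceeds x < 1 with
probability at least e^(-x).

The passage to infinitely many variables uses finite blocks only. Testing L F = -2F against cos(r
ξ·X) and sin(r ξ·X) gives a singular ODE in r; its solution identifies the quadratic form with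
matrix A on a block t as the conditional expectation of F given X_t, and likewise 2 ∑_{j∈t} A_ij X_j
as that of the i-th derivative of F, for i in t. Conditional expectations are best L²
approximations, so they converge because the cylinder approximations do, and by Jensen they do not
increase the fourth moment, so the bound on ∑ λ_k⁴ passes to blocks. The mass lost on a finite block
is absorbed by the strictness of the hypothesis on κ₄. -/

namespace WienerChaos

/-! ### One-dimensional Gaussian computations -/

lemma gaussianPDFReal_zero_one (x : ℝ) :
    gaussianPDFReal 0 1 x = (Real.sqrt (2 * Real.pi))⁻¹ * Real.exp (-x ^ 2 / 2) := by
  simp [gaussianPDFReal]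

lemma gaussianPDFReal_zero_one_le (x : ℝ) :
    gaussianPDFReal 0 1 x ≤ (Real.sqrt (2 * Real.pi))⁻¹ := by
  rw [gaussianPDFReal_zero_one]
  refine mul_le_of_le_one_right (by positivity) (Real.exp_le_one_iff.2 ?_)
  nlinarith [sq_nonneg x]

lemma hasDerivAt_gaussianPDFReal_zero_one (x : ℝ) :
    HasDerivAt (gaussianPDFReal 0 1) (-x * gaussianPDFReal 0 1 x) x := by
  have h : HasDerivAt (fun x : ℝ => (Real.sqrt (2 * Real.pi))⁻¹ * Real.exp (-x ^ 2 / 2))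
      ((Real.sqrt (2 * Real.pi))⁻¹ * (Real.exp (-x ^ 2 / 2) * (-(2 * x) / 2))) x := by
    refine (HasDerivAt.exp ?_).const_mul _
    simpa using ((hasDerivAt_pow 2 x).neg.div_const 2)
  have e : gaussianPDFReal 0 1 =
      fun x : ℝ => (Real.sqrt (2 * Real.pi))⁻¹ * Real.exp (-x ^ 2 / 2) :=
    funext gaussianPDFReal_zero_one
  rw [e]
  convert h using 1
  ring

lemma integrable_gaussianReal_zero_one_iff {f : ℝ → ℝ} :
    Integrable f (gaussianReal 0 1) ↔ Integrable (fun x => gaussianPDFReal 0 1 x * f x) := by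
  rw [gaussianReal_of_var_ne_zero 0 one_ne_zero,
    integrable_withDensity_iff_integrable_smul' (measurable_gaussianPDF 0 1)
      (ae_of_all _ fun x => gaussianPDF_lt_top)]
  simp only [toReal_gaussianPDF, smul_eq_mul]

/-- Stein's identity for the standard Gaussian law. -/
lemma integral_deriv_gaussianReal {w w' : ℝ → ℝ} (hd : ∀ x, HasDerivAt w (w' x) x)
    (hw : Integrable w (gaussianReal 0 1)) (hw' : Integrable w' (gaussianReal 0 1))
    (hxw : Integrable (fun x => x * w x) (gaussianReal 0 1)) :
    ∫ x, w' x ∂gaussianReal 0 1 = ∫ x, x * w x ∂gaussianReal 0 1 := by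
  rw [integral_gaussianReal_eq_integral_smul one_ne_zero,
    integral_gaussianReal_eq_integral_smul one_ne_zero, ← sub_eq_zero]
  rw [integrable_gaussianReal_zero_one_iff] at hw hw' hxw
  change (∫ x, gaussianPDFReal 0 1 x * w' x) - ∫ x, gaussianPDFReal 0 1 x * (x * w x) = 0
  rw [← integral_sub hw' hxw]
  refine integral_eq_zero_of_hasDerivAt_of_integrable
    (f := fun x => gaussianPDFReal 0 1 x * w x) (fun x => ?_) (hw'.sub hxw) hw
  exact ((hasDerivAt_gaussianPDFReal_zero_one x).fun_mul (hd x)).congr_deriv (by ring)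

lemma integrable_pow_gaussianReal (n : ℕ) : Integrable (fun x : ℝ => x ^ n) (gaussianReal 0 1) := by
  have h := (memLp_id_gaussianReal (μ := 0) (v := 1) n).integrable_norm_pow' 
  refine h.mono' (by fun_prop) (ae_of_all _ fun x => ?_)
  simp

lemma integral_pow_add_two_gaussianReal (n : ℕ) :
    ∫ x, x ^ (n + 2) ∂gaussianReal 0 1 = (n + 1) * ∫ x, x ^ n ∂gaussianReal 0 1 := by
  have h := integral_deriv_gaussianReal (w := fun x => x ^ (n + 1))
    (w' := fun x => (n + 1) * x ^ n) (fun x => by simpa using hasDerivAt_pow (n + 1) x)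
    (integrable_pow_gaussianReal _) ((integrable_pow_gaussianReal _).const_mul _)
    ((integrable_pow_gaussianReal (n + 2)).congr (ae_of_all _ fun x => by ring))
  rw [integral_const_mul] at h
  rw [h]
  exact integral_congr_ae (ae_of_all _ fun x => by ring)

lemma integral_sq_gaussianReal : ∫ x, x ^ 2 ∂gaussianReal 0 1 = 1 := by
  simpa using integral_pow_add_two_gaussianReal 0

lemma integral_pow_four_gaussianReal : ∫ x, x ^ 4 ∂gaussianReal 0 1 = 3 := by
  have := integral_pow_add_two_gaussianReal 2
  rw [integral_sq_gaussianReal] at this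
  norm_num at this; exact this

lemma integral_pow_six_gaussianReal : ∫ x, x ^ 6 ∂gaussianReal 0 1 = 15 := by
  have := integral_pow_add_two_gaussianReal 4
  rw [integral_pow_four_gaussianReal] at this
  norm_num at this; exact this

lemma integral_pow_eight_gaussianReal : ∫ x, x ^ 8 ∂gaussianReal 0 1 = 105 := by
  have := integral_pow_add_two_gaussianReal 6
  rw [integral_pow_six_gaussianReal] at this
  norm_num at this; exact this

lemma integral_sq_sub_one_gaussianReal : ∫ x, (x ^ 2 - 1) ∂gaussianReal 0 1 = 0 := by
  rw [integral_sub (integrable_pow_gaussianReal 2) (integrable_const _), integral_sq_gaussianReal]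
  simp

lemma integral_sq_sub_one_sq_gaussianReal : ∫ x, (x ^ 2 - 1) ^ 2 ∂gaussianReal 0 1 = 2 := by
  have e : ∀ x : ℝ, (x ^ 2 - 1) ^ 2 = x ^ 4 - 2 * x ^ 2 + 1 := fun x => by ring
  simp_rw [e]
  have h2 := (integrable_pow_gaussianReal 2).const_mul 2
  have h4 := integrable_pow_gaussianReal 4
  rw [integral_add (h4.sub' h2) (integrable_const _), integral_sub h4 h2, integral_const_mul,
    integral_sq_gaussianReal, integral_pow_four_gaussianReal]
  norm_num

lemma integral_sq_sub_one_pow_four_gaussianReal :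
    ∫ x, (x ^ 2 - 1) ^ 4 ∂gaussianReal 0 1 = 60 := by
  have e : ∀ x : ℝ, (x ^ 2 - 1) ^ 4 = x ^ 8 - 4 * x ^ 6 + 6 * x ^ 4 - 4 * x ^ 2 + 1 :=
    fun x => by ring
  simp_rw [e]
  have h2 := (integrable_pow_gaussianReal 2).const_mul 4
  have h4 := (integrable_pow_gaussianReal 4).const_mul 6
  have h6 := (integrable_pow_gaussianReal 6).const_mul 4
  have h8 := integrable_pow_gaussianReal 8
  rw [integral_add (((h8.sub' h6).fun_add h4).sub' h2) (integrable_const _),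
    integral_sub ((h8.sub' h6).fun_add h4) h2, integral_add (h8.sub' h6) h4, integral_sub h8 h6]
  simp only [integral_const_mul, integral_sq_gaussianReal, integral_pow_four_gaussianReal,
    integral_pow_six_gaussianReal, integral_pow_eight_gaussianReal]
  norm_num

lemma integral_exp_neg_mul_sq_gaussianReal {a : ℝ} (ha : 0 ≤ a) :
    ∫ x, Real.exp (-(a * x ^ 2)) ∂gaussianReal 0 1 = (Real.sqrt (1 + 2 * a))⁻¹ := by
  rw [integral_gaussianReal_eq_integral_smul one_ne_zero]
  have e : ∀ x : ℝ, gaussianPDFReal 0 1 x • Real.exp (-(a * x ^ 2)) =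
      (Real.sqrt (2 * Real.pi))⁻¹ * Real.exp (-(a + 1 / 2) * x ^ 2) := fun x => by
    rw [gaussianPDFReal_zero_one, smul_eq_mul, mul_assoc, ← Real.exp_add]
    congr 2; ring
  simp_rw [e]
  rw [integral_const_mul, integral_gaussian, ← Real.sqrt_inv, ← Real.sqrt_inv,
    ← Real.sqrt_mul (by positivity)]
  congr 1
  have := Real.pi_pos
  field_simp
  ring

/-- The interval has length 2√r and the Gaussian density is at most 1/√(2π). -/
lemma measureReal_sq_lt_gaussianReal_le {r : ℝ} (hr : 0 ≤ r) :
    (gaussianReal 0 1).real {x | x ^ 2 < r} ≤ Real.sqrt (2 * r / Real.pi) := by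
  have hset : {x : ℝ | x ^ 2 < r} = Set.Ioo (-Real.sqrt r) (Real.sqrt r) := by
    ext x
    simp [Real.sq_lt]
  have hint := (integrable_gaussianPDFReal 0 1)
  rw [hset, measureReal_def, gaussianReal_apply_eq_integral 0 one_ne_zero,
    ENNReal.toReal_ofReal (integral_nonneg fun x => gaussianPDFReal_nonneg _ _ _)]
  calc ∫ x in Set.Ioo (-Real.sqrt r) (Real.sqrt r), gaussianPDFReal 0 1 x
      ≤ ∫ _ in Set.Ioo (-Real.sqrt r) (Real.sqrt r), (Real.sqrt (2 * Real.pi))⁻¹ :=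
        integral_mono hint.integrableOn (integrable_const _) fun x => gaussianPDFReal_zero_one_le x
    _ = Real.sqrt (2 * r / Real.pi) := by
        simp only [integral_const, MeasurableSet.univ, measureReal_restrict_apply, Set.univ_inter,
          Real.volume_real_Ioo, smul_eq_mul, sub_neg_eq_add]
        rw [max_eq_left (by positivity), ← Real.sqrt_inv]
        rw [show Real.sqrt r + Real.sqrt r = 2 * Real.sqrt r by ring]
        rw [show (2 : ℝ) * Real.sqrt r = Real.sqrt (4 * r) by
          rw [Real.sqrt_mul (by norm_num)]; congr 1
          rw [show (4 : ℝ) = 2 ^ 2 by norm_num, Real.sqrt_sq (by norm_num)], 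
          ← Real.sqrt_mul (by positivity)]
        congr 1
        have := Real.pi_pos
        field_simp
        ring

/-- The standard Gaussian law on `κ → ℝ`. -/
noncomputable abbrev stdNormal (κ : Type*) [Fintype κ] : Measure (κ → ℝ) :=
  Measure.pi fun _ => gaussianReal 0 1

lemma hasLaw_eval_stdNormal {κ : Type*} [Fintype κ] (k : κ) :
    HasLaw (fun y : κ → ℝ => y k) (gaussianReal 0 1) (stdNormal κ) :=
  (measurePreserving_eval (fun _ : κ => gaussianReal 0 1) k).hasLaw

lemma iIndepFun_eval_stdNormal {κ : Type*} [Fintype κ] :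
    iIndepFun (fun (k : κ) (y : κ → ℝ) => y k) (stdNormal κ) :=
  iIndepFun_pi (X := fun _ x => x) (fun _ => aemeasurable_id)

/-! ### Moments of diagonal quadratic forms -/

/-- Adding one independent centred term at a time, every cross term containing a first power
vanishes. The values 2 and 60 are the second and fourth moments of N² - 1; then 12 = 3·2² is the
Gaussian part and 48 = 60 - 12 the fourth cumulant. -/
lemma memLp_sum_and_moments {Ω κ : Type*} [MeasurableSpace Ω] {P : Measure Ω}
    [IsProbabilityMeasure P] {Y : κ → Ω → ℝ} (hY : iIndepFun Y P) (hm : ∀ k, MemLp (Y k) 4 P)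
    (h1 : ∀ k, ∫ ω, Y k ω ∂P = 0) (h2 : ∀ k, ∫ ω, Y k ω ^ 2 ∂P = 2)
    (h4 : ∀ k, ∫ ω, Y k ω ^ 4 ∂P = 60) (l : κ → ℝ) (s : Finset κ) :
    MemLp (fun ω => ∑ k ∈ s, l k * Y k ω) 4 P ∧
    ∫ ω, ∑ k ∈ s, l k * Y k ω ∂P = 0 ∧
    ∫ ω, (∑ k ∈ s, l k * Y k ω) ^ 2 ∂P = 2 * ∑ k ∈ s, l k ^ 2 ∧
    ∫ ω, (∑ k ∈ s, l k * Y k ω) ^ 4 ∂P = 48 * ∑ k ∈ s, l k ^ 4 + 12 * (∑ k ∈ s, l k ^ 2) ^ 2 := by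
  classical
  induction s using Finset.induction_on with
  | empty => simp
  | insert i s hi ih =>
    obtain ⟨hA, hA1, hA2, hA4⟩ := ih
    set A : Ω → ℝ := fun ω => ∑ k ∈ s, l k * Y k ω with hAdef
    set B : Ω → ℝ := fun ω => l i * Y i ω with hBdef
    have hB : MemLp B 4 P := (hm i).const_mul (l i)
    have hind : IndepFun A B P := by
      have h := (hY.comp (fun k x => l k * x) (fun k => by fun_prop)).indepFun_finsetSum_of_notMem₀
        (fun k => by
          have := (hm k).aestronglyMeasurable.aemeasurable
          exact this.const_mul (l k)) hi
      have e : A = ∑ j ∈ s, (fun x => l j * x) ∘ Y j := by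
        ext ω
        simp [hAdef]
      rw [e]
      exact h
    have hpow : ∀ {f : Ω → ℝ}, MemLp f 4 P → ∀ n ≤ 4, Integrable (fun ω => f ω ^ n) P := by
      intro f hf n hn
      have h' : MemLp f n P := hf.mono_exponent (by exact_mod_cast hn)
      refine h'.integrable_norm_pow'.mono' (hf.aestronglyMeasurable.pow n) (ae_of_all _ fun x => ?_)
      simp
    have hmul : ∀ m n, m ≤ 4 → n ≤ 4 → Integrable (fun ω => A ω ^ m * B ω ^ n) P ∧
        ∫ ω, A ω ^ m * B ω ^ n ∂P = (∫ ω, A ω ^ m ∂P) * ∫ ω, B ω ^ n ∂P := by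
      intro m n hm' hn
      have hi2 : IndepFun (fun ω => A ω ^ m) (fun ω => B ω ^ n) P :=
        hind.comp (φ := fun x : ℝ => x ^ m) (ψ := fun x : ℝ => x ^ n) (by fun_prop) (by fun_prop)
      exact ⟨hi2.integrable_mul (hpow hA m hm') (hpow hB n hn),
        hi2.integral_fun_mul_eq_mul_integral (hpow hA m hm').aestronglyMeasurable
          (hpow hB n hn).aestronglyMeasurable⟩
    have hB1 : ∫ ω, B ω ∂P = 0 := by simp [hBdef, integral_const_mul, h1]
    have hB2 : ∫ ω, B ω ^ 2 ∂P = 2 * l i ^ 2 := by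
      simp only [hBdef, mul_pow, integral_const_mul, h2]; ring
    have hB4 : ∫ ω, B ω ^ 4 ∂P = 60 * l i ^ 4 := by
      simp only [hBdef, mul_pow, integral_const_mul, h4]; ring
    have hsum : ∀ ω, ∑ k ∈ insert i s, l k * Y k ω = A ω + B ω := fun ω => by
      rw [Finset.sum_insert hi, add_comm]
    simp only [hsum, Finset.sum_insert hi]
    have hA0 := hpow hA 1 (by norm_num)
    have hB0 := hpow hB 1 (by norm_num)
    simp only [pow_one] at hA0 hB0
    refine ⟨hA.add hB, ?_, ?_, ?_⟩
    · rw [integral_add hA0 hB0, hA1, hB1, add_zero]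
    · have e : ∀ ω, (A ω + B ω) ^ 2 = A ω ^ 2 + 2 * (A ω ^ 1 * B ω ^ 1) + B ω ^ 2 :=
        fun ω => by ring
      simp_rw [e]
      rw [integral_add ((hpow hA 2 (by norm_num)).fun_add ((hmul 1 1 (by norm_num) (by norm_num)).1.const_mul 2))
          (hpow hB 2 (by norm_num)), integral_add (hpow hA 2 (by norm_num))
          ((hmul 1 1 (by norm_num) (by norm_num)).1.const_mul 2), integral_const_mul,
          (hmul 1 1 (by norm_num) (by norm_num)).2, hA2, hB2]
      simp only [pow_one, hA1, hB1]
      ring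
    · have e : ∀ ω, (A ω + B ω) ^ 4 = A ω ^ 4 + 4 * (A ω ^ 3 * B ω ^ 1) + 6 * (A ω ^ 2 * B ω ^ 2)
          + 4 * (A ω ^ 1 * B ω ^ 3) + B ω ^ 4 := fun ω => by ring
      simp_rw [e]
      have i40 := hpow hA 4 le_rfl
      have i04 := hpow hB 4 le_rfl
      obtain ⟨i31, v31⟩ := hmul 3 1 (by norm_num) (by norm_num)
      obtain ⟨i22, v22⟩ := hmul 2 2 (by norm_num) (by norm_num)
      obtain ⟨i13, v13⟩ := hmul 1 3 (by norm_num) (by norm_num)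
      rw [integral_add (((i40.fun_add (i31.const_mul 4)).fun_add (i22.const_mul 6)).fun_add (i13.const_mul 4))
        i04, integral_add ((i40.fun_add (i31.const_mul 4)).fun_add (i22.const_mul 6)) (i13.const_mul 4),
        integral_add (i40.fun_add (i31.const_mul 4)) (i22.const_mul 6),
        integral_add i40 (i31.const_mul 4)]
      simp only [integral_const_mul]
      rw [v31, v22, v13, hA4, hA2, hB4, hB2]
      simp only [pow_one, hA1, hB1]
      ring

lemma memLp_sq_sub_one {Ω : Type*} [MeasurableSpace Ω] {P : Measure Ω} {N : Ω → ℝ}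
    (hN : HasLaw N (gaussianReal 0 1) P) : MemLp (fun ω => N ω ^ 2 - 1) 4 P := by
  have : IsProbabilityMeasure P := hN.isProbabilityMeasure
  have h8 : MemLp (fun x : ℝ => x ^ 2 - 1) 4 (gaussianReal 0 1) := by
    refine MemLp.sub ?_ (memLp_const 1)
    have h := (memLp_id_gaussianReal (μ := 0) (v := 1) 8)
    have h2 := h.norm_rpow_div 2
    have e : (8 : NNReal) / (2 : ENNReal) = 4 := by
      symm; rw [ENNReal.eq_div_iff (by norm_num) (by norm_num)]; norm_num
    rw [e] at h2
    simpa using h2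
  exact MemLp.comp_of_map (hN.map_eq.symm ▸ h8) hN.aemeasurable

lemma moments_diagonal {Ω κ : Type*} [MeasurableSpace Ω] {P : Measure Ω}
    {N : κ → Ω → ℝ} (hN : ∀ k, HasLaw (N k) (gaussianReal 0 1) P) (hi : iIndepFun N P)
    (l : κ → ℝ) (s : Finset κ) :
    MemLp (fun ω => ∑ k ∈ s, l k * (N k ω ^ 2 - 1)) 4 P ∧
    ∫ ω, ∑ k ∈ s, l k * (N k ω ^ 2 - 1) ∂P = 0 ∧
    ∫ ω, (∑ k ∈ s, l k * (N k ω ^ 2 - 1)) ^ 2 ∂P = 2 * ∑ k ∈ s, l k ^ 2 ∧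
    ∫ ω, (∑ k ∈ s, l k * (N k ω ^ 2 - 1)) ^ 4 ∂P =
      48 * ∑ k ∈ s, l k ^ 4 + 12 * (∑ k ∈ s, l k ^ 2) ^ 2 := by
  have : IsProbabilityMeasure P := hi.isProbabilityMeasure
  refine memLp_sum_and_moments (hi.comp (fun _ x => x ^ 2 - 1) fun _ => by fun_prop)
    (fun k => memLp_sq_sub_one (hN k)) (fun k => ?_) (fun k => ?_) (fun k => ?_) l s
  · exact ((hN k).integral_comp (f := fun x => x ^ 2 - 1) (by fun_prop)).trans
      integral_sq_sub_one_gaussianReal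
  · exact ((hN k).integral_comp (f := fun x => (x ^ 2 - 1) ^ 2) (by fun_prop)).trans
      integral_sq_sub_one_sq_gaussianReal
  · exact ((hN k).integral_comp (f := fun x => (x ^ 2 - 1) ^ 4) (by fun_prop)).trans
      integral_sq_sub_one_pow_four_gaussianReal

end WienerChaos

namespace WienerChaos

/-! ### Left tail bounds for weighted sums of squares -/

lemma prod_one_add_ge_one_add_sum {κ : Type*} (s : Finset κ) {a : κ → ℝ} (ha : ∀ k, 0 ≤ a k) :
    1 + ∑ k ∈ s, a k ≤ ∏ k ∈ s, (1 + a k) := by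
  classical
  induction s using Finset.induction_on with
  | empty => simp
  | insert i s hi ih =>
    rw [Finset.sum_insert hi, Finset.prod_insert hi]
    have h := mul_nonneg (ha i) (Finset.sum_nonneg fun k (_ : k ∈ s) => ha k)
    nlinarith [ha i]

/-- For nonnegative weights of sum one, `∏ (1 + c μ_k)` is minimal when all weights are equal. -/
lemma rpow_le_prod_one_add {κ : Type*} [Fintype κ] {μ : κ → ℝ} (hμ : ∀ k, 0 ≤ μ k)
    (hsum : ∑ k, μ k = 1) {c : ℝ} (hc : 0 ≤ c) :
    (1 / ∑ k, μ k ^ 2) * Real.log (1 + c * ∑ k, μ k ^ 2) ≤ ∑ k, Real.log (1 + c * μ k) := by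
  set s := ∑ k, μ k ^ 2 with hs
  have hspos : 0 < s := by
    have h0 : 0 ≤ s := Finset.sum_nonneg fun k _ => sq_nonneg _
    rcases h0.eq_or_lt with h | h
    · exfalso
      have := (Finset.sum_eq_zero_iff_of_nonneg fun k _ => sq_nonneg (μ k)).1 (hs ▸ h.symm)
      have h' : ∑ k, μ k = 0 := Finset.sum_eq_zero fun k hk => by simpa using this k hk
      linarith
    · exact h
  -- Both sides vanish at c = 0, so it is enough to compare their derivatives in c.
  have hd : ∀ x ∈ Set.Ici (0 : ℝ), HasDerivAt
      (fun c => ∑ k, Real.log (1 + c * μ k) - (1 / s) * Real.log (1 + c * s))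
      (∑ k, μ k / (1 + x * μ k) - (1 / s) * (s / (1 + x * s))) x := by
    intro x hx
    have hx : (0 : ℝ) ≤ x := hx
    have aux : ∀ m : ℝ, 0 ≤ m → HasDerivAt (fun c => Real.log (1 + c * m)) (m / (1 + x * m)) x := by
      intro m hm
      have h1 : HasDerivAt (fun c : ℝ => 1 + c * m) m x := by
        simpa using ((hasDerivAt_id x).mul_const m).const_add 1
      exact h1.log (by positivity)
    exact (HasDerivAt.fun_sum fun k _ => aux (μ k) (hμ k)).sub ((aux s hspos.le).const_mul _)
  have hmono : MonotoneOn
      (fun c => ∑ k, Real.log (1 + c * μ k) - (1 / s) * Real.log (1 + c * s)) (Set.Ici 0) := by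
    refine monotoneOn_of_deriv_nonneg (convex_Ici 0)
      (fun x hx => (hd x hx).continuousAt.continuousWithinAt)
      (fun x hx => (hd x (interior_subset hx)).differentiableAt.differentiableWithinAt)
      fun x hx => ?_
    have hx := interior_subset hx
    rw [(hd x hx).deriv, sub_nonneg]
    have hx : (0 : ℝ) ≤ x := hx
    -- Cauchy–Schwarz: 1 = (∑ μ_k)² ≤ ∑ μ_k / (1 + x μ_k) · ∑ μ_k (1 + x μ_k), and the last factor
    -- is 1 + x s. This is the required inequality between the derivatives.
    have hcs := Finset.sum_sq_le_sum_mul_sum_of_sq_le_mul Finset.univ (r := μ)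
      (f := fun k => μ k / (1 + x * μ k)) (g := fun k => μ k * (1 + x * μ k))
      (fun k _ => div_nonneg (hμ k) (by have := hμ k; positivity))
      (fun k _ => by have := hμ k; positivity)
      (fun k _ => by have := hμ k; field_simp; rfl)
    rw [hsum] at hcs
    have e : ∑ k, μ k * (1 + x * μ k) = 1 + x * s := by
      rw [hs, Finset.mul_sum]
      conv_rhs => rw [← hsum]
      rw [← Finset.sum_add_distrib]
      exact Finset.sum_congr rfl fun k _ => by ring
    rw [e] at hcs
    have e2 : 1 / s * (s / (1 + x * s)) = 1 / (1 + x * s) := by field_simp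
    rw [e2, div_le_iff₀ (by positivity)]
    simpa using hcs
  have := hmono (Set.mem_Ici.2 le_rfl) (Set.mem_Ici.2 hc) hc
  simpa using this

section Tail
variable {κ : Type*} [Fintype κ] {μ : κ → ℝ}

lemma integral_exp_neg_weightedSq (hμ : ∀ k, 0 ≤ μ k) (s : Finset κ) {t : ℝ} (ht : 0 ≤ t) :
    ∫ y : κ → ℝ, Real.exp (-(t * ∑ k ∈ s, μ k * y k ^ 2)) ∂stdNormal κ =
      (Real.sqrt (∏ k ∈ s, (1 + 2 * t * μ k)))⁻¹ := by
  classical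
  have e : ∀ y : κ → ℝ, Real.exp (-(t * ∑ k ∈ s, μ k * y k ^ 2)) =
      ∏ k, Real.exp (-((if k ∈ s then t * μ k else 0) * y k ^ 2)) := fun y => by
    rw [← Real.exp_sum]
    congr 1
    rw [Finset.mul_sum, ← Finset.sum_neg_distrib, ← Finset.sum_subset (Finset.subset_univ s)]
    · exact Finset.sum_congr rfl fun k hk => by rw [if_pos hk]; ring
    · exact fun k _ hk => by rw [if_neg hk]; simp
  simp_rw [e]
  rw [integral_fintype_prod_eq_prod (fun k x => Real.exp (-((if k ∈ s then t * μ k else 0) * x ^ 2)))]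
  have e3 : ∀ k, ∫ x, Real.exp (-((if k ∈ s then t * μ k else 0) * x ^ 2)) ∂gaussianReal 0 1 =
      (Real.sqrt (if k ∈ s then 1 + 2 * t * μ k else 1))⁻¹ := fun k => by
    have := hμ k
    rw [integral_exp_neg_mul_sq_gaussianReal (by split_ifs <;> positivity)]
    split_ifs <;> simp [mul_assoc]
  simp_rw [e3]
  rw [Finset.prod_inv_distrib]
  congr 1
  have : ∀ k, Real.sqrt (if k ∈ s then 1 + 2 * t * μ k else 1) =
      if k ∈ s then Real.sqrt (1 + 2 * t * μ k) else 1 := fun k => by split_ifs <;> simp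
  simp_rw [this]
  rw [Finset.prod_ite_mem, Finset.univ_inter, Real.sqrt_prod]
  exact fun k _ => by have := hμ k; positivity

lemma measureReal_weightedSq_lt_le_exp (hμ : ∀ k, 0 ≤ μ k) {t : ℝ} (ht : 0 ≤ t) (x : ℝ) :
    (stdNormal κ).real {y | ∑ k, μ k * y k ^ 2 < x} ≤
      Real.exp (t * x) * (Real.sqrt (∏ k, (1 + 2 * t * μ k)))⁻¹ := by
  have h := measure_le_le_exp_mul_mgf (μ := stdNormal κ) (X := fun y : κ → ℝ => ∑ k, μ k * y k ^ 2)
    x (t := -t) (by linarith) (by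
      refine Integrable.mono' (integrable_const 1) (Measurable.aestronglyMeasurable (by fun_prop)) (ae_of_all _ fun y => ?_)
      rw [Real.norm_eq_abs, Real.abs_exp, Real.exp_le_one_iff, neg_mul, neg_nonpos]
      exact mul_nonneg ht (Finset.sum_nonneg fun k _ => mul_nonneg (hμ k) (sq_nonneg _)))
  rw [← integral_exp_neg_weightedSq hμ Finset.univ ht]
  simp only [mgf, neg_neg, neg_mul] at h
  refine (measureReal_mono fun y hy => ?_).trans h
  simp only [Set.mem_ofPred_eq] at hy ⊢
  exact hy.le

/-- A Chernoff bound governed by `∑ μ_k ^ 2`. -/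
lemma measureReal_weightedSq_lt_le_rpow (hμ : ∀ k, 0 ≤ μ k) (hsum : ∑ k, μ k = 1) {m x : ℝ}
    (hm : m * ∑ k, μ k ^ 2 ≤ 1) (hx : 0 < x) (hx1 : x ≤ 1) :
    (stdNormal κ).real {y | ∑ k, μ k * y k ^ 2 < x} ≤
      Real.exp (m / 2 * (Real.log x + 1 - x)) := by
  set s := ∑ k, μ k ^ 2 with hs
  have hspos : 0 < s := by
    have h0 : 0 ≤ s := Finset.sum_nonneg fun k _ => sq_nonneg _
    rcases h0.eq_or_lt with h | h
    · exfalso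
      have := (Finset.sum_eq_zero_iff_of_nonneg fun k _ => sq_nonneg (μ k)).1 (hs ▸ h.symm)
      have h' : ∑ k, μ k = 0 := Finset.sum_eq_zero fun k hk => by simpa using this k hk
      linarith
    · exact h
  have hlog : Real.log x + 1 - x ≤ 0 := by linarith [Real.log_le_sub_one_of_pos hx]
  have hm' : m ≤ 1 / s := by rwa [le_div_iff₀ hspos]
  -- The minimiser of e^(tx) (1 + 2ts)^(-1/(2s)), characterised by 1 + 2ts = 1/x.
  set t := (1 / x - 1) / (2 * s) with ht
  have ht0 : 0 ≤ t := by
    have : 1 ≤ 1 / x := by rw [le_div_iff₀ hx]; linarith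
    exact div_nonneg (by linarith) (by positivity)
  refine (measureReal_weightedSq_lt_le_exp hμ ht0 x).trans ?_
  have hprod : 0 < ∏ k, (1 + 2 * t * μ k) :=
    Finset.prod_pos fun k _ => by have := hμ k; positivity
  rw [← Real.exp_log (inv_pos.2 (Real.sqrt_pos.2 hprod)), ← Real.exp_add, Real.exp_le_exp,
    Real.log_inv, Real.log_sqrt hprod.le, Real.log_prod fun k _ => by have := hμ k; positivity]
  have h1 := rpow_le_prod_one_add hμ hsum (c := 2 * t) (by positivity)
  rw [← hs] at h1
  have e : 1 + 2 * t * s = x⁻¹ := by rw [ht]; field_simp; ring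
  rw [e, Real.log_inv] at h1
  have e2 : t * x = (1 / s) / 2 * (1 - x) := by rw [ht]; field_simp
  -- Since log x + 1 - x ≤ 0, replacing 1/s by the smaller m only weakens the bound.
  have h2 : 1 / s / 2 * (Real.log x + 1 - x) ≤ m / 2 * (Real.log x + 1 - x) := by
    nlinarith
  rw [e2]
  refine le_trans ?_ h2
  linarith

/-- Cantelli's one-sided Chebyshev inequality for the centred variable Z = ∑ μ_k (N_k² - 1), whose
variance is v = 2 ∑ μ_k². -/
lemma measureReal_weightedSq_lt_le_variance (hsum : ∑ k, μ k = 1) {x : ℝ} (hx : x < 1) :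
    (stdNormal κ).real {y | ∑ k, μ k * y k ^ 2 < x} ≤
      2 * (∑ k, μ k ^ 2) / (2 * (∑ k, μ k ^ 2) + (1 - x) ^ 2) := by
  set v := 2 * ∑ k, μ k ^ 2 with hv
  have hv0 : 0 ≤ v := by have := Finset.sum_nonneg fun k (_ : k ∈ Finset.univ) => sq_nonneg (μ k); positivity
  obtain ⟨h4, h1, h2, -⟩ := moments_diagonal (P := stdNormal κ) hasLaw_eval_stdNormal
    iIndepFun_eval_stdNormal μ Finset.univ
  set Z : (κ → ℝ) → ℝ := fun y => ∑ k, μ k * (y k ^ 2 - 1) with hZ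
  have hZQ : ∀ y : κ → ℝ, ∑ k, μ k * y k ^ 2 = Z y + 1 := fun y => by
    conv_rhs => rw [← hsum]
    rw [hZ, ← Finset.sum_add_distrib]
    exact Finset.sum_congr rfl fun k _ => by ring
  have hZ2 : Integrable (fun y => Z y ^ 2) (stdNormal κ) :=
    (h4.mono_exponent (p := 2) (by norm_num)).integrable_sq
  have hZ1 : Integrable Z (stdNormal κ) := h4.integrable (by norm_num)
  set b := 1 - x with hb
  have hb0 : 0 < b := by linarith
  have hden : 0 < v + b ^ 2 := by positivity
  -- The shift minimising the Markov bound (v + c²) / (b + c)² for the event Z < -b.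
  set c := v / b with hc
  have hc0 : 0 ≤ c := by positivity
  have hint : ∫ y, (Z y - c) ^ 2 ∂stdNormal κ = v + c ^ 2 := by
    have e : ∀ y, (Z y - c) ^ 2 = Z y ^ 2 - 2 * c * Z y + c ^ 2 := fun y => by ring
    simp_rw [e]
    rw [integral_add (hZ2.sub' (hZ1.const_mul _)) (integrable_const _),
      integral_sub hZ2 (hZ1.const_mul _), integral_const_mul, h1, h2]
    simp [hv]
  have hmk := mul_meas_ge_le_integral_of_nonneg (μ := stdNormal κ) (f := fun y => (Z y - c) ^ 2)
    (ae_of_all _ fun y => sq_nonneg _) (by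
      have e : ∀ y, (Z y - c) ^ 2 = Z y ^ 2 - 2 * c * Z y + c ^ 2 := fun y => by ring
      simp_rw [e]
      exact (hZ2.sub' (hZ1.const_mul _)).fun_add (integrable_const _)) ((b + c) ^ 2)
  rw [hint] at hmk
  have hsub : (stdNormal κ).real {y | ∑ k, μ k * y k ^ 2 < x} ≤
      (stdNormal κ).real {y | (b + c) ^ 2 ≤ (Z y - c) ^ 2} := by
    refine measureReal_mono fun y hy => ?_
    simp only [Set.mem_ofPred_eq, hZQ] at hy ⊢
    nlinarith
  rw [le_div_iff₀ hden]
  have hq := mul_le_mul_of_nonneg_left hsub (sq_nonneg (b + c))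
  have hk : (b + c) ^ 2 * (stdNormal κ).real {y | ∑ k, μ k * y k ^ 2 < x} ≤ v + c ^ 2 := hq.trans hmk
  have hbc : b * c = v := by rw [hc]; field_simp
  have e1 : b ^ 2 * (v + c ^ 2) = v * (b ^ 2 + v) := by rw [← hbc]; ring
  have e2 : b ^ 2 * (b + c) ^ 2 = (b ^ 2 + v) ^ 2 := by rw [← hbc]; ring
  have h5 := mul_le_mul_of_nonneg_left hk (sq_nonneg b)
  rw [e1, ← mul_assoc, e2] at h5
  have hpos : 0 < b ^ 2 + v := by linarith
  refine le_of_mul_le_mul_left ?_ hpos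
  nlinarith [h5]

/-- A bound exploiting the bounded density of the root of a single coordinate. -/
lemma measureReal_weightedSq_lt_le_of_coordinate (hμ : ∀ k, 0 ≤ μ k) (hsum : ∑ k, μ k = 1) {x : ℝ}
    (hx : 0 < x) (k : κ) (hk : 0 < μ k) :
    (stdNormal κ).real {y | ∑ k, μ k * y k ^ 2 < x} ≤
      Real.sqrt (2 * x / (Real.pi * μ k)) * (Real.sqrt (1 + (1 - μ k) / x))⁻¹ := by
  classical
  -- The coordinate k is integrated first, with the remaining sum R frozen; R is independent of it.
  set R : (κ → ℝ) → ℝ := fun y => ∑ j ∈ Finset.univ.erase k, μ j * y j ^ 2 with hR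
  have hQ : ∀ y : κ → ℝ, ∑ j, μ j * y j ^ 2 = μ k * y k ^ 2 + R y := fun y => by
    rw [hR, ← Finset.add_sum_erase _ _ (Finset.mem_univ k)]
  have hR0 : ∀ y, 0 ≤ R y := fun y => Finset.sum_nonneg fun j _ => mul_nonneg (hμ j) (sq_nonneg _)
  have hRm : Measurable R := by fun_prop
  have hind : IndepFun R (fun y : κ → ℝ => y k) (stdNormal κ) := by
    have h := (iIndepFun_eval_stdNormal (κ := κ)).indepFun_finset (Finset.univ.erase k) {k}
      (by simp) (fun i => by fun_prop)
    have hψ : Measurable fun z : (({k} : Finset κ) : Type _) → ℝ => z ⟨k, by simp⟩ :=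
      measurable_pi_apply _
    have h2 := h.comp
      (φ := fun z : ((Finset.univ.erase k : Finset κ) : Type _) → ℝ => ∑ j : (Finset.univ.erase k : Finset κ), μ j * z j ^ 2)
      (ψ := fun z : (({k} : Finset κ) : Type _) → ℝ => z ⟨k, by simp⟩) (by fun_prop) hψ
    have e : R = (fun z : ((Finset.univ.erase k : Finset κ) : Type _) → ℝ => ∑ j : (Finset.univ.erase k : Finset κ), μ j * z j ^ 2) ∘
        fun y j => y j := by
      ext y
      exact (Finset.sum_coe_sort (Finset.univ.erase k) fun j => μ j * y j ^ 2).symm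
    rw [e]
    exact h2
  have hmap : HasLaw (fun y : κ → ℝ => (R y, y k))
      (((stdNormal κ).map R).prod (gaussianReal 0 1)) (stdNormal κ) :=
    hind.hasLaw_prod ⟨hRm.aemeasurable, rfl⟩ (hasLaw_eval_stdNormal k)
  have : IsProbabilityMeasure ((stdNormal κ).map R) :=
    Measure.isProbabilityMeasure_map hRm.aemeasurable
  have hset : MeasurableSet {z : ℝ × ℝ | μ k * z.2 ^ 2 + z.1 < x} :=
    measurableSet_lt (by fun_prop) (by fun_prop)
  have h1 : (stdNormal κ).real {y | ∑ k, μ k * y k ^ 2 < x} =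
      ∫ r, (gaussianReal 0 1).real {z | μ k * z ^ 2 + r < x} ∂((stdNormal κ).map R) := by
    simp_rw [hQ]
    rw [hmap.measureReal_eq (p := fun z : ℝ × ℝ => μ k * z.2 ^ 2 + z.1 < x) hset,
      measureReal_def, Measure.prod_apply hset, integral_eq_lintegral_of_nonneg_ae
        (ae_of_all _ fun r => measureReal_nonneg)]
    · congr 1
      refine lintegral_congr fun r => ?_
      rw [ofReal_measureReal]
      rfl
    · exact (measurable_measure_prodMk_left hset).ennreal_toReal.aestronglyMeasurable
  -- For r ≥ x the event is empty. Otherwise the density bound gives √(2(x - r)/(π μ_k)), and 1 -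
  -- r/x ≤ e^(-r/x) makes the dependence on r exponential, so that integrating over R yields a
  -- Laplace transform.
  have h2 : ∀ r, 0 ≤ r → (gaussianReal 0 1).real {z | μ k * z ^ 2 + r < x} ≤
      Real.sqrt (2 * x / (Real.pi * μ k)) * Real.exp (-(1 / (2 * x) * r)) := by
    intro r hr
    rcases le_or_gt x r with h | h
    · have : {z : ℝ | μ k * z ^ 2 + r < x} = ∅ := by
        ext z
        simp only [Set.mem_ofPred_eq, Set.mem_empty_iff_false, iff_false, not_lt]
        nlinarith [mul_nonneg hk.le (sq_nonneg z)]
      rw [this]; simp; positivity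
    · have e : {z : ℝ | μ k * z ^ 2 + r < x} = {z | z ^ 2 < (x - r) / μ k} := by
        ext z
        simp only [Set.mem_ofPred_eq, lt_div_iff₀ hk]
        constructor <;> intro _ <;> linarith
      rw [e]
      refine (measureReal_sq_lt_gaussianReal_le (div_nonneg (by linarith) hk.le)).trans ?_
      have e2 : Real.exp (-(1 / (2 * x) * r)) = Real.sqrt (Real.exp (-(r / x))) := by
        rw [← Real.exp_half]; congr 1; field_simp
      rw [e2, ← Real.sqrt_mul (by positivity)]
      refine Real.sqrt_le_sqrt ?_
      have h3 := Real.add_one_le_exp (-(r / x))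
      have e3 : 2 * ((x - r) / μ k) / Real.pi = 2 * x / (Real.pi * μ k) * (-(r / x) + 1) := by
        have := Real.pi_pos
        field_simp; ring
      rw [e3]
      exact mul_le_mul_of_nonneg_left h3 (by positivity)
  have hexpint : Integrable (fun y => Real.exp (-(1 / (2 * x) * R y))) (stdNormal κ) := by
    refine Integrable.mono' (integrable_const 1) (Measurable.aestronglyMeasurable (by fun_prop)) (ae_of_all _ fun y => ?_)
    rw [Real.norm_eq_abs, Real.abs_exp, Real.exp_le_one_iff, neg_nonpos]
    exact mul_nonneg (by positivity) (hR0 y)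
  rw [h1, integral_map hRm.aemeasurable
    (show Measurable fun r => (gaussianReal 0 1).real {z | μ k * z ^ 2 + r < x} from
      (measurable_measure_prodMk_left hset).ennreal_toReal).aestronglyMeasurable]
  calc ∫ y, (gaussianReal 0 1).real {z | μ k * z ^ 2 + R y < x} ∂stdNormal κ
      ≤ ∫ y, Real.sqrt (2 * x / (Real.pi * μ k)) * Real.exp (-(1 / (2 * x) * R y)) ∂stdNormal κ := by
        refine integral_mono_of_nonneg (ae_of_all _ fun y => measureReal_nonneg)
          (hexpint.const_mul _) (ae_of_all _ fun y => h2 _ (hR0 y))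
    _ ≤ _ := by
        rw [integral_const_mul, integral_exp_neg_weightedSq hμ _ (by positivity)]
        refine mul_le_mul_of_nonneg_left ?_ (by positivity)
        have hpos : 0 < 1 + (1 - μ k) / x := by
          have : μ k ≤ 1 := hsum ▸ Finset.single_le_sum (fun j _ => hμ j) (Finset.mem_univ k)
          have := div_nonneg (by linarith : 0 ≤ 1 - μ k) hx.le
          linarith
        refine inv_anti₀ (Real.sqrt_pos.2 hpos) (Real.sqrt_le_sqrt ?_)
        -- The Laplace transform of R at 1/(2x) is ∏ (1 + μ_j/x)^(-1/2); keeping only the linear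
        -- terms of the product leaves the total remaining weight 1 - μ_k.
        have h5 := prod_one_add_ge_one_add_sum (Finset.univ.erase k)
          (a := fun j => 2 * (1 / (2 * x)) * μ j) (fun j => by have := hμ j; positivity)
        refine le_trans (le_of_eq ?_) h5
        have h6 : ∑ j ∈ Finset.univ.erase k, μ j = 1 - μ k := by
          rw [← hsum, ← Finset.add_sum_erase _ _ (Finset.mem_univ k)]; ring
        rw [← Finset.mul_sum, h6]
        field_simp

end Tail
end WienerChaos

namespace WienerChaos

/-! ### Log-concave tails and sums of exponential variables -/

/-- Multiplicative form of log-concavity. -/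
def IsLogConcaveMul (G : ℝ → ENNReal) : Prop :=
  ∀ p a b : ℝ, 0 ≤ a → 0 ≤ b → G p * G (p + a + b) ≤ G (p + a) * G (p + b)

lemma IsLogConcaveMul.comp_mul {G : ℝ → ENNReal} (hG : IsLogConcaveMul G) {c : ℝ} (hc : 0 ≤ c) :
    IsLogConcaveMul fun x => G (c * x) := by
  intro p a b ha hb
  have h := hG (c * p) (c * a) (c * b) (mul_nonneg hc ha) (mul_nonneg hc hb)
  simpa only [mul_add] using h

lemma lintegral_Ioi_sub_add {g : ℝ → ENNReal} (x : ℝ) {h : ℝ} (hh : 0 ≤ h) :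
    ∫⁻ z in Set.Ioi (0 : ℝ), g (x + h - z) =
      (∫⁻ z in Set.Ioc 0 h, g (x + h - z)) + ∫⁻ z in Set.Ioi (0 : ℝ), g (x - z) := by
  nth_rw 1 [← Set.Ioc_union_Ioi_eq_Ioi hh]
  rw [lintegral_union measurableSet_Ioi (Set.Ioc_disjoint_Ioi le_rfl)]
  congr 1
  rw [← lintegral_indicator measurableSet_Ioi, ← lintegral_indicator measurableSet_Ioi,
    ← lintegral_add_right_eq_self _ h]
  refine lintegral_congr fun z => ?_
  by_cases hz : 0 < z
  · rw [Set.indicator_of_mem (by simpa using hz), Set.indicator_of_mem (by simpa using hz)]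
    congr 1; ring
  · rw [Set.indicator_of_notMem (by simpa using hz), Set.indicator_of_notMem (by simpa using hz)]

/-- The primitive of a log-concave function is log-concave. -/
lemma IsLogConcaveMul.lintegral_Ioi_sub {g : ℝ → ENNReal} (hg : IsLogConcaveMul g)
    (hm : Measurable g) : IsLogConcaveMul fun x => ∫⁻ z in Set.Ioi (0 : ℝ), g (x - z) := by
  intro x h b hh hb
  beta_reduce
  have e1 : x + h + b = (x + b) + h := by ring
  -- With I the primitive, I(x+h+b) and I(x+h) are each written as a slice of length h plus I(x+b),
  -- respectively I(x). The common product I(x) I(x+b) drops out, and the slices are compared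
  -- pointwise under the double integral, where z ≤ h gives the ordering needed by log-concavity of
  -- g.
  rw [e1, lintegral_Ioi_sub_add (x + b) hh, lintegral_Ioi_sub_add x hh, mul_add, add_mul]
  refine add_le_add ?_ le_rfl
  rw [mul_comm, ← lintegral_lintegral_mul (Measurable.aemeasurable (by fun_prop))
      (Measurable.aemeasurable (by fun_prop)),
    ← lintegral_lintegral_mul (Measurable.aemeasurable (by fun_prop))
      (Measurable.aemeasurable (by fun_prop))]
  refine setLIntegral_mono' measurableSet_Ioc fun z hz =>
    setLIntegral_mono' measurableSet_Ioi fun z' hz' => ?_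
  have hz' : (0 : ℝ) < z' := hz'
  have key := hg (x - z') (h - z + z') b (by linarith [hz.2]) hb
  calc g (x + b + h - z) * g (x - z') = g (x - z') * g (x - z' + (h - z + z') + b) := by
        rw [mul_comm]; congr 2; ring
    _ ≤ g (x - z' + (h - z + z')) * g (x - z' + b) := key
    _ = g (x + h - z) * g (x + b - z') := by congr 2 <;> ring

lemma IsLogConcaveMul.ofReal_exp_mul {G : ℝ → ENNReal} (hG : IsLogConcaveMul G) (c : ℝ) :
    IsLogConcaveMul fun x => ENNReal.ofReal (Real.exp (c * x)) * G x := by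
  intro p a b ha hb
  have h := hG p a b ha hb
  have e : ENNReal.ofReal (Real.exp (c * p)) * ENNReal.ofReal (Real.exp (c * (p + a + b))) =
      ENNReal.ofReal (Real.exp (c * (p + a))) * ENNReal.ofReal (Real.exp (c * (p + b))) := by
    rw [← ENNReal.ofReal_mul (Real.exp_nonneg _), ← ENNReal.ofReal_mul (Real.exp_nonneg _),
      ← Real.exp_add, ← Real.exp_add]
    congr 2; ring
  calc _ = (ENNReal.ofReal (Real.exp (c * p)) * ENNReal.ofReal (Real.exp (c * (p + a + b)))) *
        (G p * G (p + a + b)) := by ring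
    _ ≤ (ENNReal.ofReal (Real.exp (c * (p + a))) * ENNReal.ofReal (Real.exp (c * (p + b)))) *
        (G (p + a) * G (p + b)) := by rw [e]; gcongr
    _ = _ := by ring

/-- ∫ e^(-z) G(x - z) dz = e^(-x) ∫ e^(x-z) G(x - z) dz, so convolution with the exponential law is
a primitive taken between two multiplications by exponentials, each of which preserves
log-concavity. -/
lemma IsLogConcaveMul.lintegral_exp {G : ℝ → ENNReal} (hG : IsLogConcaveMul G)
    (hm : Measurable G) : IsLogConcaveMul fun x =>
      ∫⁻ z in Set.Ioi (0 : ℝ), ENNReal.ofReal (Real.exp (-z)) * G (x - z) := by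
  have h := ((hG.ofReal_exp_mul 1).lintegral_Ioi_sub (by fun_prop)).ofReal_exp_mul (-1)
  convert! h using 2 with x
  rw [← lintegral_const_mul _ (by fun_prop)]
  refine lintegral_congr fun z => ?_
  rw [← mul_assoc, ← ENNReal.ofReal_mul (Real.exp_nonneg _), ← Real.exp_add]
  congr 3; ring

/-- For c > 0 the variable x is rescaled by c. For c = 0, which must be covered because a weight may
vanish, the integral is a constant multiple of G. -/
lemma IsLogConcaveMul.lintegral_exp_mul {G : ℝ → ENNReal} (hG : IsLogConcaveMul G)
    (hm : Measurable G) {c : ℝ} (hc : 0 ≤ c) : IsLogConcaveMul fun x =>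
      ∫⁻ z in Set.Ioi (0 : ℝ), ENNReal.ofReal (Real.exp (-z)) * G (x - c * z) := by
  rcases hc.eq_or_lt with rfl | hc
  · intro p a b ha hb
    simp only [zero_mul, sub_zero]
    rw [lintegral_mul_const _ (by fun_prop), lintegral_mul_const _ (by fun_prop),
      lintegral_mul_const _ (by fun_prop), lintegral_mul_const _ (by fun_prop)]
    calc _ = (∫⁻ z in Set.Ioi (0 : ℝ), ENNReal.ofReal (Real.exp (-z))) *
          (∫⁻ z in Set.Ioi (0 : ℝ), ENNReal.ofReal (Real.exp (-z))) * (G p * G (p + a + b)) := by ring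
      _ ≤ (∫⁻ z in Set.Ioi (0 : ℝ), ENNReal.ofReal (Real.exp (-z))) *
          (∫⁻ z in Set.Ioi (0 : ℝ), ENNReal.ofReal (Real.exp (-z))) * (G (p + a) * G (p + b)) := by
            exact mul_le_mul_right (hG p a b ha hb) _
      _ = _ := by ring
  · have h := ((hG.comp_mul hc.le).lintegral_exp (by fun_prop)).comp_mul (inv_nonneg.2 hc.le)
    have e : ∀ x z : ℝ, c * (c⁻¹ * x - z) = x - c * z := fun x z => by field_simp
    simp only [e] at h
    exact h

/-- The law of half the sum of the squares of two independent standard Gaussian variables. -/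
lemma lintegral_half_sq_add_sq {f : ℝ → ENNReal} (hf : Measurable f) :
    ∫⁻ z : ℝ × ℝ, f ((z.1 ^ 2 + z.2 ^ 2) / 2) ∂((gaussianReal 0 1).prod (gaussianReal 0 1)) =
      ∫⁻ z in Set.Ioi (0 : ℝ), ENNReal.ofReal (Real.exp (-z)) * f z := by
  have hw : ∀ g : ℝ → ENNReal, Measurable g → ∫⁻ x, g x ∂gaussianReal 0 1 =
      ∫⁻ x, gaussianPDF 0 1 x * g x := fun g hg => by
    rw [gaussianReal_of_var_ne_zero 0 one_ne_zero,
      lintegral_withDensity_eq_lintegral_mul _ (measurable_gaussianPDF 0 1) hg]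
    rfl
  have hpdf := measurable_gaussianPDF 0 1
  have hw2 : ∀ x : ℝ, ∫⁻ y, f ((x ^ 2 + y ^ 2) / 2) ∂gaussianReal 0 1 =
      ∫⁻ y, gaussianPDF 0 1 y * f ((x ^ 2 + y ^ 2) / 2) := fun x => hw _ (by fun_prop)
  rw [lintegral_prod _ (Measurable.aemeasurable (by fun_prop))]
  simp_rw [hw2]
  rw [hw _ (by fun_prop)]
  have e1 : ∀ x, gaussianPDF 0 1 x * ∫⁻ y, gaussianPDF 0 1 y * f ((x ^ 2 + y ^ 2) / 2) =
      ∫⁻ y, ENNReal.ofReal ((2 * Real.pi)⁻¹ * Real.exp (-((x ^ 2 + y ^ 2) / 2))) *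
        f ((x ^ 2 + y ^ 2) / 2) := fun x => by
    rw [← lintegral_const_mul _ (by fun_prop)]
    refine lintegral_congr fun y => ?_
    rw [← mul_assoc, gaussianPDF, gaussianPDF, ← ENNReal.ofReal_mul (gaussianPDFReal_nonneg _ _ _),
      gaussianPDFReal_zero_one, gaussianPDFReal_zero_one]
    congr 2
    rw [mul_mul_mul_comm, ← Real.exp_add, ← mul_inv, Real.mul_self_sqrt (by positivity)]
    congr 2; ring
  simp_rw [e1]
  rw [← lintegral_prod (fun z : ℝ × ℝ =>
    ENNReal.ofReal ((2 * Real.pi)⁻¹ * Real.exp (-((z.1 ^ 2 + z.2 ^ 2) / 2))) *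
        f ((z.1 ^ 2 + z.2 ^ 2) / 2)) (Measurable.aemeasurable (by fun_prop)),
    ← Measure.volume_eq_prod, ← lintegral_comp_polarCoord_symm]
  have e2 : ∀ q : ℝ × ℝ, (polarCoord.symm q).1 ^ 2 + (polarCoord.symm q).2 ^ 2 = q.1 ^ 2 := fun q => by
    simp only [polarCoord_symm_apply]
    linear_combination q.1 ^ 2 * Real.sin_sq_add_cos_sq q.2
  simp_rw [e2]
  rw [polarCoord_target, Measure.volume_eq_prod, setLIntegral_prod _ (Measurable.aemeasurable (by fun_prop))]
  have himg : (fun r : ℝ => r ^ 2 / 2) '' Set.Ioi 0 = Set.Ioi 0 := by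
    ext z
    constructor
    · rintro ⟨r, hr, rfl⟩
      have hr : (0 : ℝ) < r := hr
      exact Set.mem_Ioi.2 (by positivity)
    · intro hz
      have hz : (0 : ℝ) < z := hz
      exact ⟨Real.sqrt (2 * z), Set.mem_Ioi.2 (by positivity), by
        beta_reduce; rw [Real.sq_sqrt (by positivity)]; ring⟩
  -- The substitution z = r²/2 has derivative r, exactly the polar Jacobian; the angular integral 2π
  -- cancels the Gaussian normalisation.
  have hcv := lintegral_image_eq_lintegral_abs_deriv_mul (f := fun r : ℝ => r ^ 2 / 2)
    (f' := fun r => r) (s := Set.Ioi 0) measurableSet_Ioi (fun r _ => by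
      refine HasDerivAt.hasDerivWithinAt ?_
      exact ((hasDerivAt_pow 2 r).div_const 2).congr_deriv (by simp)) (by
      intro a ha b hb hab
      have ha : (0 : ℝ) < a := ha
      have hb : (0 : ℝ) < b := hb
      have hab : a ^ 2 / 2 = b ^ 2 / 2 := hab
      nlinarith) (fun z => ENNReal.ofReal (Real.exp (-z)) * f z)
  rw [himg] at hcv
  rw [hcv]
  refine setLIntegral_congr_fun measurableSet_Ioi fun r hr => ?_
  have hr : (0 : ℝ) < r := hr
  dsimp only
  rw [setLIntegral_const, smul_eq_mul, Real.volume_Ioo, abs_of_pos hr,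
    show Real.pi - -Real.pi = 2 * Real.pi by ring, mul_comm, ← mul_assoc, ← mul_assoc, ← mul_assoc,
    ← ENNReal.ofReal_mul (by positivity), ← ENNReal.ofReal_mul (by positivity),
    ← ENNReal.ofReal_mul (by positivity)]
  congr 2
  have := Real.pi_pos
  field_simp

/-- The tail of the empty sum, where the induction on the number of exponential terms starts. -/
lemma isLogConcaveMul_ite_nonpos : IsLogConcaveMul fun x : ℝ => if x ≤ 0 then 1 else 0 := by
  intro p a b ha hb
  by_cases h : p + a + b ≤ 0
  · simp [h, show p ≤ 0 by linarith, show p + a ≤ 0 by linarith, show p + b ≤ 0 by linarith]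
  · simp [h]

/-- The tail of a nonnegative combination of independent standard exponential variables is
log-concave. -/
lemma isLogConcaveMul_tail_sum_exponential {Ω κ : Type*} [MeasurableSpace Ω] {P : Measure Ω}
    [IsProbabilityMeasure P] {E : κ → Ω → ℝ} (hE : iIndepFun E P) (hm : ∀ k, Measurable (E k))
    (hlaw : ∀ k, ∀ f : ℝ → ENNReal, Measurable f →
      ∫⁻ ω, f (E k ω) ∂P = ∫⁻ z in Set.Ioi (0 : ℝ), ENNReal.ofReal (Real.exp (-z)) * f z)
    {μ : κ → ℝ} (hμ : ∀ k, 0 ≤ μ k) (s : Finset κ) :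
    IsLogConcaveMul fun x => P {ω | x ≤ ∑ k ∈ s, μ k * E k ω} := by
  classical
  induction s using Finset.induction_on with
  | empty =>
    convert! isLogConcaveMul_ite_nonpos using 2 with x
    by_cases h : x ≤ 0 <;> simp [h]
  | insert i s hi ih =>
    set R : Ω → ℝ := fun ω => ∑ k ∈ s, μ k * E k ω with hR
    have hRm : Measurable R := by fun_prop
    have hind : IndepFun R (E i) P := by
      have h := (hE.comp (fun k x => μ k * x) (fun k => by fun_prop)).indepFun_finset s {i}
        (by simpa using hi) (fun k => by have := hm k; fun_prop)
      -- The family is weighted by μ_k except at i, so that the independence statement concerns the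
      -- sum R and the unweighted variable E_i.
      have h' := (hE.comp (fun k x => if k = i then x else μ k * x)
        (fun k => by split_ifs <;> fun_prop)).indepFun_finsetSum_of_notMem
        (fun k => by
          have := hm k
          by_cases hk : k = i
          · simp only [hk, if_true]; exact hm i
          · simp only [hk, if_false]; fun_prop) hi
      have e1 : R = ∑ j ∈ s, (fun x => if j = i then x else μ j * x) ∘ E j := by
        ext ω
        rw [Finset.sum_apply]
        refine Finset.sum_congr rfl fun k hk => ?_
        have : k ≠ i := fun h => hi (h ▸ hk)
        simp [this]
      have e2 : E i = (fun x => if i = i then x else μ i * x) ∘ E i := by ext ω; simp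
      rw [e1, e2]
      exact h'
    have hGm : Measurable fun x => P {ω | x ≤ R ω} := by
      refine Antitone.measurable fun a b hab => measure_mono fun ω (hω : b ≤ R ω) => ?_
      exact hab.trans hω
    convert! ih.lintegral_exp_mul hGm (hμ i) using 2 with x
    have hlaw' : HasLaw (fun ω => (R ω, E i ω)) ((P.map R).prod (P.map (E i))) P :=
      hind.hasLaw_prod ⟨hRm.aemeasurable, rfl⟩ ⟨(hm i).aemeasurable, rfl⟩
    have hset : MeasurableSet {z : ℝ × ℝ | x ≤ μ i * z.2 + z.1} :=
      measurableSet_le (by fun_prop) (by fun_prop)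
    simp_rw [Finset.sum_insert hi]
    -- Conditioning on E_i = z, the tail of the full sum at x is the tail of R at x - μ_i z.
    rw [hlaw'.measure_eq (p := fun z : ℝ × ℝ => x ≤ μ i * z.2 + z.1) hset,
      Measure.prod_apply_symm hset, lintegral_map (measurable_measure_prodMk_right hset) (hm i),
      hlaw i _ (measurable_measure_prodMk_right hset)]
    refine lintegral_congr fun z => ?_
    congr 1
    rw [Measure.map_apply hRm (measurable_prodMk_right hset)]
    congr 1
    ext ω
    simp only [Set.mem_preimage, Set.mem_ofPred_eq, hR]
    constructor <;> intro _ <;> linarith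

end WienerChaos

/-! ### Lower bound for log-concave tails of mean one -/

namespace WienerChaos

/-- A discrete Grönwall inequality: over n equal steps the hypothesis loses at most a factor 1 - ρ(x
- a)/n each time, and n tends to infinity. No differentiability of `I` is needed. -/
lemma mul_exp_neg_le_of_forall_sub_le {I : ℝ → ℝ} {ρ a x : ℝ} (hax : a ≤ x)
    (h : ∀ y z, a ≤ y → y ≤ z → z ≤ x → I y ≤ I z + (z - y) * (ρ * I y)) :
    I a * Real.exp (-(ρ * (x - a))) ≤ I x := by
  have hlim : Tendsto (fun n : ℕ => I a * (1 + (-(ρ * (x - a))) / n) ^ n) atTop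
      (𝓝 (I a * Real.exp (-(ρ * (x - a))))) :=
    (Real.tendsto_one_add_div_pow_exp _).const_mul _
  refine le_of_tendsto hlim ?_
  -- For n ≥ n₀ the factor 1 - ρ(x - a)/n is nonnegative, which is needed to multiply the
  -- inequalities.
  obtain ⟨n₀, hn₀⟩ := exists_nat_gt (ρ * (x - a))
  filter_upwards [eventually_ge_atTop n₀, eventually_gt_atTop 0] with n hn hn0
  have hn0' : (0 : ℝ) < n := by exact_mod_cast hn0
  have hq : 0 ≤ 1 + (-(ρ * (x - a))) / n := by
    have h1 : (n₀ : ℝ) ≤ n := by exact_mod_cast hn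
    have : ρ * (x - a) / n ≤ 1 := by rw [div_le_one hn0']; linarith
    rw [neg_div]; linarith
  have step : ∀ k : ℕ, k ≤ n → I a * (1 + (-(ρ * (x - a))) / n) ^ k ≤ I (a + k * ((x - a) / n)) := by
    intro k
    induction k with
    | zero => simp
    | succ k ih =>
      intro hk
      have ih := ih (by omega)
      have hkn : ((k + 1 : ℕ) : ℝ) ≤ n := by exact_mod_cast hk
      have hd : 0 ≤ (x - a) / n := div_nonneg (by linarith) hn0'.le
      have hz : a + (k + 1 : ℕ) * ((x - a) / n) ≤ x := by
        have := mul_le_mul_of_nonneg_right hkn hd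
        rw [mul_div_cancel₀ _ hn0'.ne'] at this
        linarith
      have h1 := h (a + k * ((x - a) / n)) (a + (k + 1 : ℕ) * ((x - a) / n))
        (by have := mul_nonneg (Nat.cast_nonneg k : (0 : ℝ) ≤ k) hd; linarith)
        (by push_cast; linarith) hz
      have e : a + (k + 1 : ℕ) * ((x - a) / n) - (a + k * ((x - a) / n)) = (x - a) / n := by
        push_cast; ring
      rw [e] at h1
      have h2 : I (a + k * ((x - a) / n)) * (1 + (-(ρ * (x - a))) / n) ≤
          I (a + (k + 1 : ℕ) * ((x - a) / n)) := by
        have e2 : I (a + k * ((x - a) / n)) * (1 + (-(ρ * (x - a))) / n) =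
            I (a + k * ((x - a) / n)) - (x - a) / n * (ρ * I (a + k * ((x - a) / n))) := by ring
        linarith
      calc _ = I a * (1 + (-(ρ * (x - a))) / n) ^ k * (1 + (-(ρ * (x - a))) / n) := by ring
        _ ≤ _ := mul_le_mul_of_nonneg_right ih hq
        _ ≤ _ := h2
  have := step n le_rfl
  rwa [mul_div_cancel₀ _ hn0'.ne', add_sub_cancel] at this

/-- A random variable of mean one with a log-concave tail exceeds `x < 1` with probability at
least `e⁻ˣ`. -/
lemma exp_neg_le_of_isLogConcaveMul {G : ℝ → ENNReal} (hG : IsLogConcaveMul G) (hanti : Antitone G)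
    (hG0 : G 0 = 1) (hint : ∫⁻ z in Set.Ioi (0 : ℝ), G z = 1) {x : ℝ} (hx0 : 0 ≤ x) (hx1 : x < 1) :
    Real.exp (-x) ≤ (G x).toReal := by
  have hm : Measurable G := hanti.measurable
  set J : ℝ → ENNReal := fun x => ∫⁻ z in Set.Ioi x, G z with hJ
  have hGle : ∀ y, 0 ≤ y → G y ≤ 1 := fun y hy => hG0 ▸ hanti hy
  have hJle : ∀ y, 0 ≤ y → J y ≤ 1 := fun y hy => hint ▸ lintegral_mono_set (Set.Ioi_subset_Ioi hy)
  have hGf : ∀ y, 0 ≤ y → G y ≠ ⊤ := fun y hy => ((hGle y hy).trans_lt ENNReal.one_lt_top).ne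
  have hJf : ∀ y, 0 ≤ y → J y ≠ ⊤ := fun y hy => ((hJle y hy).trans_lt ENNReal.one_lt_top).ne
  have hJstep : ∀ y z, 0 ≤ y → y ≤ z →
      (J y).toReal ≤ (J z).toReal + (z - y) * (G y).toReal := by
    intro y z hy hyz
    have h1 : J y ≤ J z + ENNReal.ofReal (z - y) * G y := by
      simp only [hJ]
      rw [← Set.Ioc_union_Ioi_eq_Ioi hyz, lintegral_union measurableSet_Ioi
        (Set.Ioc_disjoint_Ioi le_rfl), add_comm]
      refine add_le_add le_rfl ?_
      calc ∫⁻ a in Set.Ioc y z, G a ≤ ∫⁻ _ in Set.Ioc y z, G y :=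
            setLIntegral_mono' measurableSet_Ioc fun a ha => hanti ha.1.le
        _ = _ := by rw [setLIntegral_const, Real.volume_Ioc, mul_comm]
    have h2 := ENNReal.toReal_mono (ENNReal.add_ne_top.2 ⟨hJf z (hy.trans hyz),
      ENNReal.mul_ne_top ENNReal.ofReal_ne_top (hGf y hy)⟩) h1
    rwa [ENNReal.toReal_add (hJf z (hy.trans hyz))
      (ENNReal.mul_ne_top ENNReal.ofReal_ne_top (hGf y hy)), ENNReal.toReal_mul,
      ENNReal.toReal_ofReal (by linarith)] at h2
  have hJsh : ∀ y, J y = ∫⁻ b in Set.Ioi (0 : ℝ), G (y + b) := by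
    intro y
    simp only [hJ]
    rw [← lintegral_indicator measurableSet_Ioi, ← lintegral_indicator measurableSet_Ioi,
      ← lintegral_add_left_eq_self _ y]
    refine lintegral_congr fun z => ?_
    by_cases hz : 0 < z
    · rw [Set.indicator_of_mem (by simpa using hz), Set.indicator_of_mem (by simpa using hz)]
    · rw [Set.indicator_of_notMem (by simpa using hz), Set.indicator_of_notMem (by simpa using hz)]
  -- The hazard rate G/J is nondecreasing, by integrating the log-concavity of G.
  have hGJ : ∀ y z, 0 ≤ y → y ≤ z →
      (G y).toReal * (J z).toReal ≤ (G z).toReal * (J y).toReal := by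
    intro y z hy hyz
    rw [← ENNReal.toReal_mul, ← ENNReal.toReal_mul]
    refine ENNReal.toReal_mono (ENNReal.mul_ne_top (hGf z (hy.trans hyz)) (hJf y hy)) ?_
    rw [hJsh, hJsh, ← lintegral_const_mul _ (by fun_prop), ← lintegral_const_mul _ (by fun_prop)]
    refine setLIntegral_mono' measurableSet_Ioi fun b hb => ?_
    have h := hG y (z - y) b (by linarith) (le_of_lt hb)
    rwa [add_sub_cancel] at h
  have hJ0 : (J 0).toReal = 1 := by simp only [hJ, hint, ENNReal.toReal_one]
  have hg0 : (G 0).toReal = 1 := by rw [hG0, ENNReal.toReal_one]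
  have hg1 : ∀ y, 0 ≤ y → (G y).toReal ≤ 1 := fun y hy => by
    simpa using ENNReal.toReal_mono ENNReal.one_ne_top (hGle y hy)
  have hJlow : ∀ y, 0 ≤ y → 1 - y ≤ (J y).toReal := fun y hy => by
    have h := hJstep 0 y le_rfl hy
    rw [hJ0, hg0] at h
    linarith
  have hJpos : 0 < (J x).toReal := by linarith [hJlow x hx0]
  -- The hazard rate at x. It dominates the hazard rate on [0, x], so J decays there at rate at most
  -- ρ.
  set ρ := (G x).toReal / (J x).toReal with hρ
  have hρJ : ρ * (J x).toReal = (G x).toReal := div_mul_cancel₀ _ hJpos.ne'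
  have hρ1 : 1 ≤ ρ := by
    rw [hρ, le_div_iff₀ hJpos]
    have := hGJ 0 x le_rfl hx0
    rw [hg0, hJ0] at this
    linarith
  have hρ0 : 0 < ρ := by linarith
  have hgρ : ∀ y, 0 ≤ y → y ≤ x → (G y).toReal ≤ ρ * (J y).toReal := fun y hy hyx => by
    have := hGJ y x hy hyx
    rw [hρ, div_mul_eq_mul_div, le_div_iff₀ hJpos]
    exact this
  -- From J(y) ≥ 1 - y one gets ρ J(a) ≥ ρ (1 - a) = 1. Moreover a ≤ x, since otherwise ρ J(x) =
  -- G(x) would exceed 1. The decay estimate is run from a to x.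
  set a := 1 - 1 / ρ with ha
  have ha0 : 0 ≤ a := by
    have : 1 / ρ ≤ 1 := by rw [div_le_one hρ0]; exact hρ1
    linarith
  have hax : a ≤ x := by
    by_contra! hlt
    have h1 : 1 / ρ < (J x).toReal := by linarith [hJlow x hx0]
    have h2 : 1 < ρ * (J x).toReal := by
      rw [div_lt_iff₀ hρ0] at h1; linarith
    linarith [hg1 x hx0]
  have hgr := mul_exp_neg_le_of_forall_sub_le (I := fun y => (J y).toReal) (ρ := ρ) hax
    fun y z hy hyz hzx => by
      have h1 := hJstep y z (ha0.trans hy) hyz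
      have h2 := mul_le_mul_of_nonneg_left (hgρ y (ha0.trans hy) (hyz.trans hzx))
        (sub_nonneg.2 hyz)
      linarith
  have hJa : 1 ≤ ρ * (J a).toReal := by
    have h1 := hJlow a ha0
    have h2 : 1 / ρ ≤ (J a).toReal := by linarith
    rw [div_le_iff₀ hρ0] at h2
    linarith
  -- Here x - ρ(x - a) = (ρ - 1)(1 - x) ≥ 0.
  calc Real.exp (-x) ≤ Real.exp (-(ρ * (x - a))) := by
        rw [Real.exp_le_exp]
        have e : ρ * (x - a) = ρ * x - ρ + 1 := by rw [ha]; field_simp; ring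
        rw [e]
        nlinarith
    _ ≤ ρ * (J a).toReal * Real.exp (-(ρ * (x - a))) :=
        le_mul_of_one_le_left (Real.exp_nonneg _) hJa
    _ = ρ * ((J a).toReal * Real.exp (-(ρ * (x - a)))) := by ring
    _ ≤ ρ * (J x).toReal := mul_le_mul_of_nonneg_left hgr hρ0.le
    _ = (G x).toReal := hρJ

/-- The average of two independent copies of ∑ μ_k N_k² equals ∑ μ_k E_k with E_k = (N_k² + N'_k²)/2
standard exponential. It has mean one and a log-concave tail, hence is at least x with probability
at least e^(-x); when it is, one of the two copies is at least x. -/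
lemma exp_neg_le_two_mul_measureReal {κ : Type*} [Fintype κ] {μ : κ → ℝ} (hμ : ∀ k, 0 ≤ μ k)
    (hsum : ∑ k, μ k = 1) {x : ℝ} (hx0 : 0 ≤ x) (hx1 : x < 1) :
    Real.exp (-x) ≤ 2 * (stdNormal κ).real {y | x ≤ ∑ k, μ k * y k ^ 2} := by
  set γ := gaussianReal 0 1 with hγ
  set Q : Measure (κ → ℝ × ℝ) := Measure.pi fun _ => γ.prod γ with hQ
  set E : κ → (κ → ℝ × ℝ) → ℝ := fun k ω => ((ω k).1 ^ 2 + (ω k).2 ^ 2) / 2 with hE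
  have hcoord : iIndepFun (fun (k : κ) (ω : κ → ℝ × ℝ) => ω k) Q :=
    iIndepFun_pi (X := fun _ x => x) (fun _ => aemeasurable_id)
  have hev : ∀ k, MeasurePreserving (fun ω : κ → ℝ × ℝ => ω k) Q (γ.prod γ) :=
    fun k => measurePreserving_eval (fun _ : κ => γ.prod γ) k
  have hEind : iIndepFun E Q :=
    hcoord.comp (fun _ z => (z.1 ^ 2 + z.2 ^ 2) / 2) fun _ => by fun_prop
  have hEm : ∀ k, Measurable (E k) := fun k => by fun_prop
  have hElaw : ∀ k, ∀ f : ℝ → ENNReal, Measurable f → ∫⁻ ω, f (E k ω) ∂Q =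
      ∫⁻ z in Set.Ioi (0 : ℝ), ENNReal.ofReal (Real.exp (-z)) * f z := fun k f hf => by
    rw [← lintegral_half_sq_add_sq hf]
    exact (hev k).lintegral_comp (f := fun z : ℝ × ℝ => f ((z.1 ^ 2 + z.2 ^ 2) / 2)) (by fun_prop)
  have hlc := isLogConcaveMul_tail_sum_exponential hEind hEm hElaw hμ Finset.univ
  have hlaw1 : HasLaw (fun (ω : κ → ℝ × ℝ) k => (ω k).1) (stdNormal κ) Q :=
    (hcoord.comp (fun _ z => z.1) fun _ => measurable_fst).hasLaw_pi fun k =>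
      (measurePreserving_fst.comp (hev k)).hasLaw
  have hlaw2 : HasLaw (fun (ω : κ → ℝ × ℝ) k => (ω k).2) (stdNormal κ) Q :=
    (hcoord.comp (fun _ z => z.2) fun _ => measurable_snd).hasLaw_pi fun k =>
      (measurePreserving_snd.comp (hev k)).hasLaw
  have hset : MeasurableSet {y : κ → ℝ | x ≤ ∑ k, μ k * y k ^ 2} :=
    measurableSet_le (by fun_prop) (by fun_prop)
  have hM0 : ∀ ω, 0 ≤ ∑ k, μ k * E k ω := fun ω =>
    Finset.sum_nonneg fun k _ => mul_nonneg (hμ k) (by simp only [hE]; positivity)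
  have hmean : ∫⁻ z in Set.Ioi (0 : ℝ), Q {ω | z ≤ ∑ k, μ k * E k ω} = 1 := by
    rw [← lintegral_eq_lintegral_meas_le Q (ae_of_all _ hM0)
      (Measurable.aemeasurable (by fun_prop))]
    have e1 : ∀ ω, ENNReal.ofReal (∑ k, μ k * E k ω) =
        ∑ k, ENNReal.ofReal (μ k) * ENNReal.ofReal (E k ω) := fun ω => by
      rw [ENNReal.ofReal_sum_of_nonneg fun k _ => mul_nonneg (hμ k) (by simp only [hE]; positivity)]
      exact Finset.sum_congr rfl fun k _ => ENNReal.ofReal_mul (hμ k)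
    simp_rw [e1]
    rw [lintegral_finsetSum _ fun k _ => by have := hEm k; fun_prop]
    have e2 : ∀ k, ∫⁻ ω, ENNReal.ofReal (μ k) * ENNReal.ofReal (E k ω) ∂Q = ENNReal.ofReal (μ k) := by
      intro k
      have hint : Integrable (E k) Q := by
        have h1 : Integrable (fun z : ℝ × ℝ => z.1 ^ 2) (γ.prod γ) :=
          (integrable_pow_gaussianReal 2).comp_fst γ
        have h2 : Integrable (fun z : ℝ × ℝ => z.2 ^ 2) (γ.prod γ) :=
          (integrable_pow_gaussianReal 2).comp_snd γ
        exact ((hev k).integrable_comp_of_integrable ((h1.add h2).div_const 2))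
      rw [lintegral_const_mul _ (by have := hEm k; fun_prop),
        ← ofReal_integral_eq_lintegral_ofReal hint
          (ae_of_all _ fun ω => by simp only [hE, Pi.zero_apply]; positivity)]
      have : ∫ ω, E k ω ∂Q = 1 := by
        have h1 : Integrable (fun ω : κ → ℝ × ℝ => (ω k).1 ^ 2) Q :=
          (hev k).integrable_comp_of_integrable ((integrable_pow_gaussianReal 2).comp_fst γ)
        have h2 : Integrable (fun ω : κ → ℝ × ℝ => (ω k).2 ^ 2) Q :=
          (hev k).integrable_comp_of_integrable ((integrable_pow_gaussianReal 2).comp_snd γ)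
        simp only [hE]
        rw [integral_div, integral_add h1 h2]
        have v1 : ∫ ω, (ω k).1 ^ 2 ∂Q = 1 := by
          rw [← integral_sq_gaussianReal]
          exact (measurePreserving_fst.comp (hev k)).hasLaw.integral_comp
            (f := fun x : ℝ => x ^ 2) (by fun_prop)
        have v2 : ∫ ω, (ω k).2 ^ 2 ∂Q = 1 := by
          rw [← integral_sq_gaussianReal]
          exact (measurePreserving_snd.comp (hev k)).hasLaw.integral_comp
            (f := fun x : ℝ => x ^ 2) (by fun_prop)
        rw [v1, v2]; norm_num
      rw [this]; simp
    simp_rw [e2]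
    rw [← ENNReal.ofReal_sum_of_nonneg fun k _ => hμ k, hsum, ENNReal.ofReal_one]
  have key := exp_neg_le_of_isLogConcaveMul hlc
    (fun a b hab => measure_mono fun ω hω => by
      simp only [Set.mem_ofPred_eq] at hω ⊢; exact hab.trans hω)
    (by
      have : {ω | (0 : ℝ) ≤ ∑ k, μ k * E k ω} = Set.univ := by
        ext ω; simpa using hM0 ω
      rw [this, measure_univ]) hmean hx0 hx1
  refine key.trans ?_
  rw [two_mul]
  nth_rw 1 [← hlaw1.measureReal_eq hset]
  rw [← hlaw2.measureReal_eq hset]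
  refine le_trans (measureReal_mono (μ := Q) (fun ω hω => ?_)) (measureReal_union_le _ _)
  simp only [Set.mem_ofPred_eq, Set.mem_union] at hω ⊢
  by_contra! hcon
  have : ∑ k, μ k * E k ω = ((∑ k, μ k * (ω k).1 ^ 2) + ∑ k, μ k * (ω k).2 ^ 2) / 2 := by
    rw [← Finset.sum_add_distrib, Finset.sum_div]
    exact Finset.sum_congr rfl fun k _ => by simp only [hE]; ring
  linarith [hcon.1, hcon.2]

end WienerChaos

/-! ### Small ball estimates with explicit constants -/

namespace WienerChaos

lemma two_pow_le_two_mul_factorial {p : ℕ} (hp : 1 ≤ p) : 2 ^ p ≤ 2 * p.factorial := by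
  induction p, hp using Nat.le_induction with
  | base => simp
  | succ n hn ih =>
    rw [pow_succ, Nat.factorial_succ]
    nlinarith [Nat.factorial_pos n]

lemma three_mul_two_pow_le_four_mul_factorial {p : ℕ} (hp : 3 ≤ p) :
    3 * 2 ^ p ≤ 4 * p.factorial := by
  induction p, hp using Nat.le_induction with
  | base => decide
  | succ n hn ih =>
    rw [pow_succ, Nat.factorial_succ]
    nlinarith [Nat.factorial_pos n]

lemma log_le_tangent {x a : ℝ} (hx : 0 < x) (ha : 0 < a) :
    Real.log x ≤ Real.log a + (x / a - 1) := by
  have h := Real.log_le_sub_one_of_pos (div_pos hx ha)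
  rw [Real.log_div hx.ne' ha.ne'] at h
  linarith

section Tail
variable {κ : Type*} [Fintype κ] {μ : κ → ℝ}

lemma measureReal_weightedSq_lt_le_exp_neg (hμ : ∀ k, 0 ≤ μ k) (hsum : ∑ k, μ k = 1) {x : ℝ}
    (hx0 : 0 ≤ x) (hx1 : x < 1) :
    (stdNormal κ).real {y | ∑ k, μ k * y k ^ 2 < x} ≤ 1 - Real.exp (-x) / 2 := by
  have h := exp_neg_le_two_mul_measureReal hμ hsum hx0 hx1
  have e : {y : κ → ℝ | ∑ k, μ k * y k ^ 2 < x} = {y | x ≤ ∑ k, μ k * y k ^ 2}ᶜ := by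
    ext y; simp
  rw [e, measureReal_compl (measurableSet_le (by fun_prop) (by fun_prop)), probReal_univ]
  linarith

/-- The case p = 1. For x ≥ 1/2 the log-concavity bound is enough. For x < 1/2 either one weight is
large and its coordinate alone provides the factor √x, or all weights are small, hence so is ∑ μ_k²,
and the Chernoff bound applies. -/
lemma measureReal_weightedSq_lt_le_sqrt (hμ : ∀ k, 0 ≤ μ k) (hsum : ∑ k, μ k = 1) {x : ℝ}
    (hx0 : 0 < x) (hx1 : x < 1) :
    (stdNormal κ).real {y | ∑ k, μ k * y k ^ 2 < x} ≤ Real.sqrt x := by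
  rcases le_or_gt (1 / 2) x with hx | hx
  · refine (measureReal_weightedSq_lt_le_exp_neg hμ hsum hx0.le hx1).trans ?_
    -- Tangent line of e^(-x) at 1/2. With e^(-1/2) ≥ 3/5 the claim becomes a quadratic inequality
    -- in w = √x on [7/10, 1].
    have h1 : Real.exp (-(1 / 2)) * (3 / 2 - x) ≤ Real.exp (-x) := by
      have e : Real.exp (-x) = Real.exp (-(1 / 2)) * Real.exp (1 / 2 - x) := by
        rw [← Real.exp_add]; congr 1; ring
      rw [e]
      refine mul_le_mul_of_nonneg_left ?_ (Real.exp_nonneg _)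
      linarith [Real.add_one_le_exp (1 / 2 - x)]
    have h2 : (3 : ℝ) / 5 ≤ Real.exp (-(1 / 2)) := by
      have h3 : Real.exp (-(1 / 2)) ^ 2 = (Real.exp 1)⁻¹ := by
        rw [← Real.exp_nat_mul, ← Real.exp_neg]; norm_num
      have h4 : (9 : ℝ) / 25 ≤ (Real.exp 1)⁻¹ := by
        rw [le_inv_comm₀ (by norm_num) (Real.exp_pos 1)]
        linarith [Real.exp_one_lt_d9]
      rw [← h3] at h4
      refine le_of_sq_le_sq ?_ (Real.exp_nonneg _)
      linarith
    set w := Real.sqrt x with hw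
    have hw2 : w ^ 2 = x := Real.sq_sqrt hx0.le
    have hw0 : 0 ≤ w := Real.sqrt_nonneg x
    have hwl : (7 : ℝ) / 10 ≤ w := Real.le_sqrt_of_sq_le (by linarith)
    have hw1 : w ≤ 1 := by nlinarith
    have h3 : 3 / 5 * (3 / 2 - x) ≤ Real.exp (-(1 / 2)) * (3 / 2 - x) :=
      mul_le_mul_of_nonneg_right h2 (by linarith)
    nlinarith
  -- The threshold 13/50 serves both cases: for larger μ_k one has π μ_k (3 - 2μ_k) ≥ 2, as the
  -- coordinate bound requires, and for smaller weights ∑ μ_k² ≤ 13/50 gives an exponent large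
  -- enough for the Chernoff bound.
  · by_cases hbig : ∃ k, 13 / 50 ≤ μ k
    · obtain ⟨k, hk⟩ := hbig
      have hk0 : 0 < μ k := by linarith
      have hk1 : μ k ≤ 1 := hsum ▸ Finset.single_le_sum (fun j _ => hμ j) (Finset.mem_univ k)
      refine (measureReal_weightedSq_lt_le_of_coordinate hμ hsum hx0 k hk0).trans ?_
      have hpos : 0 < 1 + (1 - μ k) / x := by
        have := div_nonneg (by linarith : 0 ≤ 1 - μ k) hx0.le
        linarith
      rw [← div_eq_mul_inv, ← Real.sqrt_div (by positivity)]
      refine Real.sqrt_le_sqrt ?_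
      rw [div_le_iff₀ hpos, div_le_iff₀ (by positivity)]
      have h1 : 3 - 2 * μ k ≤ 1 + (1 - μ k) / x := by
        have : 2 * (1 - μ k) ≤ (1 - μ k) / x := by
          rw [le_div_iff₀ hx0]; nlinarith
        linarith
      have h2 : 2 ≤ (3 - 2 * μ k) * (Real.pi * μ k) := by
        have h3 : 0 ≤ (3 - 2 * μ k) * μ k := mul_nonneg (by linarith) hk0.le
        have h4 : (16 : ℝ) / 25 ≤ (3 - 2 * μ k) * μ k := by nlinarith
        nlinarith [Real.pi_gt_d2]
      calc 2 * x ≤ x * ((3 - 2 * μ k) * (Real.pi * μ k)) := by nlinarith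
        _ ≤ x * ((1 + (1 - μ k) / x) * (Real.pi * μ k)) := by
            have := Real.pi_pos
            gcongr
        _ = _ := by ring
    · push Not at hbig
      have hs : ∑ k, μ k ^ 2 ≤ 13 / 50 := by
        calc ∑ k, μ k ^ 2 ≤ ∑ k, 13 / 50 * μ k := Finset.sum_le_sum fun k _ => by
              nlinarith [hμ k, hbig k]
          _ = 13 / 50 := by rw [← Finset.mul_sum, hsum, mul_one]
      refine (measureReal_weightedSq_lt_le_rpow hμ hsum (m := 50 / 13) (by linarith) hx0
        hx1.le).trans ?_
      rw [← Real.exp_log (Real.sqrt_pos.2 hx0), Real.exp_le_exp, Real.log_sqrt hx0.le]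
      -- The claim is (25/13)(log x + 1 - x) ≤ (1/2) log x. Replacing log by its tangent at 1/2
      -- makes it affine, with worst point x = 1/2.
      have h1 := log_le_tangent hx0 (by norm_num : (0 : ℝ) < 1 / 2)
      rw [one_div, Real.log_inv, div_inv_eq_mul] at h1
      have := Real.log_two_gt_d9
      linarith

/-- The case p = 2, where 2 / (2²·3!) = 1/12. The log-concavity bound handles x near 1, Cantelli's
inequality the middle range and Chernoff the small x. -/
lemma measureReal_weightedSq_lt_le_self (hμ : ∀ k, 0 ≤ μ k) (hsum : ∑ k, μ k = 1)
    (hs : ∑ k, μ k ^ 2 ≤ 1 / 12) {x : ℝ} (hx0 : 0 < x) (hx1 : x < 1) :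
    (stdNormal κ).real {y | ∑ k, μ k * y k ^ 2 < x} ≤ x := by
  rcases le_or_gt (39 / 50) x with hx | hx
  · refine (measureReal_weightedSq_lt_le_exp_neg hμ hsum hx0.le hx1).trans ?_
    have h1 : Real.exp (-1) * (2 - x) ≤ Real.exp (-x) := by
      have e : Real.exp (-x) = Real.exp (-1) * Real.exp (1 - x) := by
        rw [← Real.exp_add]; congr 1; ring
      rw [e]
      refine mul_le_mul_of_nonneg_left ?_ (Real.exp_nonneg _)
      linarith [Real.add_one_le_exp (1 - x)]
    have h2 : (367 : ℝ) / 1000 ≤ Real.exp (-1) := by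
      rw [Real.exp_neg, le_inv_comm₀ (by norm_num) (Real.exp_pos 1)]
      linarith [Real.exp_one_lt_d9]
    nlinarith
  · rcases le_or_gt (11 / 50) x with hx' | hx'
    · refine (measureReal_weightedSq_lt_le_variance hsum hx1).trans ?_
      have h0 : 0 ≤ ∑ k, μ k ^ 2 := Finset.sum_nonneg fun k _ => sq_nonneg _
      rw [div_le_iff₀ (by have : 0 < (1 - x) ^ 2 := by nlinarith
                          linarith)]
      -- Cantelli's bound v / (v + (1 - x)²) is at most x exactly when v ≤ x(1 - x). Here v ≤ 1/6,
      -- while x(1 - x) ≥ (11/50)(39/50) > 1/6, which fixes the cut points.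
      have h1 : 2 * ∑ k, μ k ^ 2 ≤ x * (1 - x) := by nlinarith
      nlinarith
    · refine (measureReal_weightedSq_lt_le_rpow hμ hsum (m := 12) (by linarith) hx0
        hx1.le).trans ?_
      conv_rhs => rw [← Real.exp_log hx0]
      rw [Real.exp_le_exp]
      -- The claim is 6(log x + 1 - x) ≤ log x; the tangent at 1/4 is sharp enough below 11/50.
      have h1 := log_le_tangent hx0 (by norm_num : (0 : ℝ) < 1 / 4)
      rw [show (1 / 4 : ℝ) = (2 ^ 2)⁻¹ by norm_num, Real.log_inv, Real.log_pow] at h1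
      have := Real.log_two_gt_d9
      norm_num at h1
      linarith

/-- After the Chernoff bound with m = 2^p (p+1)!/2, the claim is (m - p) log x + m(1 - x) ≤
log(3/2). The left side is at most p²/m ≤ 1/4, while log(3/2) ≥ 1/3. -/
lemma measureReal_weightedSq_lt_le_of_three_le (hμ : ∀ k, 0 ≤ μ k) (hsum : ∑ k, μ k = 1)
    {p : ℕ} (hp : 3 ≤ p) (hs : ∑ k, μ k ^ 2 ≤ 2 / (2 ^ p * ((p + 1).factorial : ℝ)))
    {x : ℝ} (hx0 : 0 < x) (hx1 : x < 1) :
    (stdNormal κ).real {y | ∑ k, μ k * y k ^ 2 < x} ≤ Real.sqrt (3 / 2 * x ^ p) := by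
  set m : ℝ := 2 ^ p * ((p + 1).factorial : ℝ) / 2 with hm
  have hp' : (3 : ℝ) ≤ p := by exact_mod_cast hp
  have hmp : 4 * (p : ℝ) ^ 2 ≤ m := by
    have h1 : p ^ 2 ≤ (p + 1).factorial := by
      obtain ⟨q, rfl⟩ : ∃ q, p = q + 1 := ⟨p - 1, by omega⟩
      rw [Nat.factorial_succ, Nat.factorial_succ]
      nlinarith [Nat.factorial_pos q, Nat.mul_le_mul_left ((q + 2) * (q + 1)) (Nat.factorial_pos q)]
    have h2 : (p : ℝ) ^ 2 ≤ ((p + 1).factorial : ℝ) := by exact_mod_cast h1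
    have h3 : (8 : ℝ) ≤ 2 ^ p := by
      calc (8 : ℝ) = 2 ^ 3 := by norm_num
        _ ≤ 2 ^ p := pow_le_pow_right₀ (by norm_num) hp
    rw [hm]
    nlinarith [sq_nonneg (p : ℝ)]
  have hm0 : 0 < m := by positivity
  have hpm : (p : ℝ) < m := by nlinarith
  refine (measureReal_weightedSq_lt_le_rpow hμ hsum (m := m) ?_ hx0 hx1.le).trans ?_
  · have e : 2 / (2 ^ p * ((p + 1).factorial : ℝ)) = 1 / m := by rw [hm]; field_simp
    rw [e, le_div_iff₀ hm0] at hs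
    linarith
  · rw [← Real.exp_log (Real.sqrt_pos.2 (by positivity : 0 < 3 / 2 * x ^ p)), Real.exp_le_exp,
      Real.log_sqrt (by positivity), Real.log_mul (by norm_num) (by positivity), Real.log_pow]
    have h1 : (1 : ℝ) / 3 ≤ Real.log (3 / 2) := by
      have := Real.one_sub_inv_le_log_of_pos (by norm_num : (0 : ℝ) < 3 / 2)
      norm_num at this ⊢
      exact this
    -- The point (m - p)/m maximises (m - p) log x + m(1 - x); the tangent of log is taken there.
    have hx00 : 0 < (m - p) / m := div_pos (by linarith) hm0
    have h2 := log_le_tangent hx0 hx00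
    have h3 := Real.log_le_sub_one_of_pos hx00
    have h4 : (m - p) * Real.log x ≤ (m - p) * ((m - p) / m - 1 + (x / ((m - p) / m) - 1)) :=
      mul_le_mul_of_nonneg_left (by linarith) (by linarith)
    have e : (m - p) * ((m - p) / m - 1 + (x / ((m - p) / m) - 1)) =
        m * x - m + p ^ 2 / m := by
      have : m - p ≠ 0 := by linarith
      field_simp
      ring
    rw [e] at h4
    have h5 : (p : ℝ) ^ 2 / m ≤ 1 / 4 := by
      rw [div_le_iff₀ hm0]; linarith
    nlinarith

/-- Small ball estimate for a convex combination of independent `χ²` variables. -/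
theorem measureReal_weightedSq_lt_le (hμ : ∀ k, 0 ≤ μ k) (hsum : ∑ k, μ k = 1)
    {p : ℕ} (hp : 1 ≤ p) (hs : ∑ k, μ k ^ 2 ≤ 2 / (2 ^ p * ((p + 1).factorial : ℝ)))
    {x : ℝ} (hx : 0 < x) :
    (stdNormal κ).real {y | ∑ k, μ k * y k ^ 2 < x} ≤
      Real.sqrt (2 * (p.factorial : ℝ) / 2 ^ p * x ^ p) := by
  rcases le_or_gt 1 x with hx1 | hx1
  · refine measureReal_le_one.trans ?_
    rw [Real.one_le_sqrt]
    have h1 : (2 : ℝ) ^ p ≤ 2 * p.factorial := by exact_mod_cast two_pow_le_two_mul_factorial hp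
    have h2 : 1 ≤ 2 * (p.factorial : ℝ) / 2 ^ p := by rwa [one_le_div (by positivity)]
    exact one_le_mul_of_one_le_of_one_le h2 (one_le_pow₀ hx1)
  -- The constant 2 p!/2^p equals 1 for p = 1 and p = 2, and is at least 3/2 for p ≥ 3, with
  -- equality at p = 3.
  · rcases (by omega : p = 1 ∨ p = 2 ∨ 3 ≤ p) with rfl | rfl | hp3
    · simpa using measureReal_weightedSq_lt_le_sqrt hμ hsum hx hx1
    · refine (measureReal_weightedSq_lt_le_self hμ hsum
        (by norm_num [Nat.factorial] at hs; linarith) hx hx1).trans ?_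
      refine Real.le_sqrt_of_sq_le ?_
      norm_num [Nat.factorial]
    · refine (measureReal_weightedSq_lt_le_of_three_le hμ hsum hp3 hs hx hx1).trans ?_
      refine Real.sqrt_le_sqrt (mul_le_mul_of_nonneg_right ?_ (by positivity))
      rw [div_le_div_iff₀ (by norm_num) (by positivity)]
      have : (3 : ℝ) * 2 ^ p ≤ 4 * p.factorial := by
        exact_mod_cast three_mul_two_pow_le_four_mul_factorial hp3
      linarith

end Tail
end WienerChaos

/-! ### Diagonalization of finite Gaussian quadratic forms -/

namespace WienerChaos

section Diagonalization

open Matrix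

variable {Ω κ : Type*} [MeasurableSpace Ω] {P : Measure Ω} {X : κ → Ω → ℝ}

lemma integral_eq_zero_of_hasLaw {Y : Ω → ℝ} (hY : HasLaw Y (gaussianReal 0 1) P) :
    ∫ ω, Y ω ∂P = 0 := by
  rw [hY.integral_eq, integral_id_gaussianReal]

lemma memLp_of_hasLaw {Y : Ω → ℝ} (hY : HasLaw Y (gaussianReal 0 1) P) {q : ENNReal}
    (hq : q ≠ ⊤) : MemLp Y q P :=
  hY.hasGaussianLaw.memLp hq

lemma covariance_iid [DecidableEq κ] (hX : ∀ i, HasLaw (X i) (gaussianReal 0 1) P)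
    (hi : iIndepFun X P) (i j : κ) : cov[X i, X j; P] = if i = j then 1 else 0 := by
  split_ifs with h
  · subst h
    rw [covariance_self (hX i).aemeasurable, (hX i).variance_eq, variance_id_gaussianReal]
    simp
  · exact (hi.indepFun h).covariance_eq_zero (memLp_of_hasLaw (hX i) (by simp))
      (memLp_of_hasLaw (hX j) (by simp))

variable [Fintype κ]

/-- Rotation invariance: the transformed vector is jointly Gaussian and its covariance UᵀU is the
identity, so its components are uncorrelated, hence independent. -/
lemma iid_orthogonal [DecidableEq κ] (hX : ∀ i, HasLaw (X i) (gaussianReal 0 1) P)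
    (hi : iIndepFun X P) {U : Matrix κ κ ℝ} (hU : Uᵀ * U = 1) :
    (∀ k, HasLaw (fun ω => ∑ i, U i k * X i ω) (gaussianReal 0 1) P) ∧
      iIndepFun (fun k ω => ∑ i, U i k * X i ω) P := by
  have hcov (k l : κ) : cov[fun ω => ∑ i, U i k * X i ω, fun ω => ∑ i, U i l * X i ω; P] =
      if k = l then 1 else 0 := by
    have := hi.isProbabilityMeasure
    rw [covariance_fun_sum_fun_sum]
    · simp only [covariance_const_mul_left, covariance_const_mul_right, covariance_iid hX hi]
      have := congrFun (congrFun hU k) l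
      rw [Matrix.mul_apply, Matrix.one_apply] at this
      rw [← this]
      simp [Matrix.transpose_apply, mul_comm]
    · exact fun i => (memLp_of_hasLaw (hX i) (by simp)).const_mul _
    · exact fun i => (memLp_of_hasLaw (hX i) (by simp)).const_mul _
  have hG : HasGaussianLaw (fun ω k => ∑ i, U i k * X i ω) P := by
    have h0 : HasGaussianLaw (fun ω => (X · ω)) P := hi.hasGaussianLaw fun i => (hX i).hasGaussianLaw
    have h1 := h0.map_fun (LinearMap.toContinuousLinearMap (Matrix.mulVecLin Uᵀ))
    convert! h1 using 2
  have := hi.isProbabilityMeasure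
  refine ⟨fun k => ⟨(hG.eval k).aemeasurable, ?_⟩,
    hG.iIndepFun_of_covariance_eq_zero fun k l hkl => by rw [hcov, if_neg hkl]⟩
  rw [(hG.eval k).map_eq_gaussianReal, ← covariance_self (hG.eval k).aemeasurable, hcov, if_pos rfl,
    integral_finsetSum _ fun i _ =>
      ((memLp_of_hasLaw (hX i) (q := 1) (by simp)).integrable le_rfl).const_mul _]
  simp [integral_const_mul, integral_eq_zero_of_hasLaw (hX _)]

lemma IsHermitian.pow_eq {n : Type*} [Fintype n] [DecidableEq n] {A : Matrix n n ℝ}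
    (hA : A.IsHermitian) (m : ℕ) :
    A ^ m = (hA.eigenvectorUnitary : Matrix n n ℝ) * diagonal (fun k => hA.eigenvalues k ^ m) *
      (hA.eigenvectorUnitary : Matrix n n ℝ)ᵀ := by
  conv_lhs => rw [hA.spectral_theorem]
  rw [← map_pow, Matrix.diagonal_pow, Unitary.conjStarAlgAut_apply]
  rfl

lemma IsHermitian.sum_eigenvalues_pow {n : Type*} [Fintype n] [DecidableEq n] {A : Matrix n n ℝ}
    (hA : A.IsHermitian) (m : ℕ) : ∑ k, hA.eigenvalues k ^ m = (A ^ m).trace := by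
  have hU : (hA.eigenvectorUnitary : Matrix n n ℝ)ᵀ * (hA.eigenvectorUnitary : Matrix n n ℝ) = 1 :=
    Unitary.coe_star_mul_self hA.eigenvectorUnitary
  rw [IsHermitian.pow_eq hA, Matrix.trace_mul_comm, ← Matrix.mul_assoc, hU, Matrix.one_mul,
    Matrix.trace_diagonal]

/-- A quadratic form in independent standard Gaussian variables is a weighted sum of squares
of independent standard Gaussian variables. -/
lemma exists_iid_quadratic_eq [DecidableEq κ] (hX : ∀ i, HasLaw (X i) (gaussianReal 0 1) P)
    (hi : iIndepFun X P) {A : Matrix κ κ ℝ} (hA : A.IsHermitian) :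
    ∃ N : κ → Ω → ℝ, (∀ k, HasLaw (N k) (gaussianReal 0 1) P) ∧ iIndepFun N P ∧
      ∀ ω, ∑ i, ∑ j, A i j * (X i ω * X j ω) = ∑ k, hA.eigenvalues k * N k ω ^ 2 := by
  set U : Matrix κ κ ℝ := (hA.eigenvectorUnitary : Matrix κ κ ℝ)
  have hU : Uᵀ * U = 1 := Unitary.coe_star_mul_self hA.eigenvectorUnitary
  obtain ⟨h1, h2⟩ := iid_orthogonal hX hi hU
  refine ⟨_, h1, h2, fun ω => ?_⟩
  have hAe (i j : κ) : A i j = ∑ k, hA.eigenvalues k * (U i k * U j k) := by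
    have := congrFun (congrFun (IsHermitian.pow_eq hA 1) i) j
    rw [pow_one, Matrix.mul_apply] at this
    rw [this]
    refine Finset.sum_congr rfl fun k _ => ?_
    rw [Matrix.mul_diagonal, Matrix.transpose_apply, pow_one]
    ring
  simp_rw [hAe, Finset.sum_mul, sq, Finset.sum_mul_sum, Finset.mul_sum]
  rw [Finset.sum_congr rfl fun i _ => Finset.sum_comm, Finset.sum_comm]
  refine Finset.sum_congr rfl fun k _ => Finset.sum_congr rfl fun i _ =>
    Finset.sum_congr rfl fun j _ => ?_
  ring

/-- In eigencoordinates the form is ∑ λ_k (N_k² - 1), since the trace ∑ λ_k matches the subtracted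
diagonal. The power sums of the λ_k are the traces of A² and A⁴, written through the entries of A.
-/
lemma moments_quadratic [DecidableEq κ] (hX : ∀ i, HasLaw (X i) (gaussianReal 0 1) P)
    (hi : iIndepFun X P) {A : κ → κ → ℝ} (hA : ∀ i j, A i j = A j i) :
    MemLp (fun ω => ∑ i, ∑ j, A i j * (X i ω * X j ω - if i = j then 1 else 0)) 4 P ∧
    (∫ ω, (∑ i, ∑ j, A i j * (X i ω * X j ω - if i = j then 1 else 0)) ^ 2 ∂P =
      2 * ∑ i, ∑ j, A i j ^ 2) ∧
    (∫ ω, (∑ i, ∑ j, A i j * (X i ω * X j ω - if i = j then 1 else 0)) ^ 4 ∂P =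
      48 * ∑ i, ∑ j, (∑ k, A i k * A j k) ^ 2 + 12 * (∑ i, ∑ j, A i j ^ 2) ^ 2) := by
  have hH : (Matrix.of A).IsHermitian := by
    ext i j
    simp [hA j i]
  obtain ⟨N, h1, h2, h3⟩ := exists_iid_quadratic_eq hX hi hH
  have htr : ∑ k, hH.eigenvalues k = ∑ i, A i i := by
    have := IsHermitian.sum_eigenvalues_pow hH 1
    simp only [pow_one] at this
    rw [this]
    rfl
  have hsq (i j : κ) : (Matrix.of A ^ 2) i j = ∑ k, A i k * A j k := by
    rw [pow_two, Matrix.mul_apply]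
    exact Finset.sum_congr rfl fun k _ => by rw [Matrix.of_apply, Matrix.of_apply, hA k j]
  have htr2 : ∑ k, hH.eigenvalues k ^ 2 = ∑ i, ∑ j, A i j ^ 2 := by
    rw [IsHermitian.sum_eigenvalues_pow hH 2, Matrix.trace]
    refine Finset.sum_congr rfl fun i _ => ?_
    rw [Matrix.diag_apply, hsq]
    exact Finset.sum_congr rfl fun k _ => (sq _).symm
  have htr4 : ∑ k, hH.eigenvalues k ^ 4 = ∑ i, ∑ j, (∑ k, A i k * A j k) ^ 2 := by
    rw [IsHermitian.sum_eigenvalues_pow hH 4, Matrix.trace, show 4 = 2 + 2 from rfl, pow_add]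
    refine Finset.sum_congr rfl fun i _ => ?_
    rw [Matrix.diag_apply, Matrix.mul_apply]
    refine Finset.sum_congr rfl fun j _ => ?_
    rw [hsq, hsq, sq]
    congr 1
    exact Finset.sum_congr rfl fun k _ => mul_comm _ _
  have hF : (fun ω => ∑ i, ∑ j, A i j * (X i ω * X j ω - if i = j then 1 else 0)) =
      fun ω => ∑ k, hH.eigenvalues k * (N k ω ^ 2 - 1) := by
    ext ω
    have := h3 ω
    simp only [Matrix.of_apply] at this
    simp only [mul_sub, Finset.sum_sub_distrib, this, mul_one, htr]
    simp
  have hF' (n : ℕ) : (fun ω => (∑ i, ∑ j, A i j * (X i ω * X j ω - if i = j then 1 else 0)) ^ n) =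
      fun ω => (∑ k, hH.eigenvalues k * (N k ω ^ 2 - 1)) ^ n := by
    ext ω
    rw [congrFun hF ω]
  obtain ⟨m1, -, m2, m3⟩ := moments_diagonal h1 h2 hH.eigenvalues Finset.univ
  rw [hF, hF', hF', m2, m3, htr2, htr4]
  exact ⟨m1, rfl, rfl⟩

/-- Lower tail of the squared norm of a Gaussian vector `C X` whose covariance has small
normalised Hilbert-Schmidt norm. -/
lemma measureReal_sum_sq_lt_le [DecidableEq κ] (hX : ∀ i, HasLaw (X i) (gaussianReal 0 1) P)
    (hi : iIndepFun X P) {α : Type*} [Fintype α] (C : α → κ → ℝ) {T : ℝ} (hT : 0 < T)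
    (hC : ∑ a, ∑ k, C a k ^ 2 = T) {p : ℕ} (hp : 1 ≤ p)
    (hs : ∑ a, ∑ b, (∑ k, C a k * C b k) ^ 2 ≤ T ^ 2 * (2 / (2 ^ p * ((p + 1).factorial : ℝ))))
    {ε : ℝ} (hε : 0 < ε) :
    P.real {ω | ∑ a, (∑ k, C a k * X k ω) ^ 2 < ε} ≤
      Real.sqrt (2 * (p.factorial : ℝ) / 2 ^ p * (ε / T) ^ p) := by
  set M : Matrix α κ ℝ := Matrix.of C
  have hP : (Mᵀ * M).PosSemidef := Matrix.posSemidef_conjTranspose_mul_self M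
  have hH : (Mᵀ * M).IsHermitian := hP.isHermitian
  obtain ⟨N, h1, h2, h3⟩ := exists_iid_quadratic_eq hX hi hH
  have hM (i j : κ) : (Mᵀ * M) i j = ∑ a, C a i * C a j := by
    simp [Matrix.mul_apply, M]
  have htr : ∑ k, hH.eigenvalues k = T := by
    have := IsHermitian.sum_eigenvalues_pow hH 1
    simp only [pow_one] at this
    rw [this, Matrix.trace, ← hC, Finset.sum_comm]
    exact Finset.sum_congr rfl fun i _ => by simp only [Matrix.diag_apply, hM, sq]
  -- Cyclicity of the trace: tr (MᵀM)² = tr (MMᵀ)², which moves the sum from the columns of C to its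
  -- rows.
  have htr2 : ∑ k, hH.eigenvalues k ^ 2 = ∑ a, ∑ b, (∑ k, C a k * C b k) ^ 2 := by
    have hMM (a b : α) : (M * Mᵀ) a b = ∑ k, C a k * C b k := by simp [Matrix.mul_apply, M]
    rw [IsHermitian.sum_eigenvalues_pow hH 2, pow_two, Matrix.mul_assoc, Matrix.trace_mul_comm,
      Matrix.mul_assoc, Matrix.mul_assoc, ← Matrix.mul_assoc, Matrix.trace]
    refine Finset.sum_congr rfl fun a _ => ?_
    rw [Matrix.diag_apply, Matrix.mul_apply]
    refine Finset.sum_congr rfl fun b _ => ?_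
    rw [hMM, hMM, sq]
    congr 1
    exact Finset.sum_congr rfl fun k _ => mul_comm _ _
  have hμ (k : κ) : 0 ≤ hH.eigenvalues k / T := div_nonneg (hP.eigenvalues_nonneg k) hT.le
  have hmain := measureReal_weightedSq_lt_le hμ (by rw [← Finset.sum_div, htr, div_self hT.ne'])
    hp (by
      simp_rw [div_pow]
      rw [← Finset.sum_div, htr2, div_le_iff₀ (by positivity), mul_comm]
      exact hs) (div_pos hε hT)
  have hlaw : HasLaw (fun ω i => N i ω) (stdNormal κ) P := h2.hasLaw_pi h1
  refine le_of_eq_of_le ?_ hmain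
  have hmeas : MeasurableSet {y : κ → ℝ | ∑ k, hH.eigenvalues k / T * y k ^ 2 < ε / T} :=
    measurableSet_lt (by fun_prop) (by fun_prop)
  rw [measureReal_def, measureReal_def, ← hlaw.map_eq, Measure.map_apply_of_aemeasurable
    hlaw.aemeasurable hmeas]
  congr 2
  ext ω
  simp only [Set.mem_preimage, Set.mem_ofPred_eq]
  have : ∑ a, (∑ k, C a k * X k ω) ^ 2 = ∑ k, hH.eigenvalues k * N k ω ^ 2 := by
    rw [← h3 ω]
    simp_rw [hM, sq, Finset.sum_mul_sum, Finset.sum_mul]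
    rw [Finset.sum_comm]
    refine Finset.sum_congr rfl fun i _ => ?_
    rw [Finset.sum_comm]
    refine Finset.sum_congr rfl fun j _ => Finset.sum_congr rfl fun a _ => by ring
  rw [this, ← div_lt_div_iff_of_pos_right hT, Finset.sum_div]
  simp_rw [div_mul_eq_mul_div]

end Diagonalization

end WienerChaos

/-! ### Calculus of cylinder functions -/

namespace WienerChaos

section Cylinder

open scoped Classical

variable {ι : Type*} {k : ℕ} {f g : (ι → ℝ) → ℝ}

lemma hasLineDerivAt_of_comp_domRestrict {s : Finset ι} {g : (s → ℝ) → ℝ} (hg : Differentiable ℝ g)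
    (hf : ∀ x : ι → ℝ, f x = g (fun i => x i)) (x v : ι → ℝ) :
    HasLineDerivAt ℝ f (fderiv ℝ g (fun i => x i) (fun i => v i)) x v := by
  have := ((hg (fun i => x i)).hasFDerivAt.hasLineDerivAt (fun i => v i))
  unfold HasLineDerivAt at this ⊢
  refine this.congr_of_eventuallyEq (Eventually.of_forall fun t => ?_)
  exact hf _

/-- Differentiation along one coordinate with the others frozen is the form in which one-dimensional
Gaussian integration by parts can be applied after Fubini. -/
lemma hasDerivAt_update_of_hasLineDerivAt {i : ι} (hf : ∀ x, ∃ d, HasLineDerivAt ℝ f d x (Pi.single i 1))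
    (x : ι → ℝ) (u : ℝ) :
    HasDerivAt (fun u => f (Function.update x i u)) (partialDeriv i f (Function.update x i u)) u := by
  obtain ⟨d, hd⟩ := hf (Function.update x i u)
  rw [partialDeriv, hd.lineDeriv]
  unfold HasLineDerivAt at hd
  have h2 := HasDerivAt.comp_sub_const u u (by rwa [sub_self])
  refine h2.congr_of_eventuallyEq (Eventually.of_forall fun t => ?_)
  simp only
  congr 1
  ext j
  rcases eq_or_ne j i with rfl | hj <;> simp [*]

lemma partialDeriv_eq_of_hasDerivAt_update {f' : (ι → ℝ) → ℝ} {i : ι}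
    (hf : ∀ x u, HasDerivAt (fun u => f (Function.update x i u)) (f' (Function.update x i u)) u) :
    partialDeriv i f = f' := by
  ext x
  have h := hf x (x i)
  rw [Function.update_eq_self] at h
  have h2 : HasDerivAt (fun t : ℝ => f (x + t • Pi.single i 1)) (f' x) 0 := by
    have h3 := HasDerivAt.comp_const_add (x i) 0 (by rwa [add_zero])
    refine h3.congr_of_eventuallyEq (Eventually.of_forall fun t => ?_)
    simp only
    congr 1
    ext j
    rcases eq_or_ne j i with rfl | hj <;> simp [*]
  exact h2.deriv

namespace IsCylinder

lemma of_le {l : ℕ} (hf : IsCylinder k f) (hl : l ≤ k) : IsCylinder l f := by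
  obtain ⟨s, g, h1, h2, h3⟩ := hf
  exact ⟨s, g, h1.of_le (by exact_mod_cast hl), fun j hj => h2 j (hj.trans hl), h3⟩

lemma exists_dependsOn (hf : IsCylinder k f) : ∃ s : Finset ι, DependsOn f (s : Set ι) := by
  obtain ⟨s, g, h1, h2, h3⟩ := hf
  refine ⟨s, fun x y hxy => ?_⟩
  rw [h3, h3]
  congr 1
  ext i
  exact hxy i i.2

lemma measurable (hf : IsCylinder k f) : Measurable f := by
  obtain ⟨s, g, h1, h2, h3⟩ := hf
  rw [show f = fun x => g (fun i => x i) from funext h3]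
  have := h1.continuous.measurable
  fun_prop

lemma exists_bound (hf : IsCylinder k f) : ∃ C, ∀ x, |f x| ≤ C := by
  obtain ⟨s, g, h1, h2, h3⟩ := hf
  obtain ⟨C, hC⟩ := h2 0 (Nat.zero_le _)
  refine ⟨C, fun x => ?_⟩
  have := hC (fun i => x i)
  rwa [norm_iteratedFDeriv_zero, ← h3] at this

lemma hasDerivAt (hf : IsCylinder (k + 1) f) (i : ι) (x : ι → ℝ) (u : ℝ) :
    HasDerivAt (fun u => f (Function.update x i u)) (partialDeriv i f (Function.update x i u)) u := by
  obtain ⟨s, g, h1, h2, h3⟩ := hf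
  exact hasDerivAt_update_of_hasLineDerivAt (fun x =>
    ⟨_, hasLineDerivAt_of_comp_domRestrict (h1.differentiable (by simp)) h3 x _⟩) x u

lemma partialDeriv (hf : IsCylinder (k + 1) f) (i : ι) : IsCylinder k (partialDeriv i f) := by
  obtain ⟨s, g, h1, h2, h3⟩ := hf
  have hc : ContDiff ℝ k (fderiv ℝ g) := h1.fderiv_right (by norm_cast)
  refine ⟨s, fun y => fderiv ℝ g y (fun j => (Pi.single i 1 : ι → ℝ) j), hc.clm_apply contDiff_const,
    fun j hj => ?_, fun x =>
      (hasLineDerivAt_of_comp_domRestrict (h1.differentiable (by simp)) h3 x _).lineDeriv⟩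
  obtain ⟨C, hC⟩ := h2 (j + 1) (by omega)
  refine ⟨‖(fun j : s => (Pi.single i 1 : ι → ℝ) j)‖ * C, fun y => ?_⟩
  refine (norm_iteratedFDeriv_clm_apply_const (N := k) hc.contDiffAt (by exact_mod_cast hj)).trans ?_
  rw [norm_iteratedFDeriv_fderiv]
  gcongr
  exact hC y

/-- Allows two cylinder functions to be represented on a common finite set of coordinates, as needed
for their difference. -/
lemma exists_rep_of_subset {s u : Finset ι} (hsu : s ⊆ u) {g : (s → ℝ) → ℝ} (h1 : ContDiff ℝ k g)
    (h2 : ∀ j ≤ k, ∃ C : ℝ, ∀ y, ‖iteratedFDeriv ℝ j g y‖ ≤ C)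
    (h3 : ∀ x : ι → ℝ, f x = g (fun i => x i)) :
    ∃ g : (u → ℝ) → ℝ, ContDiff ℝ k g ∧ (∀ j ≤ k, ∃ C : ℝ, ∀ y, ‖iteratedFDeriv ℝ j g y‖ ≤ C) ∧
      ∀ x : ι → ℝ, f x = g (fun i => x i) := by
  let L : (u → ℝ) →L[ℝ] (s → ℝ) :=
    ContinuousLinearMap.pi fun i => ContinuousLinearMap.proj (⟨i.1, hsu i.2⟩ : u)
  refine ⟨g ∘ L, h1.comp L.contDiff, fun j hj => ?_, fun x => h3 x⟩
  obtain ⟨C, hC⟩ := h2 j hj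
  refine ⟨C * ∏ _ : Fin j, ‖L‖, fun y => ?_⟩
  rw [L.iteratedFDeriv_comp_right h1 y (by exact_mod_cast hj)]
  refine (ContinuousMultilinearMap.norm_compContinuousLinearMap_le _ _).trans ?_
  gcongr
  exact hC _

lemma sub (hf : IsCylinder k f) (hg : IsCylinder k g) : IsCylinder k (f - g) := by
  obtain ⟨s, a, h1, h2, h3⟩ := hf
  obtain ⟨t, b, h1', h2', h3'⟩ := hg
  obtain ⟨a, ha1, ha2, ha3⟩ := exists_rep_of_subset (Finset.subset_union_left (s₂ := t)) h1 h2 h3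
  obtain ⟨b, hb1, hb2, hb3⟩ := exists_rep_of_subset (Finset.subset_union_right (s₁ := s)) h1' h2' h3'
  refine ⟨s ∪ t, a - b, ha1.sub hb1, fun j hj => ?_, fun x => ?_⟩
  · obtain ⟨C, hC⟩ := ha2 j hj
    obtain ⟨D, hD⟩ := hb2 j hj
    refine ⟨C + D, fun y => ?_⟩
    rw [iteratedFDeriv_sub_apply (ha1.of_le (by exact_mod_cast hj)).contDiffAt
      (hb1.of_le (by exact_mod_cast hj)).contDiffAt]
    exact (norm_sub_le _ _).trans (add_le_add (hC y) (hD y))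
  · rw [Pi.sub_apply, ha3, hb3, Pi.sub_apply]

lemma comp_sum (h : ℝ → ℝ) (hh : ContDiff ℝ k h)
    (hb : ∀ j ≤ k, ∃ C : ℝ, ∀ y, ‖iteratedDeriv j h y‖ ≤ C) (s : Finset ι) (ξ : ι → ℝ) :
    IsCylinder k (fun x => h (∑ i ∈ s, ξ i * x i)) := by
  let L : (s → ℝ) →L[ℝ] ℝ := ∑ i : s, ξ i • ContinuousLinearMap.proj i
  refine ⟨s, h ∘ L, hh.comp L.contDiff, fun j hj => ?_, fun x => ?_⟩
  · obtain ⟨C, hC⟩ := hb j hj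
    refine ⟨C * ∏ _ : Fin j, ‖L‖, fun y => ?_⟩
    rw [L.iteratedFDeriv_comp_right hh y (by exact_mod_cast hj)]
    refine (ContinuousMultilinearMap.norm_compContinuousLinearMap_le _ _).trans ?_
    gcongr
    rw [norm_iteratedFDeriv_eq_norm_iteratedDeriv]
    exact hC _
  · simp only [L, Function.comp_apply, _root_.sum_apply, _root_.smul_apply,
      ContinuousLinearMap.proj_apply, smul_eq_mul]
    rw [← Finset.sum_coe_sort]

lemma cos_sum (k : ℕ) (s : Finset ι) (ξ : ι → ℝ) :
    IsCylinder k (fun x => Real.cos (∑ i ∈ s, ξ i * x i)) :=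
  comp_sum Real.cos Real.contDiff_cos
    (fun j _ => ⟨1, fun y => Real.abs_iteratedDeriv_cos_le_one j y⟩) s ξ

lemma sin_sum (k : ℕ) (s : Finset ι) (ξ : ι → ℝ) :
    IsCylinder k (fun x => Real.sin (∑ i ∈ s, ξ i * x i)) :=
  comp_sum Real.sin Real.contDiff_sin
    (fun j _ => ⟨1, fun y => Real.abs_iteratedDeriv_sin_le_one j y⟩) s ξ

end IsCylinder

lemma dependsOn_partialDeriv {s : Set ι} (hf : DependsOn f s) (i : ι) :
    DependsOn (partialDeriv i f) s := by
  intro x y hxy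
  unfold partialDeriv lineDeriv
  congr 1
  ext t
  exact hf fun j hj => by simp [hxy j hj]

lemma partialDeriv_eq_zero {s : Set ι} (hf : DependsOn f s) {i : ι} (hi : i ∉ s) (x : ι → ℝ) :
    partialDeriv i f x = 0 := by
  unfold partialDeriv lineDeriv
  rw [show (fun t : ℝ => f (x + t • Pi.single i 1)) = fun _ => f x from ?_, deriv_const]
  ext t
  refine hf fun j hj => ?_
  have : j ≠ i := fun h => hi (h ▸ hj)
  simp [this]

lemma partialDeriv_sub (hf : IsCylinder 1 f) (hg : IsCylinder 1 g) (i : ι) (x : ι → ℝ) :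
    partialDeriv i (f - g) x = partialDeriv i f x - partialDeriv i g x :=
  congrFun (partialDeriv_eq_of_hasDerivAt_update (f' := partialDeriv i f - partialDeriv i g)
    fun x u => (hf.hasDerivAt i x u).sub (hg.hasDerivAt i x u)) x

lemma dependsOn_sub {s : Set ι} (hf : DependsOn f s) (hg : DependsOn g s) : DependsOn (f - g) s :=
  fun x y hxy => by rw [Pi.sub_apply, Pi.sub_apply, hf hxy, hg hxy]

lemma cylGamma_eq_sum {s : Finset ι} (hf : DependsOn f (s : Set ι)) (x : ι → ℝ) :
    cylGamma f x = ∑ i ∈ s, partialDeriv i f x ^ 2 := by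
  refine finsum_eq_sum_of_support_subset _ fun i hi => ?_
  by_contra h
  exact hi (by simp [partialDeriv_eq_zero hf h])

lemma cylL_eq_sum {s : Finset ι} (hf : DependsOn f (s : Set ι)) (x : ι → ℝ) :
    cylL f x = ∑ i ∈ s, (partialDeriv i (partialDeriv i f) x - x i * partialDeriv i f x) := by
  refine finsum_eq_sum_of_support_subset _ fun i hi => ?_
  by_contra h
  refine hi ?_
  simp only
  rw [partialDeriv_eq_zero hf h, partialDeriv_eq_zero (dependsOn_partialDeriv hf i) h]
  simp

/-- Letting ξ vanish off s makes the derivative equal to ξ_i for every i, whether or not i lies in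
s. -/
lemma hasDerivAt_sum_update {s : Finset ι} {ξ : ι → ℝ} (hξ : ∀ j, j ∉ s → ξ j = 0) (i : ι)
    (x : ι → ℝ) (u : ℝ) :
    HasDerivAt (fun u => ∑ j ∈ s, ξ j * Function.update x i u j) (ξ i) u := by
  have h (j : ι) (_ : j ∈ s) : HasDerivAt (fun u => ξ j * Function.update x i u j)
      (ξ j * (Pi.single i 1 : ι → ℝ) j) u := by
    refine HasDerivAt.const_mul _ ?_
    rcases eq_or_ne j i with rfl | hj
    · simpa using hasDerivAt_id' u
    · simpa [hj] using hasDerivAt_const u (x j)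
  refine (HasDerivAt.fun_sum h).congr_deriv ?_
  by_cases hi : i ∈ s
  · rw [Finset.sum_eq_single_of_mem i hi fun j _ hj => by simp [hj]]
    simp
  · rw [hξ i hi]
    refine Finset.sum_eq_zero fun j hj => ?_
    have : j ≠ i := fun h => hi (h ▸ hj)
    simp [this]

lemma partialDeriv_cos_sum {s : Finset ι} {ξ : ι → ℝ} (hξ : ∀ j, j ∉ s → ξ j = 0) (i : ι) :
    partialDeriv i (fun x => Real.cos (∑ j ∈ s, ξ j * x j)) =
      fun x => -Real.sin (∑ j ∈ s, ξ j * x j) * ξ i :=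
  partialDeriv_eq_of_hasDerivAt_update fun x u => (hasDerivAt_sum_update hξ i x u).cos

lemma partialDeriv_sin_sum {s : Finset ι} {ξ : ι → ℝ} (hξ : ∀ j, j ∉ s → ξ j = 0) (i : ι) :
    partialDeriv i (fun x => Real.sin (∑ j ∈ s, ξ j * x j)) =
      fun x => Real.cos (∑ j ∈ s, ξ j * x j) * ξ i :=
  partialDeriv_eq_of_hasDerivAt_update fun x u => (hasDerivAt_sum_update hξ i x u).sin

lemma dependsOn_comp_sum (h : ℝ → ℝ) (s : Finset ι) (ξ : ι → ℝ) :
    DependsOn (fun x : ι → ℝ => h (∑ j ∈ s, ξ j * x j)) (s : Set ι) := by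
  intro x y hxy
  simp only
  congr 1
  exact Finset.sum_congr rfl fun j hj => by rw [hxy j hj]

lemma cylL_cos_sum {s : Finset ι} {ξ : ι → ℝ} (hξ : ∀ j, j ∉ s → ξ j = 0) (x : ι → ℝ) :
    cylL (fun x => Real.cos (∑ j ∈ s, ξ j * x j)) x =
      -(∑ j ∈ s, ξ j ^ 2) * Real.cos (∑ j ∈ s, ξ j * x j) +
        (∑ j ∈ s, ξ j * x j) * Real.sin (∑ j ∈ s, ξ j * x j) := by
  have h2 (i : ι) : partialDeriv i (partialDeriv i (fun x => Real.cos (∑ j ∈ s, ξ j * x j))) =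
      fun x => -(Real.cos (∑ j ∈ s, ξ j * x j) * ξ i) * ξ i := by
    rw [partialDeriv_cos_sum hξ]
    exact partialDeriv_eq_of_hasDerivAt_update fun x u =>
      (hasDerivAt_sum_update hξ i x u).sin.fun_neg.mul_const _
  rw [cylL_eq_sum (dependsOn_comp_sum _ s ξ)]
  simp_rw [h2, partialDeriv_cos_sum hξ]
  generalize Real.cos (∑ j ∈ s, ξ j * x j) = c
  generalize Real.sin (∑ j ∈ s, ξ j * x j) = d
  rw [← Finset.sum_neg_distrib, Finset.sum_mul, Finset.sum_mul, ← Finset.sum_add_distrib]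
  exact Finset.sum_congr rfl fun i _ => by ring

lemma cylL_sin_sum {s : Finset ι} {ξ : ι → ℝ} (hξ : ∀ j, j ∉ s → ξ j = 0) (x : ι → ℝ) :
    cylL (fun x => Real.sin (∑ j ∈ s, ξ j * x j)) x =
      -(∑ j ∈ s, ξ j ^ 2) * Real.sin (∑ j ∈ s, ξ j * x j) -
        (∑ j ∈ s, ξ j * x j) * Real.cos (∑ j ∈ s, ξ j * x j) := by
  have h2 (i : ι) : partialDeriv i (partialDeriv i (fun x => Real.sin (∑ j ∈ s, ξ j * x j))) =
      fun x => (-Real.sin (∑ j ∈ s, ξ j * x j) * ξ i) * ξ i := by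
    rw [partialDeriv_sin_sum hξ]
    exact partialDeriv_eq_of_hasDerivAt_update fun x u =>
      (hasDerivAt_sum_update hξ i x u).cos.mul_const _
  rw [cylL_eq_sum (dependsOn_comp_sum _ s ξ)]
  simp_rw [h2, partialDeriv_sin_sum hξ]
  generalize Real.cos (∑ j ∈ s, ξ j * x j) = c
  generalize Real.sin (∑ j ∈ s, ξ j * x j) = d
  rw [← Finset.sum_neg_distrib, Finset.sum_mul, Finset.sum_mul, ← Finset.sum_sub_distrib]
  exact Finset.sum_congr rfl fun i _ => by ring

end Cylinder

end WienerChaos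

/-! ### Gaussian integration by parts and symmetry of L -/

namespace WienerChaos

section IntegrationByParts

open scoped Classical

variable {ι Ω : Type*} [MeasurableSpace Ω] {P : Measure Ω} {X : ι → Ω → ℝ}

/-- Gaussian integration by parts in one coordinate of an i.i.d. standard Gaussian family. -/
lemma integral_deriv_update (hX : ∀ i, HasLaw (X i) (gaussianReal 0 1) P) (hi : iIndepFun X P)
    {w w' : (ι → ℝ) → ℝ} {s : Finset ι} (i : ι) (hs : DependsOn w (s : Set ι))
    (hs' : DependsOn w' (s : Set ι)) (hm : Measurable w) (hm' : Measurable w')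
    (hd : ∀ x u, HasDerivAt (fun u => w (Function.update x i u)) (w' (Function.update x i u)) u)
    (h1 : Integrable (fun ω => w (fun j => X j ω)) P)
    (h2 : Integrable (fun ω => w' (fun j => X j ω)) P)
    (h3 : Integrable (fun ω => X i ω * w (fun j => X j ω)) P) :
    ∫ ω, w' (fun j => X j ω) ∂P = ∫ ω, X i ω * w (fun j => X j ω) ∂P := by
  have := hi.isProbabilityMeasure
  let Z : Ω → (s.erase i → ℝ) := fun ω j => X j ω
  -- Rebuilds a point from its coordinate i and the other coordinates in s, padding with 0; the
  -- padding is harmless because both functions depend on s only.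
  let e : ℝ × (s.erase i → ℝ) → (ι → ℝ) := fun q =>
    Function.update (fun j => if h : j ∈ s.erase i then q.2 ⟨j, h⟩ else 0) i q.1
  have he : Measurable e := by
    rw [measurable_pi_iff]
    intro j
    rcases eq_or_ne j i with rfl | hj
    · simpa [e] using measurable_fst
    · by_cases h : j ∈ s.erase i
      · simp only [e, Function.update_of_ne hj, dif_pos h]
        fun_prop
      · simp only [e, Function.update_of_ne hj, dif_neg h]
        fun_prop
  have hagree (ω : Ω) : ∀ j ∈ (s : Set ι), X j ω = e (X i ω, Z ω) j := by
    intro j hj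
    rcases eq_or_ne j i with rfl | hji
    · simp [e]
    · have : j ∈ s.erase i := Finset.mem_erase.2 ⟨hji, hj⟩
      simp only [e, Function.update_of_ne hji, dif_pos this, Z]
  have hw (ω : Ω) : w (fun j => X j ω) = w (e (X i ω, Z ω)) := hs (hagree ω)
  have hw' (ω : Ω) : w' (fun j => X j ω) = w' (e (X i ω, Z ω)) := hs' (hagree ω)
  have hZ : AEMeasurable Z P := aemeasurable_pi_lambda _ fun j => (hX j).aemeasurable
  have hind : IndepFun (X i) Z P := by
    have := hi.indepFun_finset₀ {i} (s.erase i) (by simp) fun j => (hX j).aemeasurable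
    exact this.comp (φ := fun y : (({i} : Finset ι) → ℝ) => y ⟨i, by simp⟩) (ψ := id)
      (by fun_prop) measurable_id
  have hlaw : HasLaw (fun ω => (X i ω, Z ω)) ((gaussianReal 0 1).prod (P.map Z)) P :=
    hind.hasLaw_prod (hX i) ⟨hZ, rfl⟩
  have : IsProbabilityMeasure (P.map Z) := Measure.isProbabilityMeasure_map hZ
  have hint {φ : ℝ × (s.erase i → ℝ) → ℝ} (hφ : Measurable φ)
      (h : Integrable (fun ω => φ (X i ω, Z ω)) P) :
      Integrable φ ((gaussianReal 0 1).prod (P.map Z)) := by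
    rw [← hlaw.map_eq, integrable_map_measure hφ.aestronglyMeasurable hlaw.aemeasurable]
    exact h
  simp only [hw, hw'] at h1 h2 h3 ⊢
  have i1 := hint (φ := fun q => w (e q)) (hm.comp he) h1
  have i2 := hint (φ := fun q => w' (e q)) (hm'.comp he) h2
  have i3 := hint (φ := fun q => q.1 * w (e q)) (measurable_fst.mul (hm.comp he)) h3
  have e2 := hlaw.integral_comp (f := fun q => w' (e q)) i2.aestronglyMeasurable
  have e3 := hlaw.integral_comp (f := fun q => q.1 * w (e q)) i3.aestronglyMeasurable
  simp only [Function.comp_def] at e2 e3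
  rw [e2, e3, integral_prod_symm _ i2, integral_prod_symm _ i3]
  refine integral_congr_ae ?_
  -- For almost every value of the other coordinates the sections are integrable, and the
  -- one-dimensional Stein identity applies.
  filter_upwards [i1.prod_left_ae, i2.prod_left_ae, i3.prod_left_ae] with z z1 z2 z3
  refine integral_deriv_gaussianReal (fun u => ?_) z1 z2 z3
  exact hd (fun j => if h : j ∈ s.erase i then z ⟨j, h⟩ else 0) u

section Basic

variable {f g : (ι → ℝ) → ℝ} {k : ℕ}

/-- The X_i are only almost everywhere measurable, so the composition is factored through the finite
block of coordinates on which f depends. -/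
lemma aemeasurable_comp_family (hX : ∀ i, HasLaw (X i) (gaussianReal 0 1) P)
    {s : Finset ι} (hs : DependsOn f (s : Set ι)) (hf : Measurable f) :
    AEMeasurable (fun ω => f (fun j => X j ω)) P := by
  let e : (s → ℝ) → (ι → ℝ) := fun q j => if h : j ∈ s then q ⟨j, h⟩ else 0
  have he : Measurable e := by
    rw [measurable_pi_iff]
    intro j
    by_cases h : j ∈ s
    · simp only [e, dif_pos h]; fun_prop
    · simp only [e, dif_neg h]; fun_prop
  have : (fun ω => f (fun j => X j ω)) = fun ω => f (e (fun j : s => X j ω)) := by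
    ext ω
    refine hs fun j hj => ?_
    have : j ∈ s := hj
    simp [e, this]
  rw [this]
  exact (hf.comp he).comp_aemeasurable (aemeasurable_pi_lambda _ fun j => (hX j).aemeasurable)

lemma IsCylinder.aestronglyMeasurable (hX : ∀ i, HasLaw (X i) (gaussianReal 0 1) P)
    (hf : IsCylinder k f) : AEStronglyMeasurable (fun ω => f (fun j => X j ω)) P := by
  obtain ⟨s, hs⟩ := hf.exists_dependsOn
  exact (aemeasurable_comp_family hX hs hf.measurable).aestronglyMeasurable

variable [IsFiniteMeasure P]

lemma IsCylinder.memLp (hX : ∀ i, HasLaw (X i) (gaussianReal 0 1) P)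
    (hf : IsCylinder k f) (q : ENNReal) : MemLp (fun ω => f (fun j => X j ω)) q P := by
  obtain ⟨C, hC⟩ := hf.exists_bound
  exact MemLp.of_bound (hf.aestronglyMeasurable hX) C (ae_of_all _ fun ω => hC _)

lemma IsCylinder.memLp_mul (hX : ∀ i, HasLaw (X i) (gaussianReal 0 1) P)
    (hf : IsCylinder k f) {q : ENNReal} {H : Ω → ℝ} (hH : MemLp H q P) :
    MemLp (fun ω => H ω * f (fun j => X j ω)) q P :=
  (hf.memLp hX ⊤).mul (r := q) hH

end Basic

lemma integrable_mul_of_memLp_two {U V : Ω → ℝ} (hU : MemLp U 2 P) (hV : MemLp V 2 P) :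
    Integrable (fun ω => U ω * V ω) P := hU.integrable_mul hV

variable {f g : (ι → ℝ) → ℝ} {i : ι}

/-- Integration by parts against a product of a (not necessarily bounded) function and a bounded
cylinder function. -/
lemma integral_mul_partialDeriv (hX : ∀ i, HasLaw (X i) (gaussianReal 0 1) P) (hi : iIndepFun X P)
    {v v' : (ι → ℝ) → ℝ} {s : Finset ι} (hv : DependsOn v (s : Set ι))
    (hv' : DependsOn v' (s : Set ι)) (hvm : Measurable v) (hvm' : Measurable v')
    (hd : ∀ x u, HasDerivAt (fun u => v (Function.update x i u)) (v' (Function.update x i u)) u)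
    (h1 : MemLp (fun ω => v (fun j => X j ω)) 2 P) (h2 : MemLp (fun ω => v' (fun j => X j ω)) 2 P)
    (hg : IsCylinder 1 g) :
    ∫ ω, v' (fun j => X j ω) * g (fun j => X j ω) ∂P =
      ∫ ω, v (fun j => X j ω) *
        (X i ω * g (fun j => X j ω) - partialDeriv i g (fun j => X j ω)) ∂P := by
  have := hi.isProbabilityMeasure
  obtain ⟨t, ht⟩ := hg.exists_dependsOn
  have hst : (s : Set ι) ⊆ (s ∪ t : Finset ι) := by simp
  have hts : (t : Set ι) ⊆ (s ∪ t : Finset ι) := by simp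
  have hg' := hg.partialDeriv i
  have hXi := memLp_of_hasLaw (hX i) (q := 2) (by simp)
  have i1 := integrable_mul_of_memLp_two h1 (hg.memLp hX 2)
  have i2 := integrable_mul_of_memLp_two h2 (hg.memLp hX 2)
  have i3 := integrable_mul_of_memLp_two h1 (hg'.memLp hX 2)
  have i4 := integrable_mul_of_memLp_two h1 (hg.memLp_mul hX hXi)
  have key := integral_deriv_update hX hi (w := fun x => v x * g x)
    (w' := fun x => v' x * g x + v x * partialDeriv i g x) (s := s ∪ t) i
    (fun x y hxy => by
      simp only [hv fun j hj => hxy j (hst hj), ht fun j hj => hxy j (hts hj)])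
    (fun x y hxy => by
      simp only [hv fun j hj => hxy j (hst hj), ht fun j hj => hxy j (hts hj),
        hv' fun j hj => hxy j (hst hj), dependsOn_partialDeriv ht i fun j hj => hxy j (hts hj)])
    (hvm.mul hg.measurable)
    ((hvm'.mul hg.measurable).add (hvm.mul hg'.measurable))
    (fun x u => (hd x u).fun_mul (hg.hasDerivAt i x u))
    i1 (i2.fun_add i3) (i4.congr (ae_of_all _ fun ω => by ring))
  rw [integral_add i2 i3] at key
  have : ∫ ω, v (fun j => X j ω) *
        (X i ω * g (fun j => X j ω) - partialDeriv i g (fun j => X j ω)) ∂P =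
      ∫ ω, v (fun j => X j ω) * (X i ω * g (fun j => X j ω)) ∂P -
        ∫ ω, v (fun j => X j ω) * partialDeriv i g (fun j => X j ω) ∂P := by
    rw [← integral_sub i4 i3]
    exact integral_congr_ae (ae_of_all _ fun ω => by simp only [mul_sub])
  rw [this, eq_sub_iff_add_eq, key]
  exact integral_congr_ae (ae_of_all _ fun ω => by ring)

lemma integral_partialDeriv_mul (hX : ∀ i, HasLaw (X i) (gaussianReal 0 1) P) (hi : iIndepFun X P)
    (hf : IsCylinder 1 f) (hg : IsCylinder 1 g) (i : ι) :
    ∫ ω, partialDeriv i f (fun j => X j ω) * g (fun j => X j ω) ∂P =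
      ∫ ω, f (fun j => X j ω) *
        (X i ω * g (fun j => X j ω) - partialDeriv i g (fun j => X j ω)) ∂P := by
  have := hi.isProbabilityMeasure
  obtain ⟨s, hs⟩ := hf.exists_dependsOn
  exact integral_mul_partialDeriv hX hi hs (dependsOn_partialDeriv hs i) hf.measurable
    (hf.partialDeriv i).measurable (hf.hasDerivAt i) (hf.memLp hX 2)
    ((hf.partialDeriv i).memLp hX 2) hg

lemma memLp_cylL (hX : ∀ i, HasLaw (X i) (gaussianReal 0 1) P) [IsFiniteMeasure P]
    (hf : IsCylinder 2 f) : MemLp (fun ω => cylL f (fun j => X j ω)) 2 P := by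
  obtain ⟨s, hs⟩ := hf.exists_dependsOn
  simp_rw [cylL_eq_sum hs]
  exact memLp_finsetSum _ fun i _ => (((hf.partialDeriv i).partialDeriv i).memLp hX 2).sub
    ((hf.partialDeriv i).memLp_mul hX (memLp_of_hasLaw (hX i) (by simp)))

/-- The Dirichlet form of the Ornstein-Uhlenbeck operator. -/
lemma integral_mul_cylL (hX : ∀ i, HasLaw (X i) (gaussianReal 0 1) P) (hi : iIndepFun X P)
    (hf : IsCylinder 1 f) (hg : IsCylinder 2 g) {s : Finset ι} (hs : DependsOn g (s : Set ι)) :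
    ∫ ω, f (fun j => X j ω) * cylL g (fun j => X j ω) ∂P =
      -∑ i ∈ s, ∫ ω, partialDeriv i f (fun j => X j ω) * partialDeriv i g (fun j => X j ω) ∂P := by
  have := hi.isProbabilityMeasure
  simp_rw [cylL_eq_sum hs, Finset.mul_sum]
  rw [integral_finsetSum, ← Finset.sum_neg_distrib]
  · refine Finset.sum_congr rfl fun i _ => ?_
    rw [integral_partialDeriv_mul hX hi hf (hg.partialDeriv i), ← integral_neg]
    exact integral_congr_ae (ae_of_all _ fun ω => by ring)
  · intro i _
    exact integrable_mul_of_memLp_two (hf.memLp hX 2)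
      ((((hg.partialDeriv i).partialDeriv i).memLp hX 2).sub
        ((hg.partialDeriv i).memLp_mul hX (memLp_of_hasLaw (hX i) (by simp))))

lemma integral_mul_cylL_comm (hX : ∀ i, HasLaw (X i) (gaussianReal 0 1) P) (hi : iIndepFun X P)
    (hf : IsCylinder 2 f) (hg : IsCylinder 2 g) :
    ∫ ω, f (fun j => X j ω) * cylL g (fun j => X j ω) ∂P =
      ∫ ω, cylL f (fun j => X j ω) * g (fun j => X j ω) ∂P := by
  obtain ⟨s, hs⟩ := hf.exists_dependsOn
  obtain ⟨t, ht⟩ := hg.exists_dependsOn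
  have hst : (s : Set ι) ⊆ (s ∪ t : Finset ι) := by simp
  have hts : (t : Set ι) ⊆ (s ∪ t : Finset ι) := by simp
  rw [integral_mul_cylL hX hi (hf.of_le (by norm_num)) hg (ht.mono hts)]
  simp_rw [mul_comm (cylL f _)]
  rw [integral_mul_cylL hX hi (hg.of_le (by norm_num)) hf (hs.mono hst)]
  simp_rw [mul_comm (partialDeriv _ f _)]

lemma integral_cylGamma (hX : ∀ i, HasLaw (X i) (gaussianReal 0 1) P) (hi : iIndepFun X P)
    (hf : IsCylinder 2 f) :
    ∫ ω, cylGamma f (fun j => X j ω) ∂P =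
      -∫ ω, f (fun j => X j ω) * cylL f (fun j => X j ω) ∂P := by
  have := hi.isProbabilityMeasure
  obtain ⟨s, hs⟩ := hf.exists_dependsOn
  rw [integral_mul_cylL hX hi (hf.of_le (by norm_num)) hf hs, neg_neg]
  simp_rw [cylGamma_eq_sum hs, sq]
  exact integral_finsetSum _ fun i _ => integrable_mul_of_memLp_two
    ((hf.partialDeriv i).memLp hX 2) ((hf.partialDeriv i).memLp hX 2)

/-- Limits of integrals of products under `L²` convergence. -/
lemma tendsto_integral_mul_of_eLpNorm {U : Ω → ℝ} {V : ℕ → Ω → ℝ} {H : Ω → ℝ}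
    (hV : ∀ n, MemLp (V n) 2 P) (hU : MemLp U 2 P) (hH : MemLp H 2 P)
    (h : Tendsto (fun n => eLpNorm (fun ω => V n ω - U ω) 2 P) atTop (𝓝 0)) :
    Tendsto (fun n => ∫ ω, V n ω * H ω ∂P) atTop (𝓝 (∫ ω, U ω * H ω ∂P)) := by
  refine tendsto_integral_of_L1' _ (integrable_mul_of_memLp_two hU hH).aestronglyMeasurable
    (Eventually.of_forall fun n => integrable_mul_of_memLp_two (hV n) hH) ?_
  have hb (n : ℕ) : eLpNorm ((fun ω => V n ω * H ω) - fun ω => U ω * H ω) 1 P ≤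
      eLpNorm (fun ω => V n ω - U ω) 2 P * eLpNorm H 2 P := by
    rw [show ((fun ω => V n ω * H ω) - fun ω => U ω * H ω) =
      (fun ω => V n ω - U ω) • H by ext ω; simp [sub_mul]]
    exact eLpNorm_smul_le_mul_eLpNorm hH.aestronglyMeasurable
      ((hV n).sub hU).aestronglyMeasurable
  refine tendsto_of_tendsto_of_tendsto_of_le_of_le tendsto_const_nhds ?_ (fun _ => zero_le) hb
  have := ENNReal.Tendsto.mul_const (b := eLpNorm H 2 P) h (Or.inr hH.eLpNorm_ne_top)
  rwa [zero_mul] at this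

/-- The symmetry of L on cylinder functions passes to its closure: F solves L F = -2F weakly against
cylinder functions. From here on this is the form in which the eigenvalue equation enters. -/
lemma integral_mul_cylL_of_inSecondChaos (hX : ∀ i, HasLaw (X i) (gaussianReal 0 1) P)
    (hi : iIndepFun X P) {F : Ω → ℝ} (hF : InSecondChaos X P F) (hg : IsCylinder 2 g) :
    ∫ ω, F ω * cylL g (fun j => X j ω) ∂P = -2 * ∫ ω, F ω * g (fun j => X j ω) ∂P := by
  have := hi.isProbabilityMeasure
  obtain ⟨h1, h2, f, hf, hf1, hf2⟩ := hF
  have t1 := tendsto_integral_mul_of_eLpNorm (fun n => (hf n).memLp hX 2) h1 (memLp_cylL hX hg) hf1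
  have t2 := tendsto_integral_mul_of_eLpNorm (fun n => memLp_cylL hX (hf n)) h2 (hg.memLp hX 2) hf2
  simp_rw [fun n => integral_mul_cylL_comm hX hi (hf n) hg] at t1
  rw [tendsto_nhds_unique t1 t2, ← integral_const_mul]
  exact integral_congr_ae (ae_of_all _ fun ω => by ring)

end IntegrationByParts

end WienerChaos

/-! ### Fourier transform of an element of the second chaos -/

namespace WienerChaos

section Fourier

open scoped Classical

variable {ι Ω : Type*} [MeasurableSpace Ω] {P : Measure Ω} {X : ι → Ω → ℝ}

/-- The singular equation `r φ' = (2 - c r²) φ` has the regular solutions `K r² exp (-c r² / 2)`. -/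
lemma eq_of_singular_ode {φ φ' : ℝ → ℝ} {a c : ℝ} (h1 : ∀ r, HasDerivAt φ (φ' r) r)
    (h2 : HasDerivAt φ' a 0) (h3 : ∀ r, r * φ' r = (2 - c * r ^ 2) * φ r) :
    φ 1 = a / 2 * Real.exp (-c / 2) := by
  set K := φ 1 * Real.exp (c / 2) with hK
  have hφ0 : φ 0 = 0 := by have := h3 0; simpa using this.symm
  have hφ : ∀ r ∈ Set.Ioi (0 : ℝ), φ r = K * r ^ 2 * Real.exp (-(c * r ^ 2 / 2)) := by
    -- Integrating factor: φ(r) e^(cr²/2) / r² is constant on (0, ∞), with value K read off at r =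
    -- 1.
    have hd : ∀ r ∈ Set.Ioi (0 : ℝ), HasDerivAt (fun r => φ r * Real.exp (c * r ^ 2 / 2) * (r ^ 2)⁻¹)
        0 r := by
      intro r hr
      have hr : r ≠ 0 := ne_of_gt hr
      have e1 : HasDerivAt (fun r : ℝ => Real.exp (c * r ^ 2 / 2))
          (Real.exp (c * r ^ 2 / 2) * (c * r)) r := by
        have := (((hasDerivAt_pow 2 r).const_mul c).div_const 2).exp
        refine this.congr_deriv ?_
        simp only [Nat.cast_ofNat, Nat.add_one_sub_one, pow_one]
        ring
      have e2 := (hasDerivAt_pow 2 r).fun_inv (pow_ne_zero 2 hr)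
      refine (((h1 r).fun_mul e1).fun_mul e2).congr_deriv ?_
      simp only [Nat.cast_ofNat, Nat.add_one_sub_one, pow_one]
      have := h3 r
      field_simp
      linear_combination Real.exp (c * r ^ 2 / 2) * this
    intro r hr
    have hc := IsOpen.is_const_of_deriv_eq_zero isOpen_Ioi isPreconnected_Ioi
      (fun x hx => (hd x hx).differentiableAt.differentiableWithinAt) (fun x hx => (hd x hx).deriv)
      hr (Set.mem_Ioi.2 one_pos)
    simp only [one_pow, mul_one, inv_one] at hc
    have hr : r ≠ 0 := ne_of_gt hr
    rw [hK, ← hc, Real.exp_neg]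
    field_simp
  have hφ'0 : φ' 0 = 0 := by
    have t1 := (hasDerivAt_iff_tendsto_slope_zero.1 (h1 0)).mono_left
      (nhdsWithin_mono 0 (s := Set.Ioi 0) fun x hx => ne_of_gt hx)
    have t2 : Tendsto (fun r : ℝ => K * r * Real.exp (-(c * r ^ 2 / 2))) (𝓝[>] 0) (𝓝 0) := by
      have : Continuous (fun r : ℝ => K * r * Real.exp (-(c * r ^ 2 / 2))) := by fun_prop
      have := (this.tendsto 0).mono_left (nhdsWithin_le_nhds (s := Set.Ioi 0))
      simpa using this
    refine tendsto_nhds_unique (t1.congr' ?_) t2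
    filter_upwards [self_mem_nhdsWithin] with r hr
    rw [zero_add, hφ r hr, hφ0, sub_zero, smul_eq_mul]
    have hr : r ≠ 0 := ne_of_gt hr
    field_simp
  -- The equation gives φ'(r)/r = (2 - cr²) K e^(-cr²/2), which tends to 2K at 0, while the same
  -- quotient tends to the derivative a of φ' at 0.
  have haK : a = 2 * K := by
    have t1 := (hasDerivAt_iff_tendsto_slope_zero.1 h2).mono_left
      (nhdsWithin_mono 0 (s := Set.Ioi 0) fun x hx => ne_of_gt hx)
    have t2 : Tendsto (fun r : ℝ => (2 - c * r ^ 2) * K * Real.exp (-(c * r ^ 2 / 2))) (𝓝[>] 0)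
        (𝓝 (2 * K)) := by
      have : Continuous (fun r : ℝ => (2 - c * r ^ 2) * K * Real.exp (-(c * r ^ 2 / 2))) := by
        fun_prop
      have := (this.tendsto 0).mono_left (nhdsWithin_le_nhds (s := Set.Ioi 0))
      simpa using this
    refine tendsto_nhds_unique (t1.congr' ?_) t2
    filter_upwards [self_mem_nhdsWithin] with r hr
    rw [zero_add, hφ'0, sub_zero, smul_eq_mul]
    have h := h3 r
    rw [hφ r hr] at h
    have hr : r ≠ 0 := ne_of_gt hr
    rw [inv_mul_eq_iff_eq_mul₀ hr]
    apply mul_left_cancel₀ hr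
    linear_combination h
  rw [haK, hK, mul_div_cancel_left₀ _ two_ne_zero, mul_assoc, ← Real.exp_add, neg_div,
    add_neg_cancel, Real.exp_zero, mul_one]

lemma hasDerivAt_integral_mul_cos {U ℓ : Ω → ℝ} (hℓ : AEMeasurable ℓ P) (h1 : Integrable U P)
    (h2 : Integrable (fun ω => U ω * ℓ ω) P) (r : ℝ) :
    HasDerivAt (fun r => ∫ ω, U ω * Real.cos (r * ℓ ω) ∂P)
      (-∫ ω, U ω * ℓ ω * Real.sin (r * ℓ ω) ∂P) r := by
  rw [← integral_neg]
  have hm (r : ℝ) : AEMeasurable (fun ω => Real.cos (r * ℓ ω)) P :=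
    Real.measurable_cos.comp_aemeasurable (hℓ.const_mul r)
  have hm' (r : ℝ) : AEMeasurable (fun ω => Real.sin (r * ℓ ω)) P :=
    Real.measurable_sin.comp_aemeasurable (hℓ.const_mul r)
  refine (hasDerivAt_integral_of_dominated_loc_of_deriv_le
    (F' := fun r ω => -(U ω * ℓ ω * Real.sin (r * ℓ ω))) (bound := fun ω => |U ω * ℓ ω|)
    (Metric.ball_mem_nhds r one_pos) ?_ ?_ ?_ ?_ h2.abs ?_).2
  · exact Eventually.of_forall fun r => h1.aestronglyMeasurable.mul (hm r).aestronglyMeasurable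
  · exact h1.mul_bdd (c := 1) (hm r).aestronglyMeasurable
      (ae_of_all _ fun ω => Real.abs_cos_le_one _)
  · exact (h2.aestronglyMeasurable.mul (hm' r).aestronglyMeasurable).neg
  · refine ae_of_all _ fun ω x _ => ?_
    rw [norm_neg, norm_mul, Real.norm_eq_abs, Real.norm_eq_abs]
    exact mul_le_of_le_one_right (abs_nonneg _) (Real.abs_sin_le_one _)
  · refine ae_of_all _ fun ω x _ => ?_
    refine ((((hasDerivAt_id' x).mul_const (ℓ ω)).cos).const_mul (U ω)).congr_deriv ?_
    ring

lemma hasDerivAt_integral_mul_sin {U ℓ : Ω → ℝ} (hℓ : AEMeasurable ℓ P) (h1 : Integrable U P)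
    (h2 : Integrable (fun ω => U ω * ℓ ω) P) (r : ℝ) :
    HasDerivAt (fun r => ∫ ω, U ω * Real.sin (r * ℓ ω) ∂P)
      (∫ ω, U ω * ℓ ω * Real.cos (r * ℓ ω) ∂P) r := by
  have hm (r : ℝ) : AEMeasurable (fun ω => Real.cos (r * ℓ ω)) P :=
    Real.measurable_cos.comp_aemeasurable (hℓ.const_mul r)
  have hm' (r : ℝ) : AEMeasurable (fun ω => Real.sin (r * ℓ ω)) P :=
    Real.measurable_sin.comp_aemeasurable (hℓ.const_mul r)
  refine (hasDerivAt_integral_of_dominated_loc_of_deriv_le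
    (F' := fun r ω => U ω * ℓ ω * Real.cos (r * ℓ ω)) (bound := fun ω => |U ω * ℓ ω|)
    (Metric.ball_mem_nhds r one_pos) ?_ ?_ ?_ ?_ h2.abs ?_).2
  · exact Eventually.of_forall fun r => h1.aestronglyMeasurable.mul (hm' r).aestronglyMeasurable
  · exact h1.mul_bdd (c := 1) (hm' r).aestronglyMeasurable
      (ae_of_all _ fun ω => Real.abs_sin_le_one _)
  · exact h2.aestronglyMeasurable.mul (hm r).aestronglyMeasurable
  · refine ae_of_all _ fun ω x _ => ?_
    rw [norm_mul, Real.norm_eq_abs, Real.norm_eq_abs]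
    exact mul_le_of_le_one_right (abs_nonneg _) (Real.abs_cos_le_one _)
  · refine ae_of_all _ fun ω x _ => ?_
    refine ((((hasDerivAt_id' x).mul_const (ℓ ω)).sin).const_mul (U ω)).congr_deriv ?_
    ring

instance : ENNReal.HolderTriple 4 4 2 where
  inv_add_inv_eq_inv := by
    rw [← two_mul, show (4 : ENNReal) = 2 * 2 by norm_num, ENNReal.mul_inv (by simp) (by simp),
      ← mul_assoc, ENNReal.mul_inv_cancel (by simp) (by simp), one_mul]

lemma memLp_mul_family (hX : ∀ i, HasLaw (X i) (gaussianReal 0 1) P) (i j : ι) :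
    MemLp (fun ω => X i ω * X j ω) 2 P :=
  (memLp_of_hasLaw (hX j) (q := 4) (by simp)).mul (memLp_of_hasLaw (hX i) (q := 4) (by simp))

lemma memLp_sum_family (hX : ∀ i, HasLaw (X i) (gaussianReal 0 1) P) (s : Finset ι) (ξ : ι → ℝ)
    {q : ENNReal} (hq : q ≠ ⊤) : MemLp (fun ω => ∑ i ∈ s, ξ i * X i ω) q P :=
  memLp_finsetSum _ fun i _ => (memLp_of_hasLaw (hX i) hq).const_mul _

/-- Put ℓ = ∑ ξ_i X_i, c = ∑ ξ_i² and φ(r) = E[F cos(rℓ)]. The weak equation tested on cos(rℓ)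
becomes r φ' = (2 - cr²) φ, with φ''(0) = -E[F ℓ²]. The sine integral satisfies the same equation
with vanishing second derivative at 0. -/
lemma integral_mul_cos_of_inSecondChaos (hX : ∀ i, HasLaw (X i) (gaussianReal 0 1) P)
    (hi : iIndepFun X P) {F : Ω → ℝ} (hF : InSecondChaos X P F) {s : Finset ι} {ξ : ι → ℝ}
    (hξ : ∀ j, j ∉ s → ξ j = 0) :
    ∫ ω, F ω * Real.cos (∑ i ∈ s, ξ i * X i ω) ∂P =
      -(∫ ω, F ω * (∑ i ∈ s, ξ i * X i ω) ^ 2 ∂P) / 2 * Real.exp (-(∑ i ∈ s, ξ i ^ 2) / 2) ∧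
    ∫ ω, F ω * Real.sin (∑ i ∈ s, ξ i * X i ω) ∂P = 0 := by
  have := hi.isProbabilityMeasure
  set ℓ : Ω → ℝ := fun ω => ∑ i ∈ s, ξ i * X i ω with hℓ
  have hF2 : MemLp F 2 P := hF.1
  have hℓ2 : MemLp ℓ 2 P := memLp_sum_family hX s ξ (by simp)
  have hℓ4 : MemLp ℓ 4 P := memLp_sum_family hX s ξ (by simp)
  have hm : AEMeasurable ℓ P := hℓ2.aestronglyMeasurable.aemeasurable
  have i0 : Integrable F P := hF2.integrable (by norm_num)
  have i1 : Integrable (fun ω => F ω * ℓ ω) P := integrable_mul_of_memLp_two hF2 hℓ2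
  have i2 : Integrable (fun ω => F ω * ℓ ω * ℓ ω) P := by
    have := integrable_mul_of_memLp_two hF2 (hℓ4.mul (r := 2) hℓ4)
    exact this.congr (ae_of_all _ fun ω => (mul_assoc _ _ _).symm)
  have hsum (r : ℝ) (ω : Ω) : ∑ i ∈ s, (r * ξ i) * X i ω = r * ℓ ω := by
    rw [hℓ, Finset.mul_sum]
    exact Finset.sum_congr rfl fun i _ => mul_assoc _ _ _
  have hsum2 (r : ℝ) : ∑ i ∈ s, (r * ξ i) ^ 2 = (∑ i ∈ s, ξ i ^ 2) * r ^ 2 := by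
    rw [mul_comm, Finset.mul_sum]
    exact Finset.sum_congr rfl fun i _ => mul_pow _ _ _
  have hcm (r : ℝ) : AEStronglyMeasurable (fun ω => Real.cos (r * ℓ ω)) P :=
    (Real.measurable_cos.comp_aemeasurable (hm.const_mul r)).aestronglyMeasurable
  have hsm (r : ℝ) : AEStronglyMeasurable (fun ω => Real.sin (r * ℓ ω)) P :=
    (Real.measurable_sin.comp_aemeasurable (hm.const_mul r)).aestronglyMeasurable
  have bc {V : Ω → ℝ} (hV : Integrable V P) (r : ℝ) :
      Integrable (fun ω => V ω * Real.cos (r * ℓ ω)) P :=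
    hV.mul_bdd (c := 1) (hcm r) (ae_of_all _ fun ω => Real.abs_cos_le_one _)
  have bs {V : Ω → ℝ} (hV : Integrable V P) (r : ℝ) :
      Integrable (fun ω => V ω * Real.sin (r * ℓ ω)) P :=
    hV.mul_bdd (c := 1) (hsm r) (ae_of_all _ fun ω => Real.abs_sin_le_one _)
  constructor
  · have h := eq_of_singular_ode (hasDerivAt_integral_mul_cos hm i0 i1)
      ((hasDerivAt_integral_mul_sin hm i1 i2 0).neg) (c := ∑ i ∈ s, ξ i ^ 2) fun r => by
        have h := integral_mul_cylL_of_inSecondChaos hX hi hF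
          (IsCylinder.cos_sum 2 s (fun i => r * ξ i))
        simp_rw [cylL_cos_sum (ξ := fun i => r * ξ i) (s := s) (fun j hj => by rw [hξ j hj, mul_zero]),
          hsum, hsum2] at h
        have e : ∫ ω, F ω * (-((∑ i ∈ s, ξ i ^ 2) * r ^ 2) * Real.cos (r * ℓ ω) +
            r * ℓ ω * Real.sin (r * ℓ ω)) ∂P =
            -((∑ i ∈ s, ξ i ^ 2) * r ^ 2) * ∫ ω, F ω * Real.cos (r * ℓ ω) ∂P +
            r * ∫ ω, F ω * ℓ ω * Real.sin (r * ℓ ω) ∂P := by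
          rw [← integral_const_mul, ← integral_const_mul, ← integral_add ((bc i0 r).const_mul _)
            ((bs i1 r).const_mul _)]
          exact integral_congr_ae (ae_of_all _ fun ω => by ring)
        rw [e] at h
        linear_combination -h
    simp only [one_mul, zero_mul, Real.cos_zero, mul_one] at h
    rw [h]
    congr 4
    ext ω
    ring
  · have h := eq_of_singular_ode (hasDerivAt_integral_mul_sin hm i0 i1)
      (hasDerivAt_integral_mul_cos hm i1 i2 0) (c := ∑ i ∈ s, ξ i ^ 2) fun r => by
        have h := integral_mul_cylL_of_inSecondChaos hX hi hF
          (IsCylinder.sin_sum 2 s (fun i => r * ξ i))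
        simp_rw [cylL_sin_sum (ξ := fun i => r * ξ i) (s := s) (fun j hj => by rw [hξ j hj, mul_zero]),
          hsum, hsum2] at h
        have e : ∫ ω, F ω * (-((∑ i ∈ s, ξ i ^ 2) * r ^ 2) * Real.sin (r * ℓ ω) -
            r * ℓ ω * Real.cos (r * ℓ ω)) ∂P =
            -((∑ i ∈ s, ξ i ^ 2) * r ^ 2) * ∫ ω, F ω * Real.sin (r * ℓ ω) ∂P -
            r * ∫ ω, F ω * ℓ ω * Real.cos (r * ℓ ω) ∂P := by
          rw [← integral_const_mul, ← integral_const_mul, ← integral_sub ((bs i0 r).const_mul _)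
            ((bc i1 r).const_mul _)]
          exact integral_congr_ae (ae_of_all _ fun ω => by ring)
        rw [e] at h
        linear_combination -h
    simpa using h

lemma integral_family_mul (hX : ∀ i, HasLaw (X i) (gaussianReal 0 1) P) (hi : iIndepFun X P)
    {g : (ι → ℝ) → ℝ} (hg : IsCylinder 1 g) (i : ι) :
    ∫ ω, X i ω * g (fun j => X j ω) ∂P = ∫ ω, partialDeriv i g (fun j => X j ω) ∂P := by
  have := hi.isProbabilityMeasure
  obtain ⟨s, hs⟩ := hg.exists_dependsOn
  refine (integral_deriv_update hX hi i hs (dependsOn_partialDeriv hs i) hg.measurable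
    (hg.partialDeriv i).measurable (hg.hasDerivAt i) ((hg.memLp hX 1).integrable le_rfl)
    (((hg.partialDeriv i).memLp hX 1).integrable le_rfl) ?_).symm
  exact integrable_mul_of_memLp_two (memLp_of_hasLaw (hX i) (by simp)) (hg.memLp hX 2)

lemma integral_family_mul_family_mul (hX : ∀ i, HasLaw (X i) (gaussianReal 0 1) P)
    (hi : iIndepFun X P) {g : (ι → ℝ) → ℝ} (hg : IsCylinder 2 g) (i j : ι) :
    ∫ ω, (X i ω * X j ω - if i = j then 1 else 0) * g (fun j => X j ω) ∂P =
      ∫ ω, partialDeriv j (partialDeriv i g) (fun j => X j ω) ∂P := by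
  have := hi.isProbabilityMeasure
  have hg1 : IsCylinder 1 g := hg.of_le (by norm_num)
  have key := integral_mul_partialDeriv hX hi (i := i) (v := fun x => x j)
    (v' := fun _ => if i = j then 1 else 0) (s := {j}) (fun x y hxy => hxy j (by simp))
    (fun x y hxy => rfl) (by fun_prop) (by fun_prop) (fun x u => by
      split_ifs with h
      · subst h
        simpa using hasDerivAt_id' u
      · simpa [Function.update_of_ne (Ne.symm h)] using hasDerivAt_const u (x j))
    (memLp_of_hasLaw (hX j) (by simp)) (memLp_const _) hg1
  have i1 := integrable_mul_of_memLp_two (memLp_of_hasLaw (hX j) (by simp))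
    (hg1.memLp_mul hX (memLp_of_hasLaw (hX i) (q := 2) (by simp)))
  have i2 := integrable_mul_of_memLp_two (memLp_of_hasLaw (hX j) (by simp))
    ((hg.partialDeriv i).memLp hX 2)
  have i3 : Integrable (fun ω => (if i = j then 1 else 0) * g (fun j => X j ω)) P :=
    ((hg.memLp hX 1).integrable le_rfl).const_mul _
  simp_rw [mul_sub] at key
  rw [integral_sub i1 i2] at key
  rw [← integral_family_mul hX hi (hg.partialDeriv i)]
  simp_rw [sub_mul]
  rw [integral_sub (i1.congr (ae_of_all _ fun ω => by ring)) i3, key, sub_sub_eq_add_sub,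
    sub_eq_iff_eq_add, add_comm]
  congr 1
  exact integral_congr_ae (ae_of_all _ fun ω => by ring)

/-- By the Stein identity, both integrals, as functions of the scale r of ξ, solve φ' = -r c φ with
c = ∑ ξ_i². -/
lemma integral_cos_sum (hX : ∀ i, HasLaw (X i) (gaussianReal 0 1) P) (hi : iIndepFun X P)
    {s : Finset ι} {ξ : ι → ℝ} (hξ : ∀ j, j ∉ s → ξ j = 0) :
    ∫ ω, Real.cos (∑ i ∈ s, ξ i * X i ω) ∂P = Real.exp (-(∑ i ∈ s, ξ i ^ 2) / 2) ∧
    ∫ ω, Real.sin (∑ i ∈ s, ξ i * X i ω) ∂P = 0 := by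
  have := hi.isProbabilityMeasure
  set ℓ : Ω → ℝ := fun ω => ∑ i ∈ s, ξ i * X i ω with hℓ
  set c := ∑ i ∈ s, ξ i ^ 2 with hc
  have hℓ2 : MemLp ℓ 2 P := memLp_sum_family hX s ξ (by simp)
  have hm : AEMeasurable ℓ P := hℓ2.aestronglyMeasurable.aemeasurable
  have i1 : Integrable (fun ω => 1 * ℓ ω) P := (hℓ2.integrable (by norm_num)).const_mul _
  have hsum (r : ℝ) (ω : Ω) : ∑ i ∈ s, (r * ξ i) * X i ω = r * ℓ ω := by
    rw [hℓ, Finset.mul_sum]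
    exact Finset.sum_congr rfl fun i _ => mul_assoc _ _ _
  have hsin (r : ℝ) : ∫ ω, ℓ ω * Real.sin (r * ℓ ω) ∂P = r * c * ∫ ω, Real.cos (r * ℓ ω) ∂P := by
    have e (i : ι) : ∫ ω, X i ω * Real.sin (r * ℓ ω) ∂P =
        r * ξ i * ∫ ω, Real.cos (r * ℓ ω) ∂P := by
      have h := integral_family_mul hX hi (IsCylinder.sin_sum 1 s (fun i => r * ξ i)) i
      rw [partialDeriv_sin_sum (fun j hj => by rw [hξ j hj, mul_zero])] at h
      simp_rw [hsum] at h
      rw [h, ← integral_const_mul]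
      exact integral_congr_ae (ae_of_all _ fun ω => mul_comm _ _)
    simp_rw [hℓ, Finset.sum_mul] at e ⊢
    rw [integral_finsetSum]
    · simp_rw [mul_assoc, integral_const_mul, e, hc, Finset.sum_mul, Finset.mul_sum]
      exact Finset.sum_congr rfl fun i _ => by ring
    · intro i _
      have := (integrable_mul_of_memLp_two (memLp_of_hasLaw (hX i) (by simp))
        ((IsCylinder.sin_sum 1 s (fun i => r * ξ i)).memLp hX 2)).const_mul (ξ i)
      simp_rw [hsum] at this
      exact this.congr (ae_of_all _ fun ω => by simp only [hℓ]; ring)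
  have hcos (r : ℝ) : ∫ ω, ℓ ω * Real.cos (r * ℓ ω) ∂P = -(r * c * ∫ ω, Real.sin (r * ℓ ω) ∂P) := by
    have e (i : ι) : ∫ ω, X i ω * Real.cos (r * ℓ ω) ∂P =
        -(r * ξ i * ∫ ω, Real.sin (r * ℓ ω) ∂P) := by
      have h := integral_family_mul hX hi (IsCylinder.cos_sum 1 s (fun i => r * ξ i)) i
      rw [partialDeriv_cos_sum (fun j hj => by rw [hξ j hj, mul_zero])] at h
      simp_rw [hsum] at h
      rw [h, ← integral_const_mul, ← integral_neg]
      exact integral_congr_ae (ae_of_all _ fun ω => by ring)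
    simp_rw [hℓ, Finset.sum_mul] at e ⊢
    rw [integral_finsetSum]
    · simp_rw [mul_assoc, integral_const_mul, e, hc, Finset.sum_mul, Finset.mul_sum]
      rw [← Finset.sum_neg_distrib]
      exact Finset.sum_congr rfl fun i _ => by ring
    · intro i _
      have := (integrable_mul_of_memLp_two (memLp_of_hasLaw (hX i) (by simp))
        ((IsCylinder.cos_sum 1 s (fun i => r * ξ i)).memLp hX 2)).const_mul (ξ i)
      simp_rw [hsum] at this
      exact this.congr (ae_of_all _ fun ω => by simp only [hℓ]; ring)
  have hconst {φ : ℝ → ℝ} (hφ : ∀ r, HasDerivAt φ (-(r * c * φ r)) r) :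
      φ 1 = φ 0 * Real.exp (-c / 2) := by
    have hd (r : ℝ) : HasDerivAt (fun r => φ r * Real.exp (c * r ^ 2 / 2)) 0 r := by
      have e1 : HasDerivAt (fun r : ℝ => Real.exp (c * r ^ 2 / 2))
          (Real.exp (c * r ^ 2 / 2) * (c * r)) r := by
        refine (((hasDerivAt_pow 2 r).const_mul c).div_const 2).exp.congr_deriv ?_
        simp only [Nat.cast_ofNat, Nat.add_one_sub_one, pow_one]
        ring
      exact ((hφ r).fun_mul e1).congr_deriv (by ring)
    have := is_const_of_deriv_eq_zero (fun r => (hd r).differentiableAt) (fun r => (hd r).deriv) 1 0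
    simp only [one_pow, mul_one, ne_eq, OfNat.ofNat_ne_zero, not_false_eq_true, zero_pow, mul_zero,
      zero_div, Real.exp_zero] at this
    rw [← this, mul_assoc, ← Real.exp_add, neg_div, add_neg_cancel, Real.exp_zero, mul_one]
  have d1 (r : ℝ) := hasDerivAt_integral_mul_cos hm (integrable_const (μ := P) (1 : ℝ)) i1 r
  have d2 (r : ℝ) := hasDerivAt_integral_mul_sin hm (integrable_const (μ := P) (1 : ℝ)) i1 r
  simp only [one_mul, hsin, hcos] at d1 d2
  have c1 := hconst d1
  have c2 := hconst d2
  simp only [one_mul, zero_mul, Real.cos_zero, Real.sin_zero, integral_const, probReal_univ,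
    smul_eq_mul, mul_one, mul_zero] at c1 c2
  exact ⟨c1, c2⟩

/-- The quadratic polynomial `∑_{i,j ∈ t} A i j (x i x j - δ i j)`. -/
noncomputable def hermiteForm (A : ι → ι → ℝ) (t : Finset ι) (x : ι → ℝ) : ℝ :=
  ∑ i ∈ t, ∑ j ∈ t, A i j * (x i * x j - if i = j then 1 else 0)

lemma memLp_hermiteForm [IsFiniteMeasure P] (hX : ∀ i, HasLaw (X i) (gaussianReal 0 1) P)
    (A : ι → ι → ℝ) (t : Finset ι) : MemLp (fun ω => hermiteForm A t (fun j => X j ω)) 2 P :=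
  memLp_finsetSum _ fun i _ => memLp_finsetSum _ fun j _ =>
    ((memLp_mul_family hX i j).sub (memLp_const _)).const_mul _

lemma integral_hermiteForm_mul (hX : ∀ i, HasLaw (X i) (gaussianReal 0 1) P)
    (hi : iIndepFun X P) {g : (ι → ℝ) → ℝ} (hg : IsCylinder 2 g) (A : ι → ι → ℝ) (t : Finset ι) :
    ∫ ω, hermiteForm A t (fun j => X j ω) * g (fun j => X j ω) ∂P =
      ∑ i ∈ t, ∑ j ∈ t, A i j * ∫ ω, partialDeriv j (partialDeriv i g) (fun j => X j ω) ∂P := by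
  have := hi.isProbabilityMeasure
  have hint (i j : ι) : Integrable (fun ω => A i j * ((X i ω * X j ω - if i = j then 1 else 0) *
      g (fun j => X j ω))) P :=
    (integrable_mul_of_memLp_two ((memLp_mul_family hX i j).sub (memLp_const _))
      (hg.memLp hX 2)).const_mul _
  simp_rw [hermiteForm, Finset.sum_mul, mul_assoc (A _ _)]
  rw [integral_finsetSum _ fun i _ => integrable_finsetSum _ fun j _ => hint i j]
  refine Finset.sum_congr rfl fun i _ => ?_
  rw [integral_finsetSum _ fun j _ => hint i j]
  refine Finset.sum_congr rfl fun j _ => ?_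
  rw [integral_const_mul, integral_family_mul_family_mul hX hi hg]

/-- The second-order coefficients of a square integrable functional of a Gaussian family. -/
noncomputable def coeff (X : ι → Ω → ℝ) (P : Measure Ω) (F : Ω → ℝ) (i j : ι) : ℝ :=
  (∫ ω, F ω * (X i ω * X j ω) ∂P) / 2

lemma coeff_comm (F : Ω → ℝ) (i j : ι) : coeff X P F i j = coeff X P F j i := by
  simp only [coeff, mul_comm (X i _)]

/-- Both F and its quadratic form have cosine transform -(∑ A_ij ξ_i ξ_j) exp(-∑ ξ_i²/2) and zero
sine transform: for F by the ODE, for the form by two integrations by parts. -/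
lemma integral_sub_hermiteForm_mul_cos (hX : ∀ i, HasLaw (X i) (gaussianReal 0 1) P)
    (hi : iIndepFun X P) {F : Ω → ℝ} (hF : InSecondChaos X P F) {s : Finset ι} {ξ : ι → ℝ}
    (hξ : ∀ j, j ∉ s → ξ j = 0) :
    ∫ ω, (F ω - hermiteForm (coeff X P F) s (fun j => X j ω)) *
      Real.cos (∑ i ∈ s, ξ i * X i ω) ∂P = 0 ∧
    ∫ ω, (F ω - hermiteForm (coeff X P F) s (fun j => X j ω)) *
      Real.sin (∑ i ∈ s, ξ i * X i ω) ∂P = 0 := by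
  have := hi.isProbabilityMeasure
  have hc := IsCylinder.cos_sum 2 s ξ
  have hs := IsCylinder.sin_sum 2 s ξ
  obtain ⟨f1, f2⟩ := integral_mul_cos_of_inSecondChaos hX hi hF hξ
  obtain ⟨g1, g2⟩ := integral_cos_sum hX hi hξ
  simp_rw [sub_mul]
  rw [integral_sub (integrable_mul_of_memLp_two hF.1 (hc.memLp hX 2))
      (integrable_mul_of_memLp_two (memLp_hermiteForm hX _ s) (hc.memLp hX 2)),
    integral_sub (integrable_mul_of_memLp_two hF.1 (hs.memLp hX 2))
      (integrable_mul_of_memLp_two (memLp_hermiteForm hX _ s) (hs.memLp hX 2)), f1, f2,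
    integral_hermiteForm_mul hX hi hc, integral_hermiteForm_mul hX hi hs]
  have p1 (i j : ι) : partialDeriv j (partialDeriv i (fun x => Real.cos (∑ j ∈ s, ξ j * x j))) =
      fun x => -(Real.cos (∑ j ∈ s, ξ j * x j) * ξ j) * ξ i := by
    rw [partialDeriv_cos_sum hξ]
    exact partialDeriv_eq_of_hasDerivAt_update fun x u =>
      (hasDerivAt_sum_update hξ j x u).sin.fun_neg.mul_const _
  have p2 (i j : ι) : partialDeriv j (partialDeriv i (fun x => Real.sin (∑ j ∈ s, ξ j * x j))) =
      fun x => (-Real.sin (∑ j ∈ s, ξ j * x j) * ξ j) * ξ i := by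
    rw [partialDeriv_sin_sum hξ]
    exact partialDeriv_eq_of_hasDerivAt_update fun x u =>
      (hasDerivAt_sum_update hξ j x u).cos.mul_const _
  simp only [p1, p2, integral_mul_const, integral_neg, g1, g2]
  refine ⟨?_, by simp⟩
  have e : ∫ ω, F ω * (∑ i ∈ s, ξ i * X i ω) ^ 2 ∂P =
      ∑ i ∈ s, ∑ j ∈ s, ξ i * ξ j * (2 * coeff X P F i j) := by
    have hint (i j : ι) : Integrable (fun ω => ξ i * ξ j * (F ω * (X i ω * X j ω))) P :=
      (integrable_mul_of_memLp_two hF.1 (memLp_mul_family hX i j)).const_mul _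
    have : (fun ω => F ω * (∑ i ∈ s, ξ i * X i ω) ^ 2) =
        fun ω => ∑ i ∈ s, ∑ j ∈ s, ξ i * ξ j * (F ω * (X i ω * X j ω)) := by
      ext ω
      rw [sq, Finset.sum_mul_sum, Finset.mul_sum]
      refine Finset.sum_congr rfl fun i _ => ?_
      rw [Finset.mul_sum]
      exact Finset.sum_congr rfl fun j _ => by ring
    rw [this, integral_finsetSum _ fun i _ => integrable_finsetSum _ fun j _ => hint i j]
    refine Finset.sum_congr rfl fun i _ => ?_
    rw [integral_finsetSum _ fun j _ => hint i j]
    refine Finset.sum_congr rfl fun j _ => ?_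
    rw [integral_const_mul, coeff]
    ring
  rw [e, sub_eq_zero, neg_div, Finset.sum_div, neg_mul, Finset.sum_mul, ← Finset.sum_neg_distrib]
  refine Finset.sum_congr rfl fun i _ => ?_
  rw [Finset.sum_div, Finset.sum_mul, ← Finset.sum_neg_distrib]
  exact Finset.sum_congr rfl fun j _ => by ring

end Fourier

end WienerChaos

/-! ### From trigonometric orthogonality to conditional expectation -/

namespace WienerChaos

section Orthogonality

open scoped Classical

variable {ι Ω : Type*} [MeasurableSpace Ω] {P : Measure Ω} {X : ι → Ω → ℝ}

/-- An integrable variable that is orthogonal to all trigonometric functions of a random vector is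
orthogonal to all functions of that vector. -/
lemma integral_mul_eq_zero_of_trig {κ : Type*} [Fintype κ] {Y : Ω → κ → ℝ} (hY : AEMeasurable Y P)
    {U : Ω → ℝ} (hU : Integrable U P)
    (hc : ∀ ξ : κ → ℝ, ∫ ω, U ω * Real.cos (∑ k, ξ k * Y ω k) ∂P = 0)
    (hs : ∀ ξ : κ → ℝ, ∫ ω, U ω * Real.sin (∑ k, ξ k * Y ω k) ∂P = 0)
    {h : (κ → ℝ) → ℝ} (hh : Measurable h) (hUh : Integrable (fun ω => U ω * h (Y ω)) P) :
    ∫ ω, U ω * h (Y ω) ∂P = 0 := by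
  -- The positive and negative parts of U are used as densities of two finite measures, transported
  -- by Y.
  have key {V : Ω → ℝ} (hV : Integrable V P) {E : Type} [NormedAddCommGroup E] [NormedSpace ℝ E]
      {g : (κ → ℝ) → E} (hg : StronglyMeasurable g) :
      ∫ y, g y ∂((P.withDensity fun ω => ENNReal.ofReal (V ω)).map Y) =
        ∫ ω, (max (V ω) 0) • g (Y ω) ∂P := by
    rw [integral_map (hY.mono_ac (withDensity_absolutelyContinuous _ _)) hg.aestronglyMeasurable,
      integral_withDensity_eq_integral_toReal_smul₀ hV.aemeasurable.ennreal_ofReal (by simp)]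
    simp only [ENNReal.toReal_ofReal']
  have hsplit (ω : Ω) : max (U ω) 0 - max (-U ω) 0 = U ω := by
    rcases le_total (U ω) 0 with h | h <;> simp [h]
  have hp : Integrable (fun ω => max (U ω) 0) P := hU.pos_part
  have hn : Integrable (fun ω => max (-U ω) 0) P := hU.neg_part
  have hU' : Integrable (fun ω => -U ω) P := hU.neg
  have : IsFiniteMeasure (P.withDensity fun ω => ENNReal.ofReal (U ω)) :=
    isFiniteMeasure_withDensity_ofReal hU.2
  have : IsFiniteMeasure (P.withDensity fun ω => ENNReal.ofReal (-U ω)) :=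
    isFiniteMeasure_withDensity_ofReal hU.neg.2
  -- The trigonometric hypotheses say that the two transported measures have the same characteristic
  -- function, so they coincide.
  have hμ : (P.withDensity fun ω => ENNReal.ofReal (U ω)).map Y =
      (P.withDensity fun ω => ENNReal.ofReal (-U ω)).map Y := by
    refine Measure.ext_of_charFunDual ?_
    ext L
    have hL (y : κ → ℝ) : L y = ∑ k, L (Pi.single k 1) * y k := by
      conv_lhs => rw [← Finset.univ_sum_single y, map_sum]
      refine Finset.sum_congr rfl fun k _ => ?_
      rw [show (Pi.single k (y k) : κ → ℝ) = y k • Pi.single k 1 by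
        rw [← Pi.single_smul, smul_eq_mul, mul_one], map_smul, smul_eq_mul, mul_comm]
    have hem : Continuous (fun y : κ → ℝ => Complex.exp (L y * Complex.I)) := by fun_prop
    have hb {V : Ω → ℝ} (hV : Integrable V P) :
        Integrable (fun ω => V ω • Complex.exp (L (Y ω) * Complex.I)) P := by
      refine hV.smul_bdd 1 (hem.measurable.comp_aemeasurable hY).aestronglyMeasurable
        (ae_of_all _ fun ω => ?_)
      rw [Complex.norm_exp_ofReal_mul_I]
    rw [charFunDual_apply, charFunDual_apply, key hU hem.stronglyMeasurable,
      key hU' hem.stronglyMeasurable, ← sub_eq_zero, ← integral_sub (hb hp) (hb hn)]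
    simp_rw [← sub_smul, hsplit]
    have hLm : AEMeasurable (fun ω => L (Y ω)) P := L.continuous.measurable.comp_aemeasurable hY
    have i1 : Integrable (fun ω => U ω * Real.cos (L (Y ω))) P :=
      hU.mul_bdd (c := 1) (Real.measurable_cos.comp_aemeasurable hLm).aestronglyMeasurable
        (ae_of_all _ fun ω => Real.abs_cos_le_one _)
    have i2 : Integrable (fun ω => U ω * Real.sin (L (Y ω))) P :=
      hU.mul_bdd (c := 1) (Real.measurable_sin.comp_aemeasurable hLm).aestronglyMeasurable
        (ae_of_all _ fun ω => Real.abs_sin_le_one _)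
    have e (ω : Ω) : U ω • Complex.exp (L (Y ω) * Complex.I) =
        ((U ω * Real.cos (L (Y ω)) : ℝ) : ℂ) + ((U ω * Real.sin (L (Y ω)) : ℝ) : ℂ) * Complex.I := by
      rw [Complex.exp_mul_I, Complex.real_smul]
      push_cast
      ring
    simp_rw [e]
    rw [integral_add i1.ofReal (i2.ofReal.mul_const _), integral_mul_const, integral_complex_ofReal,
      integral_complex_ofReal]
    simp_rw [fun ω => hL (Y ω), hc, hs]
    simp
  have e1 := key hU hh.stronglyMeasurable
  have e2 := key hU' hh.stronglyMeasurable
  simp only [smul_eq_mul] at e1 e2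
  rw [hμ, e2] at e1
  have i1 : Integrable (fun ω => max (U ω) 0 * h (Y ω)) P := by
    refine hUh.mono (hp.aestronglyMeasurable.mul (hh.comp_aemeasurable hY).aestronglyMeasurable)
      (ae_of_all _ fun ω => ?_)
    rw [norm_mul, norm_mul]
    gcongr
    rcases le_total (U ω) 0 with h | h <;> simp [h]
  have i2 : Integrable (fun ω => max (-U ω) 0 * h (Y ω)) P := by
    refine hUh.mono (hn.aestronglyMeasurable.mul (hh.comp_aemeasurable hY).aestronglyMeasurable)
      (ae_of_all _ fun ω => ?_)
    rw [norm_mul, norm_mul]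
    gcongr
    rcases le_total (U ω) 0 with h | h <;> simp [h]
  calc ∫ ω, U ω * h (Y ω) ∂P
      = ∫ ω, (max (U ω) 0 * h (Y ω) - max (-U ω) 0 * h (Y ω)) ∂P :=
        integral_congr_ae (ae_of_all _ fun ω => by simp only [← sub_mul, hsplit])
    _ = 0 := by rw [integral_sub i1 i2, e1, sub_self]

/-- `U` is orthogonal to the trigonometric functions of the coordinates in `s`. -/
def TrigOrthogonal (X : ι → Ω → ℝ) (P : Measure Ω) (s : Finset ι) (U : Ω → ℝ) : Prop :=
  ∀ ξ : ι → ℝ, (∀ j, j ∉ s → ξ j = 0) →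
    ∫ ω, U ω * Real.cos (∑ i ∈ s, ξ i * X i ω) ∂P = 0 ∧
    ∫ ω, U ω * Real.sin (∑ i ∈ s, ξ i * X i ω) ∂P = 0

/-- For integrable U, trigonometric orthogonality amounts to E[U | X_s] = 0. A function of the
coordinates in s is viewed on the finite-dimensional space by padding with zeros. -/
lemma TrigOrthogonal.integral_mul_eq_zero (hX : ∀ i, HasLaw (X i) (gaussianReal 0 1) P)
    {s : Finset ι} {U : Ω → ℝ} (hUs : TrigOrthogonal X P s U) (hU : Integrable U P)
    {h : (ι → ℝ) → ℝ} (hs : DependsOn h (s : Set ι)) (hh : Measurable h)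
    (hUh : Integrable (fun ω => U ω * h (fun j => X j ω)) P) :
    ∫ ω, U ω * h (fun j => X j ω) ∂P = 0 := by
  let e : (s → ℝ) → (ι → ℝ) := fun q j => if h : j ∈ s then q ⟨j, h⟩ else 0
  have he : Measurable e := by
    rw [measurable_pi_iff]
    intro j
    by_cases h : j ∈ s
    · simp only [e, dif_pos h]; fun_prop
    · simp only [e, dif_neg h]; fun_prop
  have hhe (ω : Ω) : h (fun j => X j ω) = h (e (fun j : s => X j ω)) := by
    refine hs fun j hj => ?_
    have : j ∈ s := hj
    simp [e, this]
  have hsum (ξ : s → ℝ) (ω : Ω) : ∑ k, ξ k * X k ω = ∑ i ∈ s, e ξ i * X i ω := by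
    rw [← Finset.sum_coe_sort s]
    exact Finset.sum_congr rfl fun i _ => by simp [e]
  have hξ (ξ : s → ℝ) := hUs (e ξ) fun j hj => by simp [e, hj]
  simp_rw [hhe] at hUh ⊢
  refine integral_mul_eq_zero_of_trig (Y := fun ω (j : s) => X j ω)
    (aemeasurable_pi_lambda _ fun j => (hX j).aemeasurable) hU (fun ξ => ?_) (fun ξ => ?_)
    (hh.comp he) hUh
  · simp_rw [hsum]
    exact (hξ ξ).1
  · simp_rw [hsum]
    exact (hξ ξ).2

/-- `E[(U + h)²] ≥ E[U²]` when `U` is orthogonal to `h`, in terms of the `L²` seminorm. -/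
lemma TrigOrthogonal.eLpNorm_le (hX : ∀ i, HasLaw (X i) (gaussianReal 0 1) P) [IsFiniteMeasure P]
    {s : Finset ι} {U : Ω → ℝ} (hUs : TrigOrthogonal X P s U) (hU : MemLp U 2 P)
    {h : (ι → ℝ) → ℝ} (hs : DependsOn h (s : Set ι)) (hh : Measurable h)
    (hh2 : MemLp (fun ω => h (fun j => X j ω)) 2 P) :
    eLpNorm U 2 P ≤ eLpNorm (fun ω => U ω + h (fun j => X j ω)) 2 P := by
  have i1 := integrable_mul_of_memLp_two hU hh2
  have h0 := hUs.integral_mul_eq_zero hX (hU.integrable (by norm_num)) hs hh i1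
  have hUh : MemLp (fun ω => U ω + h (fun j => X j ω)) 2 P := hU.add hh2
  rw [hU.eLpNorm_eq_integral_rpow_norm (by simp) (by simp),
    hUh.eLpNorm_eq_integral_rpow_norm (by simp) (by simp)]
  refine ENNReal.ofReal_le_ofReal (Real.rpow_le_rpow (by positivity) ?_ (by simp))
  simp only [ENNReal.toReal_ofNat, Real.rpow_ofNat, Real.norm_eq_abs, sq_abs]
  calc ∫ ω, U ω ^ 2 ∂P ≤ ∫ ω, U ω ^ 2 ∂P + ∫ ω, h (fun j => X j ω) ^ 2 ∂P :=
        le_add_of_nonneg_right (by positivity)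
    _ = ∫ ω, (U ω ^ 2 + h (fun j => X j ω) ^ 2 + 2 * (U ω * h (fun j => X j ω))) ∂P := by
        rw [integral_add (hU.integrable_sq.fun_add hh2.integrable_sq) (i1.const_mul 2),
          integral_const_mul, h0, mul_zero, add_zero,
          integral_add hU.integrable_sq hh2.integrable_sq]
    _ = _ := integral_congr_ae (ae_of_all _ fun ω => by ring)

end Orthogonality

end WienerChaos

/-! ### Convergence in L¹ and L², negative moments -/

namespace WienerChaos

section LpTools

variable {Ω : Type*} [MeasurableSpace Ω] {P : Measure Ω}

lemma eLpNorm_two_eq {W : Ω → ℝ} (hW : MemLp W 2 P) :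
    eLpNorm W 2 P = ENNReal.ofReal (Real.sqrt (∫ ω, W ω ^ 2 ∂P)) := by
  rw [hW.eLpNorm_eq_integral_rpow_norm (by simp) (by simp), Real.sqrt_eq_rpow]
  simp

lemma tendsto_eLpNorm_two_iff {α : Type*} {l : Filter α} {W : α → Ω → ℝ}
    (hW : ∀ a, MemLp (W a) 2 P) :
    Tendsto (fun a => eLpNorm (W a) 2 P) l (𝓝 0) ↔
      Tendsto (fun a => ∫ ω, W a ω ^ 2 ∂P) l (𝓝 0) := by
  simp_rw [eLpNorm_two_eq (hW _)]
  constructor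
  · intro h
    have h1 := ((ENNReal.tendsto_toReal ENNReal.zero_ne_top).comp h).pow 2
    simp only [Function.comp_def, ENNReal.toReal_zero, ne_eq, OfNat.ofNat_ne_zero,
      not_false_eq_true, zero_pow, ENNReal.toReal_ofReal (Real.sqrt_nonneg _)] at h1
    refine h1.congr fun a => Real.sq_sqrt (integral_nonneg fun ω => sq_nonneg _)
  · intro h
    have := (ENNReal.continuous_ofReal.comp Real.continuous_sqrt).tendsto 0
    simpa [Function.comp_def] using this.comp h

lemma eLpNorm_one_eq {W : Ω → ℝ} (hW : Integrable W P) :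
    eLpNorm W 1 P = ENNReal.ofReal (∫ ω, |W ω| ∂P) := by
  rw [eLpNorm_one_eq_lintegral_enorm, ← ofReal_integral_norm_eq_lintegral_enorm hW]
  rfl

lemma tendsto_eLpNorm_one_of_tendsto_integral_abs {α : Type*} {l : Filter α} {W : α → Ω → ℝ}
    (hW : ∀ a, Integrable (W a) P) (h : Tendsto (fun a => ∫ ω, |W a ω| ∂P) l (𝓝 0)) :
    Tendsto (fun a => eLpNorm (W a) 1 P) l (𝓝 0) := by
  simp_rw [eLpNorm_one_eq (hW _)]
  simpa using ENNReal.tendsto_ofReal h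

lemma exists_tendsto_eLpNorm_of_cauchy {q : ENNReal} [Fact (1 ≤ q)] {V : ℕ → Ω → ℝ}
    (hV : ∀ n, MemLp (V n) q P)
    (hc : Tendsto (fun m : ℕ × ℕ => eLpNorm (V m.1 - V m.2) q P) atTop (𝓝 0)) :
    ∃ D, MemLp D q P ∧ Tendsto (fun n => eLpNorm (fun ω => V n ω - D ω) q P) atTop (𝓝 0) := by
  have hcs : CauchySeq fun n => (hV n).toLp (V n) := by
    rw [cauchySeq_iff_tendsto_dist_atTop_0]
    have := (ENNReal.tendsto_toReal ENNReal.zero_ne_top).comp hc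
    rw [ENNReal.toReal_zero] at this
    refine this.congr fun m => ?_
    rw [Function.comp_apply, dist_edist, Lp.edist_toLp_toLp]
  obtain ⟨D, hD⟩ := cauchySeq_tendsto_of_complete hcs
  refine ⟨D, Lp.memLp D, ?_⟩
  rw [Lp.tendsto_Lp_iff_tendsto_eLpNorm'] at hD
  refine hD.congr fun n => eLpNorm_congr_ae ?_
  filter_upwards [(hV n).coeFn_toLp] with ω h
  rw [Pi.sub_apply, h]

lemma tendsto_eLpNorm_sq_sub_sq {V : ℕ → Ω → ℝ} {D : Ω → ℝ} (hV : ∀ n, MemLp (V n) 2 P)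
    (hD : MemLp D 2 P) (h : Tendsto (fun n => eLpNorm (fun ω => V n ω - D ω) 2 P) atTop (𝓝 0)) :
    Tendsto (fun n => eLpNorm (fun ω => V n ω ^ 2 - D ω ^ 2) 1 P) atTop (𝓝 0) := by
  have hb (n : ℕ) : eLpNorm (fun ω => V n ω ^ 2 - D ω ^ 2) 1 P ≤
      eLpNorm (fun ω => V n ω - D ω) 2 P *
        (eLpNorm (fun ω => V n ω - D ω) 2 P + eLpNorm (fun ω => 2 * D ω) 2 P) := by
    -- The factor V + D is written (V - D) + 2D, so that Hölder involves only the distance and the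
    -- fixed limit D.
    have e1 : (fun ω => V n ω ^ 2 - D ω ^ 2) =
        (fun ω => V n ω - D ω) • ((fun ω => V n ω - D ω) + fun ω => 2 * D ω) := by
      ext ω
      simp only [Pi.smul_apply', Pi.add_apply, smul_eq_mul]
      ring
    have m1 : AEStronglyMeasurable (fun ω => V n ω - D ω) P := ((hV n).sub hD).aestronglyMeasurable
    have m2 : AEStronglyMeasurable (fun ω => 2 * D ω) P := (hD.const_mul 2).aestronglyMeasurable
    rw [e1]
    refine (eLpNorm_smul_le_mul_eLpNorm (p := 2) (q := 2) (m1.add m2) m1).trans ?_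
    gcongr
    exact eLpNorm_add_le m1 m2 (by norm_num)
  refine tendsto_of_tendsto_of_tendsto_of_le_of_le tendsto_const_nhds ?_ (fun _ => zero_le) hb
  have htop : eLpNorm (fun ω => 2 * D ω) 2 P ≠ ⊤ := (hD.const_mul 2).eLpNorm_ne_top
  have := ENNReal.Tendsto.mul h (Or.inr (by simpa using htop))
    (h.add_const (eLpNorm (fun ω => 2 * D ω) 2 P)) (Or.inr ENNReal.zero_ne_top)
  simpa using this

lemma tendsto_eLpNorm_one_sum {α : Type*} {W : α → ℕ → Ω → ℝ} {D : α → Ω → ℝ} (s : Finset α)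
    (hm : ∀ a ∈ s, ∀ n, AEStronglyMeasurable (fun ω => W a n ω - D a ω) P)
    (h : ∀ a ∈ s, Tendsto (fun n => eLpNorm (fun ω => W a n ω - D a ω) 1 P) atTop (𝓝 0)) :
    Tendsto (fun n => eLpNorm (fun ω => ∑ a ∈ s, W a n ω - ∑ a ∈ s, D a ω) 1 P) atTop (𝓝 0) := by
  have hb (n : ℕ) : eLpNorm (fun ω => ∑ a ∈ s, W a n ω - ∑ a ∈ s, D a ω) 1 P ≤
      ∑ a ∈ s, eLpNorm (fun ω => W a n ω - D a ω) 1 P := by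
    have : (fun ω => ∑ a ∈ s, W a n ω - ∑ a ∈ s, D a ω) =
        ∑ a ∈ s, fun ω => W a n ω - D a ω := by
      ext ω
      rw [Finset.sum_apply, Finset.sum_sub_distrib]
    rw [this]
    exact eLpNorm_sum_le (fun a ha => hm a ha n) le_rfl
  refine tendsto_of_tendsto_of_tendsto_of_le_of_le tendsto_const_nhds ?_ (fun _ => zero_le) hb
  simpa using tendsto_finsetSum s h

/-- Power tail bounds give negative moments. -/
lemma memLp_one_div_of_measureReal_lt_le [IsProbabilityMeasure P] {S : Ω → ℝ}
    (hS : AEStronglyMeasurable S P) (hpos : ∀ᵐ ω ∂P, 0 < S ω) {C a q : ℝ}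
    (htail : ∀ ε, 0 < ε → P.real {ω | S ω < ε} ≤ C * ε ^ a) (hq : 0 < q) (hqa : q < a) :
    MemLp (fun ω => 1 / S ω) (ENNReal.ofReal q) P := by
  have hm : AEMeasurable (fun ω => 1 / S ω) P := hS.aemeasurable.const_div 1
  refine ⟨hm.aestronglyMeasurable, ?_⟩
  rw [eLpNorm_lt_top_iff_lintegral_rpow_enorm_lt_top (by simpa using hq) (by simp),
    ENNReal.toReal_ofReal hq.le]
  have e : ∫⁻ ω, ‖1 / S ω‖ₑ ^ q ∂P = ∫⁻ ω, ENNReal.ofReal ((1 / S ω) ^ q) ∂P := by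
    refine lintegral_congr_ae ?_
    filter_upwards [hpos] with ω hω
    rw [Real.enorm_eq_ofReal (by positivity), ENNReal.ofReal_rpow_of_nonneg (by positivity) hq.le]
  rw [e, lintegral_rpow_eq_lintegral_meas_lt_mul P
    (by filter_upwards [hpos] with ω hω; positivity) hm hq]
  refine ENNReal.mul_lt_top ENNReal.ofReal_lt_top ?_
  -- In the layer cake integral, near 0 the probability is bounded by 1 and t^(q-1) is integrable as
  -- q > 0; beyond 1 the tail bound leaves t^(-a+q-1), integrable as q < a.
  rw [← Set.Ioc_union_Ioi_eq_Ioi zero_le_one]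
  refine (lintegral_union_le _ _ _).trans_lt (ENNReal.add_lt_top.2 ⟨?_, ?_⟩)
  · have hI : IntegrableOn (fun t : ℝ => t ^ (q - 1)) (Set.Ioc 0 1) :=
      (intervalIntegral.intervalIntegrable_rpow' (by linarith)).1
    refine lt_of_le_of_lt ?_ hI.lintegral_lt_top
    refine lintegral_mono fun t => ?_
    exact mul_le_of_le_one_left zero_le prob_le_one
  · have hI : IntegrableOn (fun t : ℝ => C * t ^ (-a + q - 1)) (Set.Ioi 1) :=
      (integrableOn_Ioi_rpow_of_lt (by linarith) one_pos).const_mul C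
    refine lt_of_le_of_lt ?_ hI.lintegral_lt_top
    refine setLIntegral_mono' measurableSet_Ioi fun t ht => ?_
    have ht0 : (0 : ℝ) < t := lt_trans one_pos ht
    have hle : P {ω | t < 1 / S ω} ≤ ENNReal.ofReal (C * (1 / t) ^ a) := by
      refine le_trans (measure_mono_ae ?_) (show P {ω | S ω < 1 / t} ≤ _ from ?_)
      · filter_upwards [hpos] with ω hω h
        exact (lt_one_div ht0 hω).1 h
      · rw [← ofReal_measureReal]
        exact ENNReal.ofReal_le_ofReal (htail _ (by positivity))
    calc P {ω | t < 1 / S ω} * ENNReal.ofReal (t ^ (q - 1))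
        ≤ ENNReal.ofReal (C * (1 / t) ^ a) * ENNReal.ofReal (t ^ (q - 1)) := by gcongr
      _ = ENNReal.ofReal (C * t ^ (-a + q - 1)) := by
          rw [← ENNReal.ofReal_mul' (by positivity), one_div, Real.inv_rpow ht0.le,
            ← Real.rpow_neg ht0.le, mul_assoc, ← Real.rpow_add ht0]
          congr 3
          ring

end LpTools

end WienerChaos

/-! ### Projections on finite blocks and fourth moments -/

namespace WienerChaos

section Moments

open scoped Classical

variable {ι Ω : Type*} [MeasurableSpace Ω] {P : Measure Ω} {X : ι → Ω → ℝ}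

lemma measurable_hermiteForm (A : ι → ι → ℝ) (t : Finset ι) : Measurable (hermiteForm A t) := by
  unfold hermiteForm
  fun_prop

lemma dependsOn_hermiteForm (A : ι → ι → ℝ) (t : Finset ι) :
    DependsOn (hermiteForm A t) (t : Set ι) := by
  intro x y hxy
  unfold hermiteForm
  exact Finset.sum_congr rfl fun i hi => Finset.sum_congr rfl fun j hj => by
    rw [hxy i hi, hxy j hj]

lemma moments_hermiteForm (hX : ∀ i, HasLaw (X i) (gaussianReal 0 1) P) (hi : iIndepFun X P)
    {A : ι → ι → ℝ} (hA : ∀ i j, A i j = A j i) (t : Finset ι) :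
    MemLp (fun ω => hermiteForm A t (fun j => X j ω)) 4 P ∧
    ∫ ω, hermiteForm A t (fun j => X j ω) ^ 2 ∂P = 2 * ∑ i ∈ t, ∑ j ∈ t, A i j ^ 2 ∧
    ∫ ω, hermiteForm A t (fun j => X j ω) ^ 4 ∂P =
      48 * ∑ i ∈ t, ∑ j ∈ t, (∑ k ∈ t, A i k * A j k) ^ 2 +
        12 * (∑ i ∈ t, ∑ j ∈ t, A i j ^ 2) ^ 2 := by
  have h := moments_quadratic (X := fun i : t => X i) (fun i => hX i)
    (hi.precomp Subtype.val_injective) (A := fun i j : t => A i j) fun i j => hA i j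
  have e (ω : Ω) : ∑ i : t, ∑ j : t, A i j * (X i ω * X j ω - if i = j then 1 else 0) =
      hermiteForm A t (fun j => X j ω) := by
    rw [hermiteForm, ← Finset.sum_coe_sort t]
    refine Finset.sum_congr rfl fun i _ => ?_
    rw [← Finset.sum_coe_sort t]
    refine Finset.sum_congr rfl fun j _ => ?_
    simp only [Subtype.ext_iff]
  simp only [e] at h
  simp_rw [← Finset.sum_coe_sort t]
  exact h

lemma sum_sq_contraction_le (A : ι → ι → ℝ) (t : Finset ι) :
    ∑ i ∈ t, ∑ j ∈ t, (∑ k ∈ t, A i k * A j k) ^ 2 ≤ (∑ i ∈ t, ∑ j ∈ t, A i j ^ 2) ^ 2 := by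
  rw [sq (∑ i ∈ t, ∑ j ∈ t, A i j ^ 2), Finset.sum_mul_sum]
  exact Finset.sum_le_sum fun i _ => Finset.sum_le_sum fun j _ =>
    Finset.sum_mul_sq_le_sq_mul_sq _ _ _

variable {F : Ω → ℝ}

lemma trigOrthogonal_sub_hermiteForm (hX : ∀ i, HasLaw (X i) (gaussianReal 0 1) P)
    (hi : iIndepFun X P) (hF : InSecondChaos X P F) (t : Finset ι) :
    TrigOrthogonal X P t (fun ω => F ω - hermiteForm (coeff X P F) t (fun j => X j ω)) :=
  fun _ hξ => integral_sub_hermiteForm_mul_cos hX hi hF hξ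

lemma memLp_sub_hermiteForm (hX : ∀ i, HasLaw (X i) (gaussianReal 0 1) P)
    (hi : iIndepFun X P) (hF : InSecondChaos X P F) (t : Finset ι) :
    MemLp (fun ω => F ω - hermiteForm (coeff X P F) t (fun j => X j ω)) 2 P :=
  have := hi.isProbabilityMeasure
  hF.1.sub (memLp_hermiteForm hX _ t)

/-- Replacing `F` by its projection on the variables in `t`. -/
lemma integral_mul_eq_integral_hermiteForm_mul (hX : ∀ i, HasLaw (X i) (gaussianReal 0 1) P)
    (hi : iIndepFun X P) (hF : InSecondChaos X P F) {t : Finset ι}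
    {h : (ι → ℝ) → ℝ} (hs : DependsOn h (t : Set ι)) (hh : Measurable h)
    (h1 : Integrable (fun ω => F ω * h (fun j => X j ω)) P)
    (h2 : Integrable (fun ω => hermiteForm (coeff X P F) t (fun j => X j ω) *
      h (fun j => X j ω)) P) :
    ∫ ω, F ω * h (fun j => X j ω) ∂P =
      ∫ ω, hermiteForm (coeff X P F) t (fun j => X j ω) * h (fun j => X j ω) ∂P := by
  have := hi.isProbabilityMeasure
  have := (trigOrthogonal_sub_hermiteForm hX hi hF t).integral_mul_eq_zero hX
    ((memLp_sub_hermiteForm hX hi hF t).integrable (by norm_num)) hs hh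
    ((h1.sub h2).congr (ae_of_all _ fun ω => by simp only [Pi.sub_apply, sub_mul]))
  simp_rw [sub_mul] at this
  rwa [integral_sub h1 h2, sub_eq_zero] at this

/-- Pythagoras: the residual is orthogonal to the quadratic form, which is a function of the
coordinates in t. -/
lemma integral_sub_hermiteForm_sq (hX : ∀ i, HasLaw (X i) (gaussianReal 0 1) P)
    (hi : iIndepFun X P) (hF : InSecondChaos X P F) (t : Finset ι) :
    ∫ ω, (F ω - hermiteForm (coeff X P F) t (fun j => X j ω)) ^ 2 ∂P =
      ∫ ω, F ω ^ 2 ∂P - 2 * ∑ i ∈ t, ∑ j ∈ t, coeff X P F i j ^ 2 := by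
  have := hi.isProbabilityMeasure
  have hH := memLp_hermiteForm hX (coeff X P F) t
  obtain ⟨-, m2, -⟩ := moments_hermiteForm hX hi (coeff_comm F) t
  have i1 := integrable_mul_of_memLp_two hF.1 hH
  have h := integral_mul_eq_integral_hermiteForm_mul hX hi hF (dependsOn_hermiteForm _ t)
    (measurable_hermiteForm _ t) i1 (integrable_mul_of_memLp_two hH hH)
  simp_rw [← sq] at h
  have hF2 : Integrable (fun ω => F ω ^ 2) P := hF.1.integrable_sq
  calc _ = ∫ ω, (F ω ^ 2 + hermiteForm (coeff X P F) t (fun j => X j ω) ^ 2 -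
        2 * (F ω * hermiteForm (coeff X P F) t (fun j => X j ω))) ∂P :=
        integral_congr_ae (ae_of_all _ fun ω => by ring)
    _ = _ := by
        rw [integral_sub (hF2.fun_add hH.integrable_sq) (i1.const_mul 2), integral_const_mul,
          integral_add hF2 hH.integrable_sq, h, m2]
        ring

lemma two_mul_sum_coeff_sq_le (hX : ∀ i, HasLaw (X i) (gaussianReal 0 1) P)
    (hi : iIndepFun X P) (hF : InSecondChaos X P F) (t : Finset ι) :
    2 * ∑ i ∈ t, ∑ j ∈ t, coeff X P F i j ^ 2 ≤ ∫ ω, F ω ^ 2 ∂P := by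
  rw [← sub_nonneg, ← integral_sub_hermiteForm_sq hX hi hF]
  positivity

/-- The quadratic form on t is the best L² approximation of F by functions of X_t. On the
coordinates of the n-th cylinder approximation it is therefore at least as close to F. -/
lemma exists_tendsto_hermiteForm (hX : ∀ i, HasLaw (X i) (gaussianReal 0 1) P)
    (hi : iIndepFun X P) (hF : InSecondChaos X P F) :
    ∃ t : ℕ → Finset ι, Tendsto (fun n => eLpNorm (fun ω =>
      F ω - hermiteForm (coeff X P F) (t n) (fun j => X j ω)) 2 P) atTop (𝓝 0) := by
  have := hi.isProbabilityMeasure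
  obtain ⟨-, -, f, hf, hf1, -⟩ := id hF
  choose t ht using fun n => (hf n).exists_dependsOn
  refine ⟨t, tendsto_of_tendsto_of_tendsto_of_le_of_le tendsto_const_nhds hf1
    (fun _ => zero_le) fun n => ?_⟩
  have hd : DependsOn (fun x => hermiteForm (coeff X P F) (t n) x - f n x) (t n : Set ι) :=
    fun x y hxy => by simp only [dependsOn_hermiteForm _ (t n) hxy, ht n hxy]
  have hle := (trigOrthogonal_sub_hermiteForm hX hi hF (t n)).eLpNorm_le hX
    (memLp_sub_hermiteForm hX hi hF (t n)) hd
    ((measurable_hermiteForm _ (t n)).sub (hf n).measurable)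
    ((memLp_hermiteForm hX _ (t n)).sub ((hf n).memLp hX 2))
  refine hle.trans (le_of_eq ?_)
  rw [← eLpNorm_neg]
  congr 1
  ext ω
  simp only [Pi.neg_apply]
  ring

lemma exists_lt_two_mul_sum_coeff_sq (hX : ∀ i, HasLaw (X i) (gaussianReal 0 1) P)
    (hi : iIndepFun X P) (hF : InSecondChaos X P F) {a : ℝ} (ha : a < ∫ ω, F ω ^ 2 ∂P) :
    ∃ t : Finset ι, a < 2 * ∑ i ∈ t, ∑ j ∈ t, coeff X P F i j ^ 2 := by
  obtain ⟨t, ht⟩ := exists_tendsto_hermiteForm hX hi hF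
  rw [tendsto_eLpNorm_two_iff fun n => memLp_sub_hermiteForm hX hi hF (t n)] at ht
  simp_rw [integral_sub_hermiteForm_sq hX hi hF] at ht
  obtain ⟨n, hn⟩ := (ht.eventually_lt_const (sub_pos.2 ha)).exists
  exact ⟨t n, by linarith⟩

/-- With v = ∑ A_ij² on a block, the fourth moment is at most 48 v² + 12 v² = 60 v², and 2v ≤ E F²,
so it is at most 15 (E F²)². This uniform bound survives the limit in measure. -/
lemma memLp_four_of_inSecondChaos (hX : ∀ i, HasLaw (X i) (gaussianReal 0 1) P)
    (hi : iIndepFun X P) (hF : InSecondChaos X P F) : MemLp F 4 P := by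
  have := hi.isProbabilityMeasure
  obtain ⟨t, ht⟩ := exists_tendsto_hermiteForm hX hi hF
  have hm (n : ℕ) := moments_hermiteForm hX hi (coeff_comm (X := X) (P := P) F) (t n)
  have hT : TendstoInMeasure P (fun n ω => hermiteForm (coeff X P F) (t n) (fun j => X j ω))
      atTop F := by
    refine tendstoInMeasure_of_tendsto_eLpNorm (p := 2) (by simp)
      (fun n => (hm n).1.aestronglyMeasurable) hF.1.aestronglyMeasurable ?_
    refine ht.congr fun n => ?_
    rw [← eLpNorm_neg]
    congr 1
    ext ω
    simp
  refine ⟨hF.1.aestronglyMeasurable, lt_of_le_of_lt (eLpNorm_le_of_tendstoInMeasure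
    (C := ENNReal.ofReal ((15 * (∫ ω, F ω ^ 2 ∂P) ^ 2) ^ (4⁻¹ : ℝ)))
    (Eventually.of_forall fun n => ?_) hT fun n => (hm n).1.aestronglyMeasurable)
    ENNReal.ofReal_lt_top⟩
  rw [(hm n).1.eLpNorm_eq_integral_rpow_norm (by simp) (by simp)]
  simp only [ENNReal.toReal_ofNat, Real.rpow_ofNat, Real.norm_eq_abs]
  have he (x : ℝ) : |x| ^ 4 = x ^ 4 := by rw [← abs_pow, abs_of_nonneg (by positivity)]
  simp_rw [he, (hm n).2.2]
  refine ENNReal.ofReal_le_ofReal (Real.rpow_le_rpow (by positivity) ?_ (by norm_num))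
  have h1 := two_mul_sum_coeff_sq_le hX hi hF (t n)
  have h2 := sum_sq_contraction_le (coeff X P F) (t n)
  set v := ∑ i ∈ t n, ∑ j ∈ t n, coeff X P F i j ^ 2
  have hv : 0 ≤ v := by positivity
  nlinarith [mul_self_le_mul_self (mul_nonneg zero_le_two hv) h1]

/-- Jensen for the projection H of F: E H⁴ = E[F H³] ≤ E F⁴/4 + 3 E H⁴/4 by Young, so E H⁴ ≤ E F⁴.
The explicit value of E H⁴ does the rest. -/
lemma sum_sq_contraction_le_fourth_moment (hX : ∀ i, HasLaw (X i) (gaussianReal 0 1) P)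
    (hi : iIndepFun X P) (hF : InSecondChaos X P F) (t : Finset ι) :
    48 * ∑ i ∈ t, ∑ j ∈ t, (∑ k ∈ t, coeff X P F i k * coeff X P F j k) ^ 2 ≤
      ∫ ω, F ω ^ 4 ∂P - 12 * (∑ i ∈ t, ∑ j ∈ t, coeff X P F i j ^ 2) ^ 2 := by
  have := hi.isProbabilityMeasure
  obtain ⟨m1, m2, m3⟩ := moments_hermiteForm hX hi (coeff_comm (X := X) (P := P) F) t
  have hF4 := memLp_four_of_inSecondChaos hX hi hF
  set H : Ω → ℝ := fun ω => hermiteForm (coeff X P F) t (fun j => X j ω) with hH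
  have he (x : ℝ) : |x| ^ 4 = x ^ 4 := by rw [← abs_pow, abs_of_nonneg (by positivity)]
  have i4 {V : Ω → ℝ} (hV : MemLp V 4 P) : Integrable (fun ω => V ω ^ 4) P := by
    have := hV.integrable_norm_pow (p := 4) (by norm_num)
    simpa only [Real.norm_eq_abs, he] using this
  have young (a b : ℝ) : |a * b ^ 3| ≤ a ^ 4 / 4 + 3 * b ^ 4 / 4 := by
    rw [abs_le]
    constructor <;>
      nlinarith [sq_nonneg (a ^ 2 - b ^ 2), mul_nonneg (sq_nonneg b) (sq_nonneg (a - b)),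
        mul_nonneg (sq_nonneg b) (sq_nonneg (a + b))]
  have ib : Integrable (fun ω => F ω ^ 4 / 4 + 3 * H ω ^ 4 / 4) P :=
    ((i4 hF4).div_const 4).fun_add (((i4 m1).const_mul 3).div_const 4)
  have i1 : Integrable (fun ω => F ω * H ω ^ 3) P :=
    ib.mono' (hF4.aestronglyMeasurable.mul (m1.aestronglyMeasurable.pow 3))
      (ae_of_all _ fun ω => young _ _)
  have h := integral_mul_eq_integral_hermiteForm_mul hX hi hF (t := t)
    (h := fun x => hermiteForm (coeff X P F) t x ^ 3)
    (fun x y hxy => by simp only [dependsOn_hermiteForm _ t hxy])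
    ((measurable_hermiteForm _ t).pow_const 3) i1
    ((i4 m1).congr (ae_of_all _ fun ω => by simp only [hH]; ring))
  have h2 : ∫ ω, H ω ^ 4 ∂P = ∫ ω, F ω * H ω ^ 3 ∂P := by
    rw [h]
    exact integral_congr_ae (ae_of_all _ fun ω => by simp only [hH]; ring)
  have h3 : ∫ ω, F ω * H ω ^ 3 ∂P ≤ ∫ ω, (F ω ^ 4 / 4 + 3 * H ω ^ 4 / 4) ∂P :=
    integral_mono i1 ib fun ω => (le_abs_self _).trans (young _ _)
  rw [integral_add ((i4 hF4).div_const 4) (((i4 m1).const_mul 3).div_const 4), integral_div,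
    integral_div, integral_const_mul] at h3
  linarith

end Moments

end WienerChaos

/-! ### The square field operator and the gradient -/

namespace WienerChaos

section Gradient

open scoped Classical

variable {ι Ω : Type*} [MeasurableSpace Ω] {P : Measure Ω} {X : ι → Ω → ℝ} {F : Ω → ℝ}

lemma tendsto_eLpNorm_sub_prod {q : ENNReal} (hq : 1 ≤ q) {V : ℕ → Ω → ℝ} {D : Ω → ℝ}
    (hV : ∀ n, AEStronglyMeasurable (V n) P) (hD : AEStronglyMeasurable D P)
    (h : Tendsto (fun n => eLpNorm (fun ω => V n ω - D ω) q P) atTop (𝓝 0)) :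
    Tendsto (fun m : ℕ × ℕ => eLpNorm (V m.1 - V m.2) q P) atTop (𝓝 0) := by
  have hb (m : ℕ × ℕ) : eLpNorm (V m.1 - V m.2) q P ≤
      eLpNorm (fun ω => V m.1 ω - D ω) q P + eLpNorm (fun ω => V m.2 ω - D ω) q P := by
    have : V m.1 - V m.2 = (fun ω => V m.1 ω - D ω) - fun ω => V m.2 ω - D ω := by
      ext ω
      simp
    rw [this]
    exact eLpNorm_sub_le ((hV _).sub hD) ((hV _).sub hD) hq
  refine tendsto_of_tendsto_of_tendsto_of_le_of_le tendsto_const_nhds ?_ (fun _ => zero_le) hb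
  rw [← prod_atTop_atTop_eq]
  simpa using (h.comp tendsto_fst).add (h.comp tendsto_snd)

lemma tendsto_eLpNorm_two_sub_iff {V : ℕ → Ω → ℝ} (hV : ∀ n, MemLp (V n) 2 P) :
    Tendsto (fun m : ℕ × ℕ => eLpNorm (V m.1 - V m.2) 2 P) atTop (𝓝 0) ↔
      Tendsto (fun m : ℕ × ℕ => ∫ ω, (V m.1 ω - V m.2 ω) ^ 2 ∂P) atTop (𝓝 0) :=
  tendsto_eLpNorm_two_iff (W := fun m : ℕ × ℕ => V m.1 - V m.2) fun m => (hV m.1).sub (hV m.2)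

lemma tendsto_eLpNorm_one_sub {V : ℕ → Ω → ℝ} (hV : ∀ n, Integrable (V n) P)
    (h : Tendsto (fun m : ℕ × ℕ => ∫ ω, |V m.1 ω - V m.2 ω| ∂P) atTop (𝓝 0)) :
    Tendsto (fun m : ℕ × ℕ => eLpNorm (V m.1 - V m.2) 1 P) atTop (𝓝 0) :=
  tendsto_eLpNorm_one_of_tendsto_integral_abs (W := fun m : ℕ × ℕ => V m.1 - V m.2)
    (fun m => (hV m.1).sub (hV m.2)) h

variable {f g : (ι → ℝ) → ℝ}

lemma exists_dependsOn_pair {k l : ℕ} (hf : IsCylinder k f) (hg : IsCylinder l g) :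
    ∃ s : Finset ι, DependsOn f (s : Set ι) ∧ DependsOn g (s : Set ι) := by
  obtain ⟨s, hs⟩ := hf.exists_dependsOn
  obtain ⟨t, ht⟩ := hg.exists_dependsOn
  exact ⟨s ∪ t, hs.mono (by simp), ht.mono (by simp)⟩

lemma cylL_sub (hf : IsCylinder 2 f) (hg : IsCylinder 2 g) (x : ι → ℝ) :
    cylL (f - g) x = cylL f x - cylL g x := by
  obtain ⟨s, hs, ht⟩ := exists_dependsOn_pair hf hg
  have h1 (i : ι) : partialDeriv i (f - g) = partialDeriv i f - partialDeriv i g :=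
    funext fun x => partialDeriv_sub (hf.of_le (by norm_num)) (hg.of_le (by norm_num)) i x
  rw [cylL_eq_sum hs, cylL_eq_sum ht, cylL_eq_sum (dependsOn_sub hs ht), ← Finset.sum_sub_distrib]
  refine Finset.sum_congr rfl fun i _ => ?_
  rw [h1, partialDeriv_sub (hf.partialDeriv i) (hg.partialDeriv i), Pi.sub_apply]
  ring

lemma cylGamma_nonneg (f : (ι → ℝ) → ℝ) (x : ι → ℝ) : 0 ≤ cylGamma f x :=
  finsum_nonneg fun _ => sq_nonneg _

lemma sum_sq_partialDeriv_le_cylGamma {k : ℕ} (hf : IsCylinder k f) (t : Finset ι) (x : ι → ℝ) :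
    ∑ i ∈ t, partialDeriv i f x ^ 2 ≤ cylGamma f x := by
  obtain ⟨s, hs⟩ := hf.exists_dependsOn
  have hst : (s : Set ι) ⊆ (t ∪ s : Finset ι) := by simp
  rw [cylGamma_eq_sum (hs.mono hst)]
  exact Finset.sum_le_sum_of_subset_of_nonneg Finset.subset_union_left fun _ _ _ => sq_nonneg _

lemma cylGamma_le_two_mul (hf : IsCylinder 1 f) (hg : IsCylinder 1 g) (x : ι → ℝ) :
    cylGamma f x ≤ 2 * cylGamma (f - g) x + 2 * cylGamma g x := by
  obtain ⟨s, hs, ht⟩ := exists_dependsOn_pair hf hg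
  rw [cylGamma_eq_sum hs, cylGamma_eq_sum ht, cylGamma_eq_sum (dependsOn_sub hs ht),
    Finset.mul_sum, Finset.mul_sum, ← Finset.sum_add_distrib]
  refine Finset.sum_le_sum fun i _ => ?_
  rw [partialDeriv_sub hf hg]
  nlinarith [sq_nonneg (partialDeriv i f x - 2 * partialDeriv i g x)]

/-- Write a² - b² = (a - b)(a + b) and weight the product by θ. Once the energies are bounded,
convergence of E Γ[f_n - f_m] to 0 then makes Γ[f_n] Cauchy in L¹. -/
lemma abs_cylGamma_sub_le (hf : IsCylinder 1 f) (hg : IsCylinder 1 g) {θ : ℝ} (hθ : 0 < θ)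
    (x : ι → ℝ) :
    |cylGamma f x - cylGamma g x| ≤
      (2 * θ)⁻¹ * cylGamma (f - g) x + θ * (cylGamma f x + cylGamma g x) := by
  obtain ⟨s, hs, ht⟩ := exists_dependsOn_pair hf hg
  rw [cylGamma_eq_sum hs, cylGamma_eq_sum ht, cylGamma_eq_sum (dependsOn_sub hs ht),
    ← Finset.sum_sub_distrib, Finset.mul_sum, ← Finset.sum_add_distrib, Finset.mul_sum,
    ← Finset.sum_add_distrib]
  refine (Finset.abs_sum_le_sum_abs _ _).trans (Finset.sum_le_sum fun i _ => ?_)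
  rw [partialDeriv_sub hf hg]
  generalize partialDeriv i f x = a
  generalize partialDeriv i g x = b
  have h1 : (2 * θ)⁻¹ * (a - b) ^ 2 + θ * (a ^ 2 + b ^ 2) - |a ^ 2 - b ^ 2| =
      (2 * θ)⁻¹ * (|a - b| - θ * |a + b|) ^ 2 + θ / 2 * (a - b) ^ 2 := by
    rw [show a ^ 2 - b ^ 2 = (a - b) * (a + b) by ring, abs_mul, ← sq_abs (a - b),
      show a ^ 2 + b ^ 2 = (|a - b| ^ 2 + |a + b| ^ 2) / 2 by rw [sq_abs, sq_abs]; ring]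
    field_simp
    ring
  have h2 : 0 ≤ (2 * θ)⁻¹ * (|a - b| - θ * |a + b|) ^ 2 + θ / 2 * (a - b) ^ 2 := by positivity
  linarith

lemma integrable_cylGamma [IsFiniteMeasure P] (hX : ∀ i, HasLaw (X i) (gaussianReal 0 1) P)
    (hf : IsCylinder 1 f) : Integrable (fun ω => cylGamma f (fun j => X j ω)) P := by
  obtain ⟨s, hs⟩ := hf.exists_dependsOn
  simp_rw [cylGamma_eq_sum hs]
  exact integrable_finsetSum _ fun i _ => ((hf.partialDeriv i).memLp hX 2).integrable_sq

/-- Elements of the second chaos are in the domain of the square field operator. -/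
lemma exists_isCarreDuChamp (hX : ∀ i, HasLaw (X i) (gaussianReal 0 1) P) (hi : iIndepFun X P)
    (hF : InSecondChaos X P F) : ∃ S : Ω → ℝ, IsCarreDuChamp X P F S := by
  have := hi.isProbabilityMeasure
  obtain ⟨hF2, hG2, f, hf, hf1, hf2⟩ := hF
  have hf' (n : ℕ) : IsCylinder 1 (f n) := (hf n).of_le (by norm_num)
  have hm1 (n : ℕ) := (hf n).memLp hX 2 (P := P)
  have hm2 (n : ℕ) := memLp_cylL hX (hf n)
  have c1 := (tendsto_eLpNorm_two_sub_iff hm1).1 (tendsto_eLpNorm_sub_prod one_le_two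
    (V := fun n ω => f n (fun j => X j ω)) (fun n => (hm1 n).aestronglyMeasurable) hF2.aestronglyMeasurable hf1)
  have c2 := (tendsto_eLpNorm_two_sub_iff hm2).1 (tendsto_eLpNorm_sub_prod one_le_two
    (V := fun n ω => cylL (f n) (fun j => X j ω)) (fun n => (hm2 n).aestronglyMeasurable) hG2.aestronglyMeasurable hf2)
  have hE : Tendsto (fun m : ℕ × ℕ => ∫ ω, cylGamma (f m.1 - f m.2) (fun i => X i ω) ∂P) atTop
      (𝓝 0) := by
    -- With h = f_n - f_m, E Γ[h] = -E[h L h] ≤ (E h² + E (L h)²)/2, and both terms tend to 0.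
    have c3 := (c1.add c2).div_const 2
    rw [add_zero, zero_div] at c3
    refine squeeze_zero (fun m => integral_nonneg fun ω => cylGamma_nonneg _ _) (fun m => ?_) c3
    have s1 : Integrable (fun ω => (f m.1 (fun j => X j ω) - f m.2 (fun j => X j ω)) ^ 2) P := ((hm1 m.1).sub (hm1 m.2)).integrable_sq
    have s2 : Integrable (fun ω => (cylL (f m.1) (fun j => X j ω) -
        cylL (f m.2) (fun j => X j ω)) ^ 2) P := ((hm2 m.1).sub (hm2 m.2)).integrable_sq
    rw [integral_cylGamma hX hi ((hf m.1).sub (hf m.2)), ← integral_neg, ← integral_add s1 s2,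
      ← integral_div]
    have hs := (hf m.1).sub (hf m.2)
    refine integral_mono (integrable_mul_of_memLp_two (hs.memLp hX 2) (memLp_cylL hX hs)).neg
      ((s1.fun_add s2).div_const 2) fun ω => ?_
    simp only [Pi.sub_apply, cylL_sub (hf m.1) (hf m.2)]
    generalize f m.1 (fun j => X j ω) - f m.2 (fun j => X j ω) = a
    generalize cylL (f m.1) (fun j => X j ω) - cylL (f m.2) (fun j => X j ω) = b
    nlinarith [sq_nonneg (a + b)]
  have hΓ (n : ℕ) := integrable_cylGamma (P := P) hX (hf' n)
  have hΓs (m : ℕ × ℕ) := integrable_cylGamma (P := P) hX ((hf' m.1).sub (hf' m.2))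
  -- An eventual uniform bound on the energies, by comparison with one fixed element of the Cauchy
  -- sequence.
  obtain ⟨M, N, hM0, hM⟩ : ∃ M : ℝ, ∃ N : ℕ, 0 ≤ M ∧ ∀ n, N ≤ n →
      ∫ ω, cylGamma (f n) (fun i => X i ω) ∂P ≤ M := by
    obtain ⟨⟨N1, N2⟩, hN⟩ := eventually_atTop.1 (hE.eventually_lt_const one_pos)
    refine ⟨2 * 1 + 2 * ∫ ω, cylGamma (f (max N1 N2)) (fun i => X i ω) ∂P, max N1 N2, ?_,
      fun n hn => ?_⟩
    · have : 0 ≤ ∫ ω, cylGamma (f (max N1 N2)) (fun i => X i ω) ∂P :=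
        integral_nonneg fun ω => cylGamma_nonneg _ _
      linarith
    · have h1 := hN (n, max N1 N2) ⟨(le_max_left _ _).trans hn, le_max_right _ _⟩
      have h2 : ∫ ω, cylGamma (f n) (fun i => X i ω) ∂P ≤
          ∫ ω, (2 * cylGamma (f n - f (max N1 N2)) (fun i => X i ω) +
            2 * cylGamma (f (max N1 N2)) (fun i => X i ω)) ∂P :=
        integral_mono (hΓ n) (((hΓs (n, max N1 N2)).const_mul 2).fun_add ((hΓ _).const_mul 2))
          fun ω => cylGamma_le_two_mul (hf' n) (hf' _) _
      rw [integral_add ((hΓs (n, max N1 N2)).const_mul 2) ((hΓ _).const_mul 2), integral_const_mul,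
        integral_const_mul] at h2
      linarith
  have hA : Tendsto (fun m : ℕ × ℕ => ∫ ω, |cylGamma (f m.1) (fun i => X i ω) -
      cylGamma (f m.2) (fun i => X i ω)| ∂P) atTop (𝓝 0) := by
    rw [Metric.tendsto_nhds]
    intro ε hε
    -- Makes the term θ(Γ[f_n] + Γ[f_m]) contribute at most 2θM ≤ ε/2; the energy of the difference
    -- is then required to be below θε.
    set θ := ε / (4 * (M + 1)) with hθ
    have hθ0 : 0 < θ := by positivity
    filter_upwards [hE.eventually_lt_const (mul_pos hθ0 hε), eventually_ge_atTop (N, N)] with m h1 h2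
    rw [Real.dist_0_eq_abs, abs_of_nonneg (integral_nonneg fun ω => abs_nonneg _)]
    have h3 : ∫ ω, |cylGamma (f m.1) (fun i => X i ω) - cylGamma (f m.2) (fun i => X i ω)| ∂P ≤
        ∫ ω, ((2 * θ)⁻¹ * cylGamma (f m.1 - f m.2) (fun i => X i ω) +
          θ * (cylGamma (f m.1) (fun i => X i ω) + cylGamma (f m.2) (fun i => X i ω))) ∂P :=
      integral_mono ((hΓ m.1).sub (hΓ m.2)).abs
        (((hΓs m).const_mul _).fun_add (((hΓ m.1).fun_add (hΓ m.2)).const_mul _))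
        fun ω => abs_cylGamma_sub_le (hf' m.1) (hf' m.2) hθ0 _
    rw [integral_add ((hΓs m).const_mul _) (((hΓ m.1).fun_add (hΓ m.2)).const_mul _),
      integral_const_mul, integral_const_mul, integral_add (hΓ m.1) (hΓ m.2)] at h3
    have h4 := hM m.1 h2.1
    have h5 := hM m.2 h2.2
    have h6 : (2 * θ)⁻¹ * ∫ ω, cylGamma (f m.1 - f m.2) (fun i => X i ω) ∂P < ε / 2 := by
      rw [inv_mul_lt_iff₀ (by positivity)]
      linarith
    have h7 : θ * (2 * M) ≤ ε / 2 := by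
      rw [hθ, div_mul_eq_mul_div, div_le_div_iff₀ (by positivity) (by norm_num)]
      nlinarith
    have h8 : θ * (∫ ω, cylGamma (f m.1) (fun i => X i ω) ∂P +
        ∫ ω, cylGamma (f m.2) (fun i => X i ω) ∂P) ≤ θ * (2 * M) := by
      gcongr
      linarith
    linarith
  have c4 := tendsto_eLpNorm_one_sub (V := fun n ω => cylGamma (f n) (fun i => X i ω)) hΓ hA
  obtain ⟨S, hS, hS'⟩ := exists_tendsto_eLpNorm_of_cauchy (q := 1)
    (V := fun n ω => cylGamma (f n) (fun i => X i ω))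
    (fun n => memLp_one_iff_integrable.2 (hΓ n)) c4
  exact ⟨S, hF2, memLp_one_iff_integrable.1 hS, f, hf', hf1, hE, hS'⟩

/-- One squared partial derivative is dominated by the square field, so each partial derivative is
Cauchy in L². -/
lemma exists_gradient (hX : ∀ i, HasLaw (X i) (gaussianReal 0 1) P) [IsFiniteMeasure P]
    {f : ℕ → (ι → ℝ) → ℝ} (hf : ∀ n, IsCylinder 1 (f n))
    (hE : Tendsto (fun m : ℕ × ℕ => ∫ ω, cylGamma (f m.1 - f m.2) (fun i => X i ω) ∂P) atTop (𝓝 0))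
    (i : ι) : ∃ D, MemLp D 2 P ∧ Tendsto (fun n => eLpNorm (fun ω =>
      partialDeriv i (f n) (fun j => X j ω) - D ω) 2 P) atTop (𝓝 0) := by
  have hm (n : ℕ) := ((hf n).partialDeriv i).memLp hX 2 (P := P)
  refine exists_tendsto_eLpNorm_of_cauchy hm ((tendsto_eLpNorm_two_sub_iff hm).2 ?_)
  refine squeeze_zero (fun m => integral_nonneg fun ω => sq_nonneg _) (fun m => ?_) hE
  refine integral_mono ((hm m.1).sub (hm m.2)).integrable_sq
    (integrable_cylGamma hX ((hf m.1).sub (hf m.2))) fun ω => ?_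
  have := sum_sq_partialDeriv_le_cylGamma ((hf m.1).sub (hf m.2)) {i} fun j => X j ω
  rwa [Finset.sum_singleton, partialDeriv_sub (hf m.1) (hf m.2)] at this

lemma hasDerivAt_hermiteForm {A : ι → ι → ℝ} (hA : ∀ i j, A i j = A j i) {t : Finset ι} {i : ι}
    (hit : i ∈ t) (x : ι → ℝ) (u : ℝ) :
    HasDerivAt (fun u => hermiteForm A t (Function.update x i u))
      (∑ j ∈ t, 2 * A i j * Function.update x i u j) u := by
  have h0 (a : ι) : HasDerivAt (fun u => Function.update x i u a) ((Pi.single i 1 : ι → ℝ) a) u := by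
    rcases eq_or_ne a i with rfl | ha
    · simpa using hasDerivAt_id' u
    · simpa [ha] using hasDerivAt_const u (x a)
  unfold hermiteForm
  refine (HasDerivAt.fun_sum fun a _ => HasDerivAt.fun_sum fun b _ =>
    (((h0 a).fun_mul (h0 b)).sub_const _).const_mul (A a b)).congr_deriv ?_
  generalize Function.update x i u = y
  simp only [mul_add, Finset.sum_add_distrib]
  have e1 : ∑ a ∈ t, ∑ b ∈ t, A a b * ((Pi.single i 1 : ι → ℝ) a * y b) = ∑ j ∈ t, A i j * y j := by
    rw [Finset.sum_eq_single_of_mem i hit fun a _ ha => by simp [ha]]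
    simp
  have e2 : ∑ a ∈ t, ∑ b ∈ t, A a b * (y a * (Pi.single i 1 : ι → ℝ) b) = ∑ j ∈ t, A i j * y j := by
    rw [Finset.sum_comm, Finset.sum_eq_single_of_mem i hit fun a _ ha => by simp [ha]]
    exact Finset.sum_congr rfl fun j _ => by simp [hA i j]
  rw [e1, e2, ← Finset.sum_add_distrib]
  exact Finset.sum_congr rfl fun j _ => by ring

/-- The conditional expectation of the gradient given finitely many coordinates is linear. -/
lemma trigOrthogonal_gradient (hX : ∀ i, HasLaw (X i) (gaussianReal 0 1) P) (hi : iIndepFun X P)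
    (hF : InSecondChaos X P F) {f : ℕ → (ι → ℝ) → ℝ} (hf : ∀ n, IsCylinder 1 (f n))
    (hfF : Tendsto (fun n => eLpNorm (fun ω => f n (fun i => X i ω) - F ω) 2 P) atTop (𝓝 0))
    {i : ι} {D : Ω → ℝ} (hD : MemLp D 2 P) (hfD : Tendsto (fun n => eLpNorm (fun ω =>
      partialDeriv i (f n) (fun j => X j ω) - D ω) 2 P) atTop (𝓝 0)) {t : Finset ι} (hit : i ∈ t) :
    TrigOrthogonal X P t (fun ω => D ω - ∑ j ∈ t, 2 * coeff X P F i j * X j ω) := by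
  have := hi.isProbabilityMeasure
  have hXi := memLp_of_hasLaw (hX i) (q := 2) (by simp)
  have hY : MemLp (fun ω => ∑ j ∈ t, 2 * coeff X P F i j * X j ω) 2 P :=
    memLp_sum_family hX t _ (by simp)
  have hH := memLp_hermiteForm hX (coeff X P F) t (P := P)
  -- In the limit, E[D g] = E[F (X_i g - ∂_i g)]. As i ∈ t, the weight depends on t only, so F may
  -- be replaced by its quadratic form; integrating by parts back puts the derivative on that form.
  have key {g : (ι → ℝ) → ℝ} (hg : IsCylinder 1 g) (hgt : DependsOn g (t : Set ι)) :
      ∫ ω, (D ω - ∑ j ∈ t, 2 * coeff X P F i j * X j ω) * g (fun j => X j ω) ∂P = 0 := by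
    have hg2 := hg.memLp hX 2 (P := P)
    have hW : MemLp (fun ω => X i ω * g (fun j => X j ω) - partialDeriv i g (fun j => X j ω)) 2 P :=
      (hg.memLp_mul hX hXi).sub ((hg.partialDeriv i).memLp hX 2)
    have t1 := tendsto_integral_mul_of_eLpNorm (fun n => ((hf n).partialDeriv i).memLp hX 2) hD hg2
      hfD
    have t2 := tendsto_integral_mul_of_eLpNorm (fun n => (hf n).memLp hX 2) hF.1 hW hfF
    simp_rw [fun n => integral_partialDeriv_mul hX hi (hf n) hg i] at t1
    have e1 := tendsto_nhds_unique t1 t2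
    have e2 := integral_mul_eq_integral_hermiteForm_mul hX hi hF (t := t)
      (h := fun x => x i * g x - partialDeriv i g x)
      (fun x y hxy => by
        simp only [hgt hxy, hxy i hit, dependsOn_partialDeriv hgt i hxy])
      (((measurable_pi_apply i).mul hg.measurable).sub (hg.partialDeriv i).measurable)
      (integrable_mul_of_memLp_two hF.1 hW) (integrable_mul_of_memLp_two hH hW)
    have e3 := integral_mul_partialDeriv hX hi (i := i) (v := hermiteForm (coeff X P F) t)
      (v' := fun x => ∑ j ∈ t, 2 * coeff X P F i j * x j) (s := t) (dependsOn_hermiteForm _ t)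
      (fun x y hxy => Finset.sum_congr rfl fun j hj => by rw [hxy j hj])
      (measurable_hermiteForm _ t) (by fun_prop) (hasDerivAt_hermiteForm (coeff_comm F) hit)
      hH hY hg
    simp_rw [sub_mul]
    rw [integral_sub (integrable_mul_of_memLp_two hD hg2) (integrable_mul_of_memLp_two hY hg2),
      e1, e2, e3, sub_self]
  exact fun ξ _ => ⟨key (IsCylinder.cos_sum 1 t ξ) (dependsOn_comp_sum _ t ξ),
    key (IsCylinder.sin_sum 1 t ξ) (dependsOn_comp_sum _ t ξ)⟩

/-- The linear forms `2 ∑ⱼ Aᵢⱼ Xⱼ` approximate the gradient. -/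
lemma tendsto_linear_gradient (hX : ∀ i, HasLaw (X i) (gaussianReal 0 1) P) (hi : iIndepFun X P)
    (hF : InSecondChaos X P F) {f : ℕ → (ι → ℝ) → ℝ} (hf : ∀ n, IsCylinder 1 (f n))
    (hfF : Tendsto (fun n => eLpNorm (fun ω => f n (fun i => X i ω) - F ω) 2 P) atTop (𝓝 0))
    {i : ι} {D : Ω → ℝ} (hD : MemLp D 2 P) (hfD : Tendsto (fun n => eLpNorm (fun ω =>
      partialDeriv i (f n) (fun j => X j ω) - D ω) 2 P) atTop (𝓝 0)) {t : ℕ → Finset ι}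
    (hit : ∀ n, i ∈ t n) (ht : ∀ n, DependsOn (f n) (t n : Set ι)) :
    Tendsto (fun n => eLpNorm (fun ω => ∑ j ∈ t n, 2 * coeff X P F i j * X j ω - D ω) 2 P) atTop
      (𝓝 0) := by
  have := hi.isProbabilityMeasure
  refine tendsto_of_tendsto_of_tendsto_of_le_of_le tendsto_const_nhds hfD
    (fun _ => zero_le) fun n => ?_
  have hY : MemLp (fun ω => ∑ j ∈ t n, 2 * coeff X P F i j * X j ω) 2 P :=
    memLp_sum_family hX (t n) _ (by simp)
  -- The linear form is the best approximation of D by functions of the block, hence at least as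
  -- close to D as ∂_i f_n.
  have hle := (trigOrthogonal_gradient hX hi hF hf hfF hD hfD (hit n)).eLpNorm_le hX (hD.sub hY)
    (h := fun x => ∑ j ∈ t n, 2 * coeff X P F i j * x j - partialDeriv i (f n) x)
    (fun x y hxy => by
      simp only [dependsOn_partialDeriv (ht n) i hxy]
      congr 1
      exact Finset.sum_congr rfl fun j hj => by rw [hxy j hj])
    (Measurable.sub (by fun_prop) ((hf n).partialDeriv i).measurable)
    (hY.sub (((hf n).partialDeriv i).memLp hX 2))
  rw [← eLpNorm_neg]
  refine le_trans (le_of_eq ?_) (hle.trans (le_of_eq ?_))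
  · congr 1
    ext ω
    simp
  · rw [← eLpNorm_neg]
    congr 1
    ext ω
    simp only [Pi.neg_apply]
    ring

end Gradient

end WienerChaos

/-! ### Tail of the square field and conclusion -/

namespace WienerChaos

section Conclusion

open scoped Classical

variable {ι Ω : Type*} [MeasurableSpace Ω] {P : Measure Ω} {X : ι → Ω → ℝ} {F : Ω → ℝ}

lemma tendsto_measureReal_le_abs_sub [IsFiniteMeasure P] {V : ℕ → Ω → ℝ} {D : Ω → ℝ}
    (hV : ∀ n, AEStronglyMeasurable (V n) P) (hD : AEStronglyMeasurable D P)
    (h : Tendsto (fun n => eLpNorm (fun ω => V n ω - D ω) 1 P) atTop (𝓝 0)) {η : ℝ} (hη : 0 < η) :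
    Tendsto (fun n => P.real {ω | η ≤ |V n ω - D ω|}) atTop (𝓝 0) := by
  have h1 : TendstoInMeasure P V atTop D :=
    tendstoInMeasure_of_tendsto_eLpNorm one_ne_zero hV hD h
  exact tendstoInMeasure_iff_measureReal_norm.1 h1 η hη

/-- Lower tail of the squared norm of the conditional gradient. -/
lemma measureReal_linear_gradient_lt_le (hX : ∀ i, HasLaw (X i) (gaussianReal 0 1) P)
    (hi : iIndepFun X P) (hF : InSecondChaos X P F) {p : ℕ} (hp : 1 ≤ p) {c : ℝ} (hc : 0 < c)
    (hκ : ∫ ω, F ω ^ 4 ∂P - 3 * c ^ 2 ≤ 12 * c ^ 2 * (2 / (2 ^ p * ((p + 1).factorial : ℝ))))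
    {s t : Finset ι} (hst : s ⊆ t) (hs : c < 2 * ∑ i ∈ s, ∑ j ∈ s, coeff X P F i j ^ 2)
    {ε : ℝ} (hε : 0 < ε) :
    P.real {ω | ∑ i ∈ s, (∑ j ∈ t, 2 * coeff X P F i j * X j ω) ^ 2 < ε} ≤
      Real.sqrt (2 * (p.factorial : ℝ) / 2 ^ p * (ε / (2 * c)) ^ p) := by
  set A := coeff X P F with hA
  set T := ∑ i ∈ s, ∑ j ∈ t, (2 * A i j) ^ 2 with hT
  have hTc : 2 * c ≤ T := by
    have : ∑ i ∈ s, ∑ j ∈ s, (2 * A i j) ^ 2 ≤ T :=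
      Finset.sum_le_sum fun i _ => Finset.sum_le_sum_of_subset_of_nonneg hst fun _ _ _ => sq_nonneg _
    simp_rw [mul_pow, ← Finset.mul_sum] at this
    linarith
  have hT0 : 0 < T := by linarith
  have hw : ∑ i ∈ s, ∑ j ∈ s, A i j ^ 2 ≤ ∑ i ∈ t, ∑ j ∈ t, A i j ^ 2 :=
    (Finset.sum_le_sum fun i _ =>
      Finset.sum_le_sum_of_subset_of_nonneg hst fun _ _ _ => sq_nonneg _).trans
      (Finset.sum_le_sum_of_subset_of_nonneg hst fun _ _ _ => by positivity)
  have hq : ∑ i ∈ s, ∑ j ∈ s, (∑ k ∈ t, 2 * A i k * (2 * A j k)) ^ 2 ≤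
      T ^ 2 * (2 / (2 ^ p * ((p + 1).factorial : ℝ))) := by
    have h1 : ∑ i ∈ s, ∑ j ∈ s, (∑ k ∈ t, 2 * A i k * (2 * A j k)) ^ 2 =
        16 * ∑ i ∈ s, ∑ j ∈ s, (∑ k ∈ t, A i k * A j k) ^ 2 := by
      simp_rw [Finset.mul_sum]
      refine Finset.sum_congr rfl fun i _ => Finset.sum_congr rfl fun j _ => ?_
      rw [show (16 : ℝ) = 4 ^ 2 by norm_num, ← mul_pow, Finset.mul_sum]
      congr 1
      exact Finset.sum_congr rfl fun k _ => by ring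
    have h2 : ∑ i ∈ s, ∑ j ∈ s, (∑ k ∈ t, A i k * A j k) ^ 2 ≤
        ∑ i ∈ t, ∑ j ∈ t, (∑ k ∈ t, A i k * A j k) ^ 2 :=
      (Finset.sum_le_sum fun i _ =>
        Finset.sum_le_sum_of_subset_of_nonneg hst fun _ _ _ => sq_nonneg _).trans
        (Finset.sum_le_sum_of_subset_of_nonneg hst fun _ _ _ => by positivity)
    have h3 := sum_sq_contraction_le_fourth_moment hX hi hF t
    rw [← hA] at h3
    have h4 : (2 * c) ^ 2 * (2 / (2 ^ p * ((p + 1).factorial : ℝ))) ≤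
        T ^ 2 * (2 / (2 ^ p * ((p + 1).factorial : ℝ))) := by gcongr
    -- The block carries ∑ A_ij² ≥ c/2, so 16 ∑ (∑_k A_ik A_jk)² ≤ (E F⁴ - 3c²)/3, and `hκ` bounds
    -- this by 4c²·2/(2^p (p+1)!), while T ≥ 2c.
    have h5 : (c / 2) ^ 2 ≤ (∑ i ∈ t, ∑ j ∈ t, A i j ^ 2) ^ 2 := by
      gcongr
      linarith
    rw [h1]
    linarith
  have key := measureReal_sum_sq_lt_le (X := fun j : t => X j) (fun j => hX j)
    (hi.precomp Subtype.val_injective) (fun (i : s) (j : t) => 2 * A i j) hT0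
    (by rw [hT, ← Finset.sum_coe_sort s]
        exact Finset.sum_congr rfl fun i _ => by rw [← Finset.sum_coe_sort t]) hp
    (by
      refine le_trans (le_of_eq ?_) hq
      simp_rw [← Finset.sum_coe_sort s, ← Finset.sum_coe_sort t]) hε
  refine le_trans (le_of_eq ?_) (key.trans ?_)
  · congr 1
    ext ω
    simp_rw [← Finset.sum_coe_sort s, ← Finset.sum_coe_sort t]
  · refine Real.sqrt_le_sqrt ?_
    gcongr

/-- Only a fixed finite set s of derivatives, carrying variance more than c, is kept: the square
field dominates their squares. These are limits in probability of squares of linear forms in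
finitely many Gaussians, for which the small ball estimate is available. -/
lemma measureReal_carreDuChamp_lt_le (hX : ∀ i, HasLaw (X i) (gaussianReal 0 1) P)
    (hi : iIndepFun X P) (hF : InSecondChaos X P F) (hF1 : ∫ ω, F ω ^ 2 ∂P = 1) {p : ℕ}
    (hp : 1 ≤ p) {c : ℝ} (hc : 0 < c) (hc1 : c < 1)
    (hκ : ∫ ω, F ω ^ 4 ∂P - 3 * c ^ 2 ≤ 12 * c ^ 2 * (2 / (2 ^ p * ((p + 1).factorial : ℝ))))
    {S : Ω → ℝ} (hS : IsCarreDuChamp X P F S) {ε η : ℝ} (hε : 0 < ε) (hη : 0 < η) :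
    P.real {ω | S ω < ε} ≤
      Real.sqrt (2 * (p.factorial : ℝ) / 2 ^ p * ((ε + η) / (2 * c)) ^ p) := by
  have := hi.isProbabilityMeasure
  obtain ⟨hF2, hSi, f, hf, hfF, hE, hΓ⟩ := hS
  obtain ⟨s, hs⟩ := exists_lt_two_mul_sum_coeff_sq hX hi hF (by rwa [hF1])
  choose D hD hfD using fun i => exists_gradient hX hf hE i
  choose u hu using fun n => (hf n).exists_dependsOn
  have hsu (n : ℕ) : s ⊆ s ∪ u n := Finset.subset_union_left
  have hY (i : ι) (n : ℕ) : MemLp (fun ω => ∑ j ∈ s ∪ u n, 2 * coeff X P F i j * X j ω) 2 P :=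
    memLp_sum_family hX _ _ (by simp)
  have hd (i : ι) (n : ℕ) := ((hf n).partialDeriv i).memLp hX 2 (P := P)
  have l1 : Tendsto (fun n => eLpNorm (fun ω =>
      ∑ i ∈ s, (∑ j ∈ s ∪ u n, 2 * coeff X P F i j * X j ω) ^ 2 - ∑ i ∈ s, D i ω ^ 2) 1 P)
      atTop (𝓝 0) :=
    tendsto_eLpNorm_one_sum s
      (W := fun i n ω => (∑ j ∈ s ∪ u n, 2 * coeff X P F i j * X j ω) ^ 2)
      (D := fun i ω => D i ω ^ 2)
      (fun i _ n => ((hY i n).aestronglyMeasurable.pow 2).sub ((hD i).aestronglyMeasurable.pow 2))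
      fun i his => tendsto_eLpNorm_sq_sub_sq (hY i) (hD i)
        (tendsto_linear_gradient hX hi hF hf hfF (hD i) (hfD i) (fun n => hsu n his)
          fun n => (hu n).mono (by simp))
  have l2 : Tendsto (fun n => eLpNorm (fun ω =>
      ∑ i ∈ s, partialDeriv i (f n) (fun j => X j ω) ^ 2 - ∑ i ∈ s, D i ω ^ 2) 1 P)
      atTop (𝓝 0) :=
    tendsto_eLpNorm_one_sum s
      (W := fun i n ω => partialDeriv i (f n) (fun j => X j ω) ^ 2)
      (D := fun i ω => D i ω ^ 2)
      (fun i _ n => ((hd i n).aestronglyMeasurable.pow 2).sub ((hD i).aestronglyMeasurable.pow 2))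
      fun i _ => tendsto_eLpNorm_sq_sub_sq (hd i) (hD i) (hfD i)
  have hDs : AEStronglyMeasurable (fun ω => ∑ i ∈ s, D i ω ^ 2) P :=
    Finset.aestronglyMeasurable_fun_sum s fun i _ => (hD i).aestronglyMeasurable.pow 2
  have hη3 : 0 < η / 3 := by positivity
  have m1 := tendsto_measureReal_le_abs_sub
    (V := fun n ω => ∑ i ∈ s, (∑ j ∈ s ∪ u n, 2 * coeff X P F i j * X j ω) ^ 2) (fun n =>
      Finset.aestronglyMeasurable_fun_sum s fun i _ => (hY i n).aestronglyMeasurable.pow 2) hDs l1 hη3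
  have m2 := tendsto_measureReal_le_abs_sub
    (V := fun n ω => ∑ i ∈ s, partialDeriv i (f n) (fun j => X j ω) ^ 2) (fun n =>
      Finset.aestronglyMeasurable_fun_sum s fun i _ => (hd i n).aestronglyMeasurable.pow 2) hDs l2 hη3
  have m3 := tendsto_measureReal_le_abs_sub
    (fun n => (integrable_cylGamma hX (hf n)).aestronglyMeasurable) hSi.aestronglyMeasurable hΓ hη3
  have hlim := (((tendsto_const_nhds (x := Real.sqrt (2 * (p.factorial : ℝ) / 2 ^ p *
    ((ε + η) / (2 * c)) ^ p))).add m1).add m2).add m3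
  simp only [add_zero] at hlim
  refine ge_of_tendsto' hlim fun n => ?_
  have hb := measureReal_linear_gradient_lt_le hX hi hF hp hc hκ (hsu n) hs (add_pos hε hη)
  refine le_trans ?_ (add_le_add_left (add_le_add_left (add_le_add_left hb _) _) _)
  -- If S < ε and the three approximations are each within η/3, the sum of squared linear forms is
  -- below ε + η.
  refine le_trans (measureReal_mono (fun ω hω => ?_) (measure_ne_top _ _))
    ((measureReal_union_le _ _).trans (add_le_add_left ((measureReal_union_le _ _).trans
      (add_le_add_left (measureReal_union_le _ _) _)) _))
  simp only [Set.mem_union, Set.mem_ofPred_eq] at hω ⊢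
  by_contra hcon
  push Not at hcon
  obtain ⟨⟨⟨h1, h2⟩, h3⟩, h4⟩ := hcon
  have h5 := sum_sq_partialDeriv_le_cylGamma (hf n) s fun j => X j ω
  rw [abs_lt] at h2 h3 h4
  linarith [h2.2, h3.1, h4.2]

/-- Polynomial lower tail of the square field of an element of the second chaos. -/
lemma measureReal_carreDuChamp_lt_le_rpow (hX : ∀ i, HasLaw (X i) (gaussianReal 0 1) P)
    (hi : iIndepFun X P) (hF : InSecondChaos X P F) (hF1 : ∫ ω, F ω ^ 2 ∂P = 1) {p : ℕ}
    (hp : 1 ≤ p) (hκ : kappa4 P F < 24 / (2 ^ p * ((p + 1).factorial : ℝ)))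
    {S : Ω → ℝ} (hS : IsCarreDuChamp X P F S) {ε : ℝ} (hε : 0 < ε) :
    P.real {ω | S ω < ε} ≤
      Real.sqrt (2 * (p.factorial : ℝ)) / 2 ^ p * ε ^ ((p : ℝ) / 2) := by
  -- The bound for c = 1 - δ and η = δ, evaluated at δ = 0; the two factors 2^p under the root
  -- combine into 2^p outside.
  have hval : Real.sqrt (2 * (p.factorial : ℝ) / 2 ^ p * ((ε + 0) / (2 * (1 - 0))) ^ p) =
      Real.sqrt (2 * (p.factorial : ℝ)) / 2 ^ p * ε ^ ((p : ℝ) / 2) := by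
    rw [show 2 * (p.factorial : ℝ) / 2 ^ p * ((ε + 0) / (2 * (1 - 0))) ^ p =
      2 * (p.factorial : ℝ) * ε ^ p / (2 ^ p) ^ 2 by rw [add_zero, sub_zero, mul_one, div_pow]; ring,
      Real.sqrt_div' _ (by positivity), Real.sqrt_sq (by positivity),
      Real.sqrt_mul (by positivity), Real.sqrt_eq_rpow (ε ^ p), ← Real.rpow_natCast ε p,
      ← Real.rpow_mul hε.le]
    ring_nf
  rw [← hval]
  have hcont : ContinuousAt (fun δ : ℝ => Real.sqrt (2 * (p.factorial : ℝ) / 2 ^ p *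
      ((ε + δ) / (2 * (1 - δ))) ^ p)) 0 := by
    have : ContinuousAt (fun δ : ℝ => (ε + δ) / (2 * (1 - δ))) 0 := by
      fun_prop (disch := norm_num)
    exact ((this.pow p).const_mul _).sqrt
  refine ge_of_tendsto (hcont.tendsto.mono_left (nhdsWithin_le_nhds (s := Set.Ioi 0))) ?_
  -- The strict inequality on κ₄ is an open condition, so it persists for c = 1 - δ slightly below
  -- 1.
  have hcond : ∀ᶠ δ : ℝ in 𝓝 0, ∫ ω, F ω ^ 4 ∂P - 3 * (1 - δ) ^ 2 <
      12 * (1 - δ) ^ 2 * (2 / (2 ^ p * ((p + 1).factorial : ℝ))) := by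
    refine ContinuousAt.eventually_lt (by fun_prop) (by fun_prop) ?_
    have : kappa4 P F = ∫ ω, F ω ^ 4 ∂P - 3 := rfl
    rw [this] at hκ
    calc _ = ∫ ω, F ω ^ 4 ∂P - 3 := by ring
      _ < _ := hκ
      _ = _ := by ring
  filter_upwards [nhdsWithin_le_nhds hcond, self_mem_nhdsWithin,
    nhdsWithin_le_nhds (Iio_mem_nhds (zero_lt_one (α := ℝ)))] with δ h1 h2 h3
  have h2 : 0 < δ := h2
  have h3 : δ < 1 := h3
  exact measureReal_carreDuChamp_lt_le hX hi hF hF1 hp (by linarith) (by linarith) h1.le hS hε h2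

lemma ae_pos_of_measureReal_lt_le [IsFiniteMeasure P] {S : Ω → ℝ} {C a : ℝ} (ha : 0 < a)
    (h : ∀ ε, 0 < ε → P.real {ω | S ω < ε} ≤ C * ε ^ a) : ∀ᵐ ω ∂P, 0 < S ω := by
  rw [ae_iff]
  have hz : P.real {ω | ¬0 < S ω} ≤ 0 := by
    have hcont : Tendsto (fun ε : ℝ => C * ε ^ a) (𝓝[>] 0) (𝓝 0) := by
      have := ((Real.continuousAt_rpow_const 0 a (Or.inr ha.le)).const_mul C).tendsto.mono_left
        (nhdsWithin_le_nhds (s := Set.Ioi (0 : ℝ)))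
      simpa [Real.zero_rpow ha.ne'] using this
    refine ge_of_tendsto hcont ?_
    filter_upwards [self_mem_nhdsWithin] with ε hε
    refine (measureReal_mono (fun ω hω => ?_) (measure_ne_top _ _)).trans (h ε hε)
    simp only [Set.mem_ofPred_eq, not_lt] at hω ⊢
    exact lt_of_le_of_lt hω hε
  exact (measureReal_eq_zero_iff).1 (le_antisymm hz measureReal_nonneg)

end Conclusion

end WienerChaos

theorem theorem1 {ι : Type*} [Countable ι] {Ω : Type*} [MeasurableSpace Ω]
    (P : Measure Ω) [IsProbabilityMeasure P]
    (X : ι → Ω → ℝ) (hX_law : ∀ i, HasLaw (X i) (gaussianReal 0 1) P) (hX_indep : iIndepFun X P)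
    (F : Ω → ℝ) (hF : WienerChaos.InSecondChaos X P F) (hF_var : ∫ ω, (F ω) ^ 2 ∂P = 1)
    (p : ℕ) (hp : 1 ≤ p)
    (hκ : WienerChaos.kappa4 P F < 24 / (2 ^ p * (Nat.factorial (p + 1) : ℝ))) :
    (∃ S : Ω → ℝ, WienerChaos.IsCarreDuChamp X P F S) ∧
    ∀ S : Ω → ℝ, WienerChaos.IsCarreDuChamp X P F S →
      (∀ᵐ ω ∂P, 0 < S ω) ∧
      (∀ q : ℝ, 0 < q → q < (p : ℝ) / 2 → MemLp (fun ω => 1 / S ω) (ENNReal.ofReal q) P) ∧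
      (∀ ε : ℝ, 0 < ε →
        P.real {ω | S ω < ε} ≤
          Real.sqrt (2 * (Nat.factorial p : ℝ)) / 2 ^ p * ε ^ ((p : ℝ) / 2)) := by
  refine ⟨WienerChaos.exists_isCarreDuChamp hX_law hX_indep hF, fun S hS => ?_⟩
  have htail (ε : ℝ) (hε : 0 < ε) := WienerChaos.measureReal_carreDuChamp_lt_le_rpow hX_law
    hX_indep hF hF_var hp hκ hS hε
  have hp0 : (0 : ℝ) < (p : ℝ) / 2 := by
    have : (1 : ℝ) ≤ p := by exact_mod_cast hp
    positivity
  have hpos := WienerChaos.ae_pos_of_measureReal_lt_le hp0 htail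
  exact ⟨hpos, fun q hq hqp => WienerChaos.memLp_one_div_of_measureReal_lt_le
    hS.2.1.aestronglyMeasurable hpos htail hq hqp, htail⟩
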